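/- **Setting.** Let $k,n\ge 0$ be integers with $n\ge 2k$. A *diagram* is a set partition of $\{1,\dots,k\}\cup\{1',\dots,k'\}$ (top row $1,\dots,k$, bottom row $1',\dots,k'$). The partition algebra $\mathbf P_k(n)$ over $\mathbb C$ has the diagrams as basis and product $d_1d_2=n^{\ell(d_1,d_2)}\,d_1\circ d_2$, where $d_1\circ d_2$ is concatenation ($d_1$ above $d_2$) and $\ell(d_1,d_2)$ is the number of connected components deleted from the middle row. Let $\mathsf A_k$ be $\mathbf P_k(n)$ itself or the span of the set $\mathcal A_k$ of diagrams satisfying one of the following conditions: every block has exactly one top and one bottom vertex ($\mathbb C\mathsf S_k$); at most one top and at most one bottom vertex ($\mathbf R_k$); size $2$ ($\mathbf B_k(n)$); size $1$ or $2$ ($\mathbf{RB}_k(n)$); the diagram is planar ($\mathbf{PP}_k(n)$); or one of the first four conditions together with planarity ($\mathbb C\mathbf 1_k$, $\mathbf{PR}_k$, $\mathbf{TL}_k(n)$, $\mathbf M_k(n)$ respectively). The rank of a diagram is its number of propagating blocks (blocks meeting both rows). Let $\lambda\vdash n$, let $\lambda^*$ be $\lambda$ with its first row removed, and let $m=|\lambda^*|$.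 Assume that $\lambda$ is in the index set of $\mathsf A_k$: $m\le k$ for $\mathbf P_k(n),\mathbf R_k,\mathbf{RB}_k(n)$; $m\le k$ and $k-m$ even for $\mathbf B_k(n)$; $m=k$ for $\mathbb C\mathsf S_k$; and for the planar algebras moreover $\lambda^*$ has at most one row ($m\le k$ for $\mathbf{PP}_k(n),\mathbf{PR}_k,\mathbf M_k(n)$; $m\le k$, $k-m$ even for $\mathbf{TL}_k(n)$; $m=k$ for $\mathbb C\mathbf 1_k$). *The module $\mathsf A_k^\lambda$.* Blocks are ordered by their maximal entries. Let $d^T$ be the reflection of $d$ exchanging the rows, and let $\mathcal W^m_{\mathcal A_k}$ be the set of $w\in\mathcal A_k$ with $w=w^T$ that have rank $m$ and each of whose propagating blocks contains, with every vertex, its mirror image. For a Young tableau $t$ of shape $\mu\vdash m$ put $\mathsf n_t=\sigma_tp_\mu\in\mathbb C\mathsf S_m$, where $t_c$ is the column-reading tableau, $\sigma_t(t_c)=t$, and $p_\mu=\sum_{\gamma\in C(t_c),\,\rho\in R(t_c)}\operatorname{sign}(\gamma)\gamma\rho$ with $C(t_c)$, $R(t_c)$ the column and row groups. Let $\mathsf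 S_m^{\mu}=(\mathbb C\mathsf S_m)p_\mu$. On $\mathsf A_k^\lambda=\mathbb C\mathcal W^m_{\mathcal A_k}\otimes\mathsf S_m^{\lambda^*}$ let $d\in\mathcal A_k$ act by $d\cdot(w\otimes v)=n^{\ell(d,w)}(d\circ w\circ d^T)\otimes\sigma_{d,w}v$ if $d\circ w\circ d^T$ has rank $m$, and by $0$ otherwise; here $\sigma_{d,w}$ is the permutation such that the $i$-th propagating block of $w$ is carried by $d$ to the $\sigma_{d,w}(i)$-th one of $d\circ w\circ d^T$. *Set-partition tableaux.* A set-partition tableau $T$ of shape $\lambda$ is a bijective filling of the boxes of $\lambda/[n-t]$ with the blocks of a set partition $\pi$ of $\{1,\dots,k\}$ into $t$ blocks; the blocks below the first row are called propagating, those in the first row non-propagating. It is standard if its rows and columns increase. Let $\mathsf P_k^\lambda$ have basis $\{\mathsf N_T\}$, $T$ standard. If the first row of $T$ increases but $T$ need not be standard, let $t$ be the Young tableau of shape $\lambda^*$ having $i$ where $T$ has its $i$-th propagating block. If $\mathsf n_t=\sum_sc_s\mathsf n_s$ with $s$ standard and $c_s\in\mathbb Z$, put $\mathsf N_T=\sum_sc_s\mathsf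 N_{T_s}$, where $T_s$ has the same propagating and non-propagating blocks as $T$ and Young tableau $s$. For a diagram $d$, the tableau $d(T)$ is formed by placing $d$ above $\pi$: each propagating block of $T$ is replaced by the block of the top row to which it is connected, and the other blocks of the top row are put in increasing order in the first row. If $d(T)$ is a set-partition tableau, then $d\cdot\mathsf N_T=n^{\ell(d,T)}\mathsf N_{d(T)}$, where $\ell(d,T)$ is the number of components not meeting the top row; otherwise $d\cdot\mathsf N_T=0$. *Restricted tableaux.* Let $w_T$ be the symmetric diagram whose propagating and non-propagating blocks are those of $T$, and let $\mathcal{SSPT}(\lambda,\mathcal W^m_{\mathcal A_k})$ be the set of standard $T$ of shape $\lambda$ with $w_T\in\mathcal W^m_{\mathcal A_k}$. **Theorem.** 1. For every Young tableau $t$ of shape $\lambda^*$ there are unique integers $c_s$ ($s$ a standard Young tableau of shape $\lambda^*$) with $\mathsf n_t=\sum_s c_s\mathsf n_s$. Thus $\mathsf N_T$ is well defined. 2. A standard $T$ is in $\mathcal{SSPT}(\lambda,\mathcal W^m_{\mathcal A_k})$ if and only if: (for $\mathsf A_k\neq\mathbf P_k(n),\mathbf{PP}_k(n)$) its propagating blocks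 are singletons and its non-propagating blocks are singletons for $\mathbf R_k,\mathbf{PR}_k$, pairs for $\mathbf B_k(n),\mathbf{TL}_k(n)$, singletons or pairs for $\mathbf{RB}_k(n),\mathbf M_k(n)$, and absent for $\mathbb C\mathsf S_k,\mathbb C\mathbf 1_k$; and, for the planar algebras, $w_T$ is planar. (For $\mathbf P_k(n)$ there is no condition.) 3. $\mathsf A_k$ is a unital subalgebra of $\mathbf P_k(n)$. The span of $\{\mathsf N_T\mid T\in\mathcal{SSPT}(\lambda,\mathcal W^m_{\mathcal A_k})\}$ is stable under the action of $\mathsf A_k$, and this action makes it an $\mathsf A_k$-module. The twisted action makes $\mathsf A_k^\lambda$ an irreducible $\mathsf A_k$-module, and the two $\mathsf A_k$-modules are isomorphic. -/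

import Mathlib

namespace DiagramAlgebras

/-! ### Set-partition diagrams and concatenation -/

/-- A set-partition diagram with top row `α` and bottom row `β`: the equivalence relation on the
vertices whose classes are the blocks. -/
abbrev BiDiagram (α β : Type) : Type := Setoid (α ⊕ β)

/-- The set-partition diagrams `𝒫_k`: set partitions of `{1, …, k, 1', …, k'}`; the vertex
`Sum.inl i` is in the top row and `Sum.inr i` in the bottom row. -/
abbrev Diagram (k : ℕ) : Type := BiDiagram (Fin k) (Fin k)

section Concatenation

variable {α β γ δ : Type}

/-- The edges of the stacked diagram (`d` above `e`) on the three rows `α`, `β`, `γ`. -/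
def stackRel (d : BiDiagram α β) (e : BiDiagram β γ) (x y : α ⊕ (β ⊕ γ)) : Prop :=
  (∃ u v, d u v ∧ Sum.map id Sum.inl u = x ∧ Sum.map id Sum.inl v = y) ∨
    (∃ u v, e u v ∧ Sum.inr u = x ∧ Sum.inr v = y)

/-- The connected components of the stacked diagram, `d` above `e`, where the bottom row of `d`
is identified with the top row of `e`. -/
def stack (d : BiDiagram α β) (e : BiDiagram β γ) : Setoid (α ⊕ (β ⊕ γ)) :=
  Relation.EqvGen.setoid (stackRel d e)

/-- The concatenation `d ∘ e`. -/
def comp (d : BiDiagram α β) (e : BiDiagram β γ) : BiDiagram α γ :=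
  (stack d e).comap (Sum.map id Sum.inr)

/-- The connected components of the stacked diagram that lie entirely in the middle row. -/
def MiddleComponent (d : BiDiagram α β) (e : BiDiagram β γ) : Type :=
  {q : Quotient (stack d e) // ∀ x, Quotient.mk (stack d e) x = q → ∃ b, x = Sum.inr (Sum.inl b)}

/-- `ℓ(d, e)`: the number of components deleted from the middle row in forming `d ∘ e`. -/
noncomputable def removed (d : BiDiagram α β) (e : BiDiagram β γ) : ℕ :=
  Nat.card (MiddleComponent d e)

/-- The reflection `dᵀ` of a diagram over the horizontal axis. -/
def transpose (d : BiDiagram α β) : BiDiagram β α := d.comap Sum.swap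

/-- The identity diagram, with blocks `{i, i'}`. -/
def idDiagram (α : Type) : BiDiagram α α := Setoid.ker (Sum.elim id id)

/-! ### Associativity of concatenation, through the matrices of diagrams acting on `2`-colourings -/

/-- The colouring `f` is constant on the blocks of `d`. -/
def IsConst {ι : Type} (d : Setoid ι) (f : ι → Bool) : Prop := ∀ x y, d x y → f x = f y

theorem isConst_stack (d : BiDiagram α β) (e : BiDiagram β γ) (a : α → Bool) (b : β → Bool)
    (c : γ → Bool) : IsConst (stack d e) (Sum.elim a (Sum.elim b c)) ↔
      IsConst d (Sum.elim a b) ∧ IsConst e (Sum.elim b c) := by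
  constructor
  · intro h
    refine ⟨fun u v huv => ?_, fun u v huv => ?_⟩
    · have := h _ _ (Relation.EqvGen.rel _ _ (Or.inl ⟨u, v, huv, rfl, rfl⟩))
      rcases u with u | u <;> rcases v with v | v <;> simpa using this
    · have := h _ _ (Relation.EqvGen.rel _ _ (Or.inr ⟨u, v, huv, rfl, rfl⟩))
      simpa using this
  · rintro ⟨h₁, h₂⟩ x y hxy
    induction hxy with
    | rel x y h =>
      rcases h with ⟨u, v, huv, rfl, rfl⟩ | ⟨u, v, huv, rfl, rfl⟩
      · have := h₁ _ _ huv
        rcases u with u | u <;> rcases v with v | v <;> simpa using this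
      · simpa using h₂ _ _ huv
    | refl x => rfl
    | symm x y _ ih => exact ih.symm
    | trans x y z _ _ ih₁ ih₂ => exact ih₁.trans ih₂

theorem isConst_comp_of_stack {d : BiDiagram α β} {e : BiDiagram β γ} {a : α → Bool}
    {b : β → Bool} {c : γ → Bool} (h : IsConst (stack d e) (Sum.elim a (Sum.elim b c))) :
    IsConst (comp d e) (Sum.elim a c) := by
  intro u v huv
  have := h _ _ huv
  rcases u with u | u <;> rcases v with v | v <;> simpa using this

open Classical in
/-- The extension of an outer colouring to the stacked diagram. -/
noncomputable def extend (d : BiDiagram α β) (e : BiDiagram β γ) (o : α ⊕ γ → Bool)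
    (g : MiddleComponent d e → Bool) (q : Quotient (stack d e)) : Bool :=
  if h : ∃ u, Quotient.mk (stack d e) (Sum.map id Sum.inr u) = q then o h.choose
  else g ⟨q, by
    rintro (x | x | x) hx
    · exact absurd ⟨Sum.inl x, hx⟩ h
    · exact ⟨x, rfl⟩
    · exact absurd ⟨Sum.inr x, hx⟩ h⟩

theorem extend_outer {d : BiDiagram α β} {e : BiDiagram β γ} {o : α ⊕ γ → Bool}
    (ho : IsConst (comp d e) o) (g : MiddleComponent d e → Bool) (u : α ⊕ γ) :
    extend d e o g (Quotient.mk _ (Sum.map id Sum.inr u)) = o u := by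
  have h : ∃ u', Quotient.mk (stack d e) (Sum.map id Sum.inr u') =
    Quotient.mk (stack d e) (Sum.map id Sum.inr u) := ⟨u, rfl⟩
  rw [extend, dif_pos h]
  have hs : stack d e (Sum.map id Sum.inr h.choose) (Sum.map id Sum.inr u) :=
    Quotient.exact h.choose_spec
  exact ho _ _ hs

theorem extend_middle {d : BiDiagram α β} {e : BiDiagram β γ} (o : α ⊕ γ → Bool)
    (g : MiddleComponent d e → Bool) (q : MiddleComponent d e) :
    extend d e o g q.1 = g q := by
  have h : ¬ ∃ u, Quotient.mk (stack d e) (Sum.map id Sum.inr u) = q.1 := by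
    rintro ⟨u, hu⟩
    obtain ⟨b, hb⟩ := q.2 _ hu
    rcases u with u | u <;> simp at hb
  rw [extend, dif_neg h]
  rfl

/-- The colourings of the middle row compatible with a given colouring of the outer rows. -/
noncomputable def middleColouringEquiv (d : BiDiagram α β) (e : BiDiagram β γ) (a : α → Bool)
    (c : γ → Bool) (ho : IsConst (comp d e) (Sum.elim a c)) :
    {b : β → Bool // IsConst d (Sum.elim a b) ∧ IsConst e (Sum.elim b c)} ≃
      (MiddleComponent d e → Bool) where
  toFun b q := Quotient.lift (Sum.elim a (Sum.elim b.1 c)) ((isConst_stack d e a b.1 c).2 b.2) q.1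
  invFun g := ⟨fun x => extend d e (Sum.elim a c) g (Quotient.mk _ (Sum.inr (Sum.inl x))), by
    rw [← isConst_stack]
    have key : Sum.elim a (Sum.elim (fun x => extend d e (Sum.elim a c) g
        (Quotient.mk _ (Sum.inr (Sum.inl x)))) c) =
        fun z => extend d e (Sum.elim a c) g (Quotient.mk _ z) := by
      funext z
      rcases z with z | z | z
      · exact (extend_outer ho g (Sum.inl z)).symm
      · rfl
      · exact (extend_outer ho g (Sum.inr z)).symm
    rw [key]
    intro x y hxy
    exact congrArg _ (Quotient.sound hxy)⟩
  left_inv b := by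
    apply Subtype.ext
    funext x
    have hs := (isConst_stack d e a b.1 c).2 b.2
    by_cases h : ∃ u, Quotient.mk (stack d e) (Sum.map id Sum.inr u) =
        Quotient.mk (stack d e) (Sum.inr (Sum.inl x))
    · obtain ⟨u, hu⟩ := h
      have h₁ := extend_outer ho (fun q => Quotient.lift (Sum.elim a (Sum.elim b.1 c)) hs q.1) u
      have h₂ := hs _ _ (Quotient.exact hu)
      simp only
      rw [← hu, h₁]
      rcases u with u | u <;> simpa using h₂
    · have hm : ∀ y, Quotient.mk (stack d e) y = Quotient.mk (stack d e) (Sum.inr (Sum.inl x)) →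
          ∃ b, y = Sum.inr (Sum.inl b) := by
        rintro (y | y | y) hy
        · exact absurd ⟨Sum.inl y, hy⟩ h
        · exact ⟨y, rfl⟩
        · exact absurd ⟨Sum.inr y, hy⟩ h
      exact extend_middle (Sum.elim a c)
        (fun q => Quotient.lift (Sum.elim a (Sum.elim b.1 c)) hs q.1)
        (⟨_, hm⟩ : MiddleComponent d e)
  right_inv g := by
    funext q
    obtain ⟨q, hq⟩ := q
    induction q using Quotient.inductionOn with
    | h z =>
      obtain ⟨x, rfl⟩ := hq z rfl
      exact extend_middle (Sum.elim a c) g ⟨_, hq⟩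

open Classical in
/-- The matrix of a diagram, indexed by colourings of its rows. -/
noncomputable def colourMatrix (d : BiDiagram α β) : Matrix (α → Bool) (β → Bool) ℕ :=
  fun a b => if IsConst d (Sum.elim a b) then 1 else 0

theorem colourMatrix_mul [Fintype α] [Fintype β] [Fintype γ] [DecidableEq β]
    (d : BiDiagram α β) (e : BiDiagram β γ) :
    colourMatrix d * colourMatrix e = 2 ^ removed d e • colourMatrix (comp d e) := by
  classical
  ext a c
  have hsum : (colourMatrix d * colourMatrix e) a c =
      Nat.card {b : β → Bool // IsConst d (Sum.elim a b) ∧ IsConst e (Sum.elim b c)} := by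
    rw [Matrix.mul_apply, Nat.card_eq_fintype_card, Fintype.card_subtype, Finset.card_filter]
    refine Finset.sum_congr rfl fun b _ => ?_
    simp only [colourMatrix]
    by_cases h₁ : IsConst d (Sum.elim a b) <;> by_cases h₂ : IsConst e (Sum.elim b c) <;>
      simp [h₁, h₂]
  rw [hsum, Matrix.smul_apply]
  by_cases ho : IsConst (comp d e) (Sum.elim a c)
  · have : Finite (MiddleComponent d e) := Subtype.finite
    rw [Nat.card_congr (middleColouringEquiv d e a c ho), Nat.card_fun]
    simp [colourMatrix, ho, removed]
  · have : IsEmpty {b : β → Bool // IsConst d (Sum.elim a b) ∧ IsConst e (Sum.elim b c)} :=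
      ⟨fun b => ho (isConst_comp_of_stack ((isConst_stack d e a b.1 c).2 b.2))⟩
    simp [colourMatrix, ho]

theorem colourMatrix_injective {d e : BiDiagram α β} {p q : ℕ}
    (h : 2 ^ p • colourMatrix d = 2 ^ q • colourMatrix e) : d = e ∧ p = q := by
  classical
  have h0 := congrFun (congrFun h fun _ => false) fun _ => false
  have hc : ∀ f : BiDiagram α β,
      IsConst f (Sum.elim (fun _ => false) fun _ => false) := by
    rintro f (u | u) (v | v) _ <;> rfl
  have hpq : p = q := by
    simp only [Matrix.smul_apply, colourMatrix, if_pos (hc _)] at h0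
    exact Nat.pow_right_injective le_rfl (by simpa using h0)
  subst hpq
  have hiff : ∀ f : α ⊕ β → Bool, IsConst d f ↔ IsConst e f := by
    intro f
    have h1 := congrFun (congrFun h (f ∘ Sum.inl)) (f ∘ Sum.inr)
    simp only [Matrix.smul_apply, colourMatrix, Sum.elim_comp_inl_inr, smul_eq_mul] at h1
    have h2 := Nat.eq_of_mul_eq_mul_left (by positivity) h1
    by_cases h3 : IsConst d f <;> by_cases h4 : IsConst e f
    · exact ⟨fun _ => h4, fun _ => h3⟩
    · rw [if_pos h3, if_neg h4] at h2
      exact absurd h2 one_ne_zero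
    · rw [if_neg h3, if_pos h4] at h2
      exact absurd h2 zero_ne_one
    · exact ⟨fun h => absurd h h3, fun h => absurd h h4⟩
  have hself : ∀ (s : BiDiagram α β) (x : α ⊕ β), IsConst s fun z => decide (s x z) := by
    intro s x u v huv
    simp only [decide_eq_decide]
    exact ⟨fun h => s.trans' h huv, fun h => s.trans' h (s.symm' huv)⟩
  refine ⟨Setoid.ext fun x y => ⟨fun hxy => ?_, fun hxy => ?_⟩, rfl⟩
  · have := (hiff _).2 (hself e x) x y hxy
    exact of_decide_eq_true (this.symm.trans (decide_eq_true (e.refl' x)))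
  · have := (hiff _).1 (hself d x) x y hxy
    exact of_decide_eq_true (this.symm.trans (decide_eq_true (d.refl' x)))

theorem comp_assoc_and_removed [Finite α] [Finite β] [Finite γ] [Finite δ]
    (d : BiDiagram α β) (e : BiDiagram β γ) (f : BiDiagram γ δ) :
    comp (comp d e) f = comp d (comp e f) ∧
      removed d e + removed (comp d e) f = removed e f + removed d (comp e f) := by
  classical
  have := Fintype.ofFinite α
  have := Fintype.ofFinite β
  have := Fintype.ofFinite γ
  have := Fintype.ofFinite δ
  have h := Matrix.mul_assoc (colourMatrix d) (colourMatrix e) (colourMatrix f)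
  rw [colourMatrix_mul, colourMatrix_mul, Matrix.smul_mul, Matrix.mul_smul, colourMatrix_mul,
    colourMatrix_mul, smul_smul, smul_smul, ← pow_add, ← pow_add] at h
  exact colourMatrix_injective h

theorem colourMatrix_id [DecidableEq (α → Bool)] :
    colourMatrix (idDiagram α) = (1 : Matrix (α → Bool) (α → Bool) ℕ) := by
  ext a b
  have : IsConst (idDiagram α) (Sum.elim a b) ↔ a = b := by
    constructor
    · intro h
      funext x
      exact h (Sum.inl x) (Sum.inr x) rfl
    · rintro rfl (u | u) (v | v) h <;> exact congrArg a h
  simp [colourMatrix, this, Matrix.one_apply]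

theorem id_comp_and_removed [Finite α] [Finite β] (d : BiDiagram α β) :
    comp (idDiagram α) d = d ∧ removed (idDiagram α) d = 0 := by
  classical
  have := Fintype.ofFinite α
  have := Fintype.ofFinite β
  have h := colourMatrix_mul (idDiagram α) d
  rw [colourMatrix_id, Matrix.one_mul] at h
  have := colourMatrix_injective (p := 0) (by simpa using h)
  exact ⟨this.1.symm, this.2.symm⟩

theorem comp_id_and_removed [Finite α] [Finite β] (d : BiDiagram α β) :
    comp d (idDiagram β) = d ∧ removed d (idDiagram β) = 0 := by
  classical
  have := Fintype.ofFinite α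
  have := Fintype.ofFinite β
  have h := colourMatrix_mul d (idDiagram β)
  rw [colourMatrix_id, Matrix.mul_one] at h
  have := colourMatrix_injective (p := 0) (by simpa using h)
  exact ⟨this.1.symm, this.2.symm⟩

end Concatenation

/-! ### The partition algebra -/

/-- The partition algebra `P_k(n)` with parameter `n ∈ ℂ`: the vector space with basis the
set-partition diagrams. -/
def PartitionAlgebra (k : ℕ) (_n : ℂ) : Type := Diagram k →₀ ℂ

namespace PartitionAlgebra

variable {k : ℕ} {n : ℂ}

noncomputable instance : AddCommGroup (PartitionAlgebra k n) :=
  inferInstanceAs (AddCommGroup (Diagram k →₀ ℂ))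

noncomputable instance : Module ℂ (PartitionAlgebra k n) :=
  inferInstanceAs (Module ℂ (Diagram k →₀ ℂ))

/-- The diagram `d` as a basis vector of the partition algebra. -/
noncomputable def ofDiagram (n : ℂ) (d : Diagram k) : PartitionAlgebra k n :=
  Finsupp.single d (1 : ℂ)

/-- Linear extension of a function on diagrams. -/
noncomputable def lift {M : Type} [AddCommGroup M] [Module ℂ M] (f : Diagram k → M) :
    PartitionAlgebra k n →ₗ[ℂ] M :=
  Finsupp.linearCombination ℂ f

@[simp] theorem lift_ofDiagram {M : Type} [AddCommGroup M] [Module ℂ M] (f : Diagram k → M)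
    (d : Diagram k) : lift f (ofDiagram n d) = f d := by
  change Finsupp.linearCombination ℂ f (Finsupp.single d (1 : ℂ)) = f d
  rw [Finsupp.linearCombination_single, one_smul]

theorem lin_ext {M : Type} [AddCommGroup M] [Module ℂ M] {f g : PartitionAlgebra k n →ₗ[ℂ] M}
    (h : ∀ d, f (ofDiagram n d) = g (ofDiagram n d)) : f = g :=
  Finsupp.lhom_ext' fun d => LinearMap.ext_ring (h d)

/-- The bilinear product with `d e = n ^ ℓ(d, e) (d ∘ e)` on diagrams. -/
noncomputable def mulLin :
    PartitionAlgebra k n →ₗ[ℂ] PartitionAlgebra k n →ₗ[ℂ] PartitionAlgebra k n :=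
  lift fun d => lift fun e => n ^ removed d e • ofDiagram n (comp d e)

noncomputable instance : Mul (PartitionAlgebra k n) := ⟨fun a b => mulLin a b⟩

noncomputable instance : One (PartitionAlgebra k n) := ⟨ofDiagram n (idDiagram (Fin k))⟩

theorem mul_def (a b : PartitionAlgebra k n) : a * b = mulLin a b := rfl

theorem one_def : (1 : PartitionAlgebra k n) = ofDiagram n (idDiagram (Fin k)) := rfl

theorem ofDiagram_mul (d e : Diagram k) :
    ofDiagram n d * ofDiagram n e = n ^ removed d e • ofDiagram n (comp d e) := by
  rw [mul_def, mulLin, lift_ofDiagram, lift_ofDiagram]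

theorem mul_assoc' (a b c : PartitionAlgebra k n) : a * b * c = a * (b * c) := by
  have h : (mulLin (n := n) (k := k)).compr₂ mulLin =
      ((LinearMap.llcomp ℂ _ _ _).comp mulLin).compl₂ mulLin := by
    refine lin_ext fun d => lin_ext fun e => lin_ext fun f => ?_
    change ofDiagram n d * ofDiagram n e * ofDiagram n f =
      ofDiagram n d * (ofDiagram n e * ofDiagram n f)
    obtain ⟨h₁, h₂⟩ := comp_assoc_and_removed d e f
    rw [ofDiagram_mul, ofDiagram_mul, mul_def, mul_def, map_smul, map_smul, LinearMap.smul_apply,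
      ← mul_def, ← mul_def, ofDiagram_mul, ofDiagram_mul, smul_smul, smul_smul, ← pow_add,
      ← pow_add, h₁, h₂]
  exact congrArg (fun F => F a b c) h

theorem one_mul' (a : PartitionAlgebra k n) : 1 * a = a := by
  have h : mulLin (n := n) (ofDiagram n (idDiagram (Fin k))) = LinearMap.id := by
    refine lin_ext fun d => ?_
    obtain ⟨h₁, h₂⟩ := id_comp_and_removed d
    rw [← mul_def, ofDiagram_mul, h₁, h₂, pow_zero, one_smul, LinearMap.id_apply]
  exact congrArg (fun F => F a) h

theorem mul_one' (a : PartitionAlgebra k n) : a * 1 = a := by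
  have h : (mulLin (n := n)).flip (ofDiagram n (idDiagram (Fin k))) = LinearMap.id := by
    refine lin_ext fun d => ?_
    obtain ⟨h₁, h₂⟩ := comp_id_and_removed d
    rw [LinearMap.flip_apply, ← mul_def, ofDiagram_mul, h₁, h₂, pow_zero, one_smul,
      LinearMap.id_apply]
  exact congrArg (fun F => F a) h

noncomputable instance : Ring (PartitionAlgebra k n) where
  __ := (inferInstance : AddCommGroup (PartitionAlgebra k n))
  mul := (· * ·)
  one := 1
  left_distrib a b c := map_add (mulLin a) b c
  right_distrib a b c := by
    simp only [mul_def, map_add, LinearMap.add_apply]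
  zero_mul a := by simp only [mul_def, map_zero, LinearMap.zero_apply]
  mul_zero a := map_zero (mulLin a)
  mul_assoc := mul_assoc'
  one_mul := one_mul'
  mul_one := mul_one'

noncomputable instance : Algebra ℂ (PartitionAlgebra k n) :=
  Algebra.ofModule (fun r a b => by
      change mulLin (r • a) b = r • mulLin a b
      rw [map_smul, LinearMap.smul_apply])
    (fun r a b => map_smul (mulLin a) r b)

end PartitionAlgebra

/-! ### Blocks of diagrams and the diagram subalgebras -/

section Blocks

variable {k : ℕ}

open Classical in
/-- The number of top-row vertices in the block of the vertex `v`. -/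
noncomputable def topCount (d : Diagram k) (v : Fin k ⊕ Fin k) : ℕ :=
  (Finset.univ.filter fun i : Fin k => d v (Sum.inl i)).card

open Classical in
/-- The number of bottom-row vertices in the block of the vertex `v`. -/
noncomputable def bottomCount (d : Diagram k) (v : Fin k ⊕ Fin k) : ℕ :=
  (Finset.univ.filter fun i : Fin k => d v (Sum.inr i)).card

/-- The position of a vertex when the boundary of the rectangle is traversed clockwise:
`1, …, k, k', …, 1'`. -/
def boundaryPos : Fin k ⊕ Fin k → ℕ
  | Sum.inl i => i
  | Sum.inr i => 2 * k - 1 - i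

/-- A diagram is planar if no two of its blocks cross inside the rectangle: there are no vertices
`a, b, a', b'` in this order on the boundary with `a, a'` in one block and `b, b'` in another. -/
def IsPlanar (d : Diagram k) : Prop :=
  ∀ a b a' b' : Fin k ⊕ Fin k, boundaryPos a < boundaryPos b → boundaryPos b < boundaryPos a' →
    boundaryPos a' < boundaryPos b' → d a a' → d b b' → d a b

/-- The top-row vertex `i` lies in a propagating block of `d`. -/
def Propagates (d : Diagram k) (i : Fin k) : Prop := ∃ j, d (Sum.inl i) (Sum.inr j)

/-- The rank (propagating number) of `d`: the number of blocks with vertices in both rows. -/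
noncomputable def rank (d : Diagram k) : ℕ :=
  Nat.card {q : Quotient d // (∃ i : Fin k, Quotient.mk d (Sum.inl i) = q) ∧
    ∃ j : Fin k, Quotient.mk d (Sum.inr j) = q}

/-- Symmetric `m`-diagrams: `d = dᵀ`, the rank is `m`, and each propagating block of the top row
is connected to its mirror image. -/
def IsSymmetricDiagram (m : ℕ) (d : Diagram k) : Prop :=
  d = transpose d ∧ rank d = m ∧ ∀ i, Propagates d i → d (Sum.inl i) (Sum.inr i)

/-- The conjugate `d ∘ w ∘ dᵀ`. -/
def conj (d w : Diagram k) : Diagram k := comp (comp d w) (transpose d)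

open Classical in
/-- The position, starting from `0`, of the block of the top-row vertex `i` among the propagating
blocks of `d`, in max-entry order of their top rows: the number of maximal entries `y` of
propagating blocks that are smaller than some entry of the block of `i`. -/
noncomputable def blockIndex (d : Diagram k) (i : Fin k) : ℕ :=
  (Finset.univ.filter fun y : Fin k =>
    (Propagates d y ∧ ∀ z, d (Sum.inl y) (Sum.inl z) → z ≤ y) ∧
      ∃ z, d (Sum.inl i) (Sum.inl z) ∧ y < z).card

/-- `σ` is the twist `σ_{d,w}` of the conjugation of `w` by `d`: the `i`-th propagating block of
`w` gets sent to (is connected by `d` to) the `σ i`-th propagating block of `d ∘ w ∘ dᵀ`. -/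
def IsTwist {m : ℕ} (d w : Diagram k) (σ : Equiv.Perm (Fin m)) : Prop :=
  ∀ (i : Fin m) (x y : Fin k), Propagates w x → blockIndex w x = i →
    stack d w (Sum.inl y) (Sum.inr (Sum.inl x)) → blockIndex (conj d w) y = σ i

end Blocks

/-- The partition algebra and its diagram subalgebras. -/
inductive DiagramFamily
  | partition
  | symmetric
  | rook
  | brauer
  | rookBrauer
  | planarPartition
  | identity
  | temperleyLieb
  | planarRook
  | motzkin

namespace DiagramFamily

/-- The diagram bases `𝒜_k` of the algebras `A_k`: `P_k(n)`, `ℂS_k`, `R_k`, `B_k(n)`, `RB_k(n)`,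
`PP_k(n)`, `ℂ1_k`, `TL_k(n)`, `PR_k`, `M_k(n)`. -/
def Mem (X : DiagramFamily) {k : ℕ} (d : Diagram k) : Prop :=
  match X with
  | partition => True
  | symmetric => ∀ v, topCount d v = 1 ∧ bottomCount d v = 1
  | rook => ∀ v, topCount d v ≤ 1 ∧ bottomCount d v ≤ 1
  | brauer => ∀ v, topCount d v + bottomCount d v = 2
  | rookBrauer => ∀ v, topCount d v + bottomCount d v = 1 ∨ topCount d v + bottomCount d v = 2
  | planarPartition => IsPlanar d
  | identity => (∀ v, topCount d v = 1 ∧ bottomCount d v = 1) ∧ IsPlanar d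
  | temperleyLieb => (∀ v, topCount d v + bottomCount d v = 2) ∧ IsPlanar d
  | planarRook => (∀ v, topCount d v ≤ 1 ∧ bottomCount d v ≤ 1) ∧ IsPlanar d
  | motzkin => (∀ v, topCount d v + bottomCount d v = 1 ∨ topCount d v + bottomCount d v = 2) ∧
      IsPlanar d

/-- The subspace `A_k = ℂ𝒜_k` of the partition algebra. -/
noncomputable def span (X : DiagramFamily) (k : ℕ) (n : ℂ) :
    Submodule ℂ (PartitionAlgebra k n) :=
  Submodule.span ℂ {a | ∃ d : Diagram k, X.Mem d ∧ a = PartitionAlgebra.ofDiagram n d}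

/-- The set `𝒲^m` of symmetric `m`-diagrams in `𝒜_k`. -/
def SymDiagram (X : DiagramFamily) (k m : ℕ) : Type :=
  {w : Diagram k // X.Mem w ∧ IsSymmetricDiagram m w}

end DiagramFamily

/-! ### Partitions, Young tableaux and Young's natural basis -/

theorem shift_injOn (s : Set (ℕ × ℕ)) : Set.InjOn (fun c : ℕ × ℕ => (c.1 + 1, c.2)) s := by
  rintro ⟨a, b⟩ _ ⟨a', b'⟩ _ h
  simpa using h

theorem mem_shift {s : Finset (ℕ × ℕ)} {c : ℕ × ℕ} :
    c ∈ s.preimage (fun c : ℕ × ℕ => (c.1 + 1, c.2)) (shift_injOn _) ↔ (c.1 + 1, c.2) ∈ s :=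
  Finset.mem_preimage (hf := shift_injOn _)

/-- The Young diagram `λ*`, obtained from `λ` by removing the first row. -/
noncomputable def removeFirstRow (lam : YoungDiagram) : YoungDiagram where
  cells := lam.cells.preimage (fun c : ℕ × ℕ => (c.1 + 1, c.2)) (shift_injOn _)
  isLowerSet := by
    rintro ⟨a, b⟩ ⟨a', b'⟩ hle h
    have h₁ : ((a + 1, b) : ℕ × ℕ) ∈ lam.cells := mem_shift.1 (Finset.mem_coe.1 h)
    have h₂ : ((a' + 1, b') : ℕ × ℕ) ≤ (a + 1, b) := ⟨Nat.succ_le_succ hle.1, hle.2⟩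
    exact Finset.mem_coe.2 (mem_shift.2 (lam.isLowerSet h₂ h₁))

theorem mem_removeFirstRow {lam : YoungDiagram} {c : ℕ × ℕ} :
    c ∈ (removeFirstRow lam).cells ↔ (c.1 + 1, c.2) ∈ lam.cells :=
  mem_shift

/-- `μ` has at most one row. -/
def OneRow (μ : YoungDiagram) : Prop := ∀ c ∈ μ.cells, c.1 = 0

/-- The index sets `Λ_n^{A_k}`, for `n = |λ|`. -/
def DiagramFamily.IsIndex (X : DiagramFamily) (k : ℕ) (lam : YoungDiagram) : Prop :=
  match X with
  | partition | rook | rookBrauer => (removeFirstRow lam).card ≤ k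
  | symmetric => (removeFirstRow lam).card = k
  | brauer => ∃ l, (removeFirstRow lam).card + 2 * l = k
  | planarPartition | planarRook | motzkin =>
      (removeFirstRow lam).card ≤ k ∧ OneRow (removeFirstRow lam)
  | identity => (removeFirstRow lam).card = k ∧ OneRow (removeFirstRow lam)
  | temperleyLieb => (∃ l, (removeFirstRow lam).card + 2 * l = k) ∧ OneRow (removeFirstRow lam)

/-- The bijection from a finite type to `{0, …, m - 1}` that is increasing for the order induced
by an injective map `f` to a linear order. -/
noncomputable def rankEquiv {α β : Type} [Fintype α] [LinearOrder β] (f : α → β)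
    (hf : Function.Injective f) {m : ℕ} (hm : Fintype.card α = m) : α ≃ Fin m :=
  letI : LinearOrder α := LinearOrder.lift' f hf
  (Fintype.orderIsoFinOfCardEq α hm).symm.toEquiv

theorem rankEquiv_lt {α β : Type} [Fintype α] [LinearOrder β] (f : α → β)
    (hf : Function.Injective f) {m : ℕ} (hm : Fintype.card α = m) (a b : α) :
    rankEquiv f hf hm a < rankEquiv f hf hm b ↔ f a < f b := by
  let _ : LinearOrder α := LinearOrder.lift' f hf
  exact (Fintype.orderIsoFinOfCardEq α hm).symm.lt_iff_lt

/-- The boxes of a Young diagram; `(i, j)` is the box in row `i` and column `j`. -/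
abbrev Cell (μ : YoungDiagram) : Type := {c : ℕ × ℕ // c ∈ μ.cells}

theorem card_cell (μ : YoungDiagram) : Fintype.card (Cell μ) = μ.card :=
  Fintype.card_coe μ.cells

/-- Young tableaux of shape `μ`: fillings of the boxes with the numbers `0, …, m - 1`, each used
once, where `m = |μ|`. -/
abbrev YoungTableau (μ : YoungDiagram) : Type := Cell μ ≃ Fin μ.card

/-- Rows increase from left to right and columns from top to bottom. -/
def YoungTableau.IsStandard {μ : YoungDiagram} (t : YoungTableau μ) : Prop :=
  ∀ c c' : Cell μ, (c.1.1 = c'.1.1 ∧ c.1.2 < c'.1.2 ∨ c.1.2 = c'.1.2 ∧ c.1.1 < c'.1.1) →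
    t c < t c'

/-- `𝒮𝒴𝒯(μ)`. -/
abbrev StandardYoungTableau (μ : YoungDiagram) : Type := {t : YoungTableau μ // t.IsStandard}

noncomputable instance (μ : YoungDiagram) : Fintype (StandardYoungTableau μ) := Fintype.ofFinite _

/-- The column-reading tableau `t_c`. -/
noncomputable def columnReading (μ : YoungDiagram) : YoungTableau μ :=
  rankEquiv (fun c : Cell μ => (toLex (c.1.2, c.1.1) : ℕ ×ₗ ℕ))
    (by
      rintro ⟨⟨a, b⟩, _⟩ ⟨⟨a', b'⟩, _⟩ h
      have h' := toLex.injective h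
      simp only [Prod.mk.injEq] at h'
      simp [h'.1, h'.2])
    (card_cell μ)

/-- The permutation `σ_t` with `σ_t(t_c) = t`. -/
noncomputable def tableauPerm {μ : YoungDiagram} (t : YoungTableau μ) :
    Equiv.Perm (Fin μ.card) :=
  (columnReading μ).symm.trans t

/-- The column group `C(t_c)`: the permutations preserving the columns of `t_c`. -/
def columnGroup (μ : YoungDiagram) : Set (Equiv.Perm (Fin μ.card)) :=
  {γ | ∀ x, ((columnReading μ).symm (γ x)).1.2 = ((columnReading μ).symm x).1.2}

/-- The row group `R(t_c)`: the permutations preserving the rows of `t_c`. -/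
def rowGroup (μ : YoungDiagram) : Set (Equiv.Perm (Fin μ.card)) :=
  {ρ | ∀ x, ((columnReading μ).symm (ρ x)).1.1 = ((columnReading μ).symm x).1.1}

/-- The group algebra `ℂS_m`. -/
abbrev SymGroupAlgebra (m : ℕ) : Type := MonoidAlgebra ℂ (Equiv.Perm (Fin m))

/-- A permutation as an element of the group algebra. -/
noncomputable def ofPerm {m : ℕ} (σ : Equiv.Perm (Fin m)) : SymGroupAlgebra m :=
  MonoidAlgebra.of ℂ _ σ

open Classical in
/-- The Young symmetrizer `p_μ`, the sum of `sign(γ) γ ρ` over `γ ∈ C(t_c)` and `ρ ∈ R(t_c)`. -/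
noncomputable def youngSymmetrizer (μ : YoungDiagram) : SymGroupAlgebra μ.card :=
  ∑ γ ∈ Finset.univ.filter (· ∈ columnGroup μ), ∑ ρ ∈ Finset.univ.filter (· ∈ rowGroup μ),
    ((Equiv.Perm.sign γ : ℤ) : ℂ) • ofPerm (γ * ρ)

/-- The irreducible module `S_m^μ = (ℂS_m) p_μ`, a left ideal of `ℂS_m`. -/
noncomputable def spechtModule (μ : YoungDiagram) : Submodule (SymGroupAlgebra μ.card)
    (SymGroupAlgebra μ.card) :=
  Submodule.span (SymGroupAlgebra μ.card) {youngSymmetrizer μ}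

/-- Young's natural vectors `n_t = σ_t p_μ`. -/
noncomputable def naturalVector {μ : YoungDiagram} (t : YoungTableau μ) : SymGroupAlgebra μ.card :=
  ofPerm (tableauPerm t) * youngSymmetrizer μ

/-- The integers `c s` express `n_t` in terms of the natural vectors of standard tableaux. -/
def IsStraightening {μ : YoungDiagram} (t : YoungTableau μ) (c : StandardYoungTableau μ → ℤ) :
    Prop :=
  naturalVector t = ∑ s : StandardYoungTableau μ, (c s : ℂ) • naturalVector s.1

open Classical in
/-- The coefficients in the expansion of `n_t` as an integer combination of the vectors `n_s` with
`s` standard. -/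
noncomputable def straightening {μ : YoungDiagram} (t : YoungTableau μ) :
    StandardYoungTableau μ → ℤ :=
  if h : ∃ c, IsStraightening t c then h.choose else 0

/-! ### The modules `A_k^λ` on symmetric diagrams -/

/-- The space `A_k^λ = ℂ𝒲^m ⊗ S_m^{λ*}`, where `m = |λ*|`. -/
abbrev SymModule (X : DiagramFamily) (k : ℕ) (lam : YoungDiagram) : Type :=
  TensorProduct ℂ (X.SymDiagram k (removeFirstRow lam).card →₀ ℂ)
    (spechtModule (removeFirstRow lam))

/-- `τ` is the twisted conjugation action of `A_k` on `A_k^λ`: `d · (w ⊗ v)` is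
`n ^ ℓ(d, w) (d ∘ w ∘ dᵀ) ⊗ σ_{d,w} v` if `d ∘ w ∘ dᵀ` has rank `m`, and `0` if the rank is less
than `m`. -/
def IsTwistedAction (X : DiagramFamily) {k : ℕ} {n : ℂ} (lam : YoungDiagram)
    {A : Subalgebra ℂ (PartitionAlgebra k n)} (τ : A →ₐ[ℂ] Module.End ℂ (SymModule X k lam)) :
    Prop :=
  ∀ (a : A) (d : Diagram k), X.Mem d → (a : PartitionAlgebra k n) = .ofDiagram n d →
    ∀ (w : X.SymDiagram k (removeFirstRow lam).card) (v : spechtModule (removeFirstRow lam)),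
      (rank (conj d w.1) = (removeFirstRow lam).card →
        ∃ (w' : X.SymDiagram k (removeFirstRow lam).card)
          (σ : Equiv.Perm (Fin (removeFirstRow lam).card)),
          w'.1 = conj d w.1 ∧ IsTwist d w.1 σ ∧
          τ a (TensorProduct.tmul ℂ (Finsupp.single w (1 : ℂ)) v) =
            n ^ removed d w.1 •
              TensorProduct.tmul ℂ (Finsupp.single w' (1 : ℂ)) (ofPerm σ • v)) ∧
      (rank (conj d w.1) < (removeFirstRow lam).card →
        τ a (TensorProduct.tmul ℂ (Finsupp.single w (1 : ℂ)) v) = 0)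

/-- The module defined by an algebra homomorphism `A → End M` is irreducible: it is nonzero, and
its only invariant subspaces are `0` and `M`. -/
def IsIrreducibleAction {A M : Type} [Ring A] [Algebra ℂ A] [AddCommMonoid M] [Module ℂ M]
    (τ : A →ₐ[ℂ] Module.End ℂ M) : Prop :=
  Nontrivial M ∧ ∀ U : Submodule ℂ M, (∀ a, ∀ x ∈ U, τ a x ∈ U) → U = ⊥ ∨ U = ⊤

/-! ### Set-partition tableaux -/

/-- A set partition `π` viewed as a one-line diagram. -/
def oneLine {k : ℕ} (π : Setoid (Fin k)) : BiDiagram (Fin k) Empty :=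
  π.comap (Sum.elim id Empty.elim)

/-- The set partition `top(d ∘ π)` induced on the top row of the concatenation. -/
def topOfComp {k : ℕ} (d : Diagram k) (π : Setoid (Fin k)) : Setoid (Fin k) :=
  (comp d (oneLine π)).comap Sum.inl

open Classical in
/-- The maximal entry of a block. -/
noncomputable def blockMax {k : ℕ} {π : Setoid (Fin k)} (q : Quotient π) : Fin k :=
  (Finset.univ.filter fun x => Quotient.mk π x = q).max'
    ⟨q.exists_rep.choose, by simpa using q.exists_rep.choose_spec⟩

theorem blockMax_mk {k : ℕ} {π : Setoid (Fin k)} (q : Quotient π) :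
    Quotient.mk π (blockMax q) = q := by
  classical
  have := Finset.max'_mem (Finset.univ.filter fun x => Quotient.mk π x = q)
    ⟨q.exists_rep.choose, by simpa using q.exists_rep.choose_spec⟩
  exact (Finset.mem_filter.1 this).2

theorem blockMax_injective {k : ℕ} {π : Setoid (Fin k)} :
    Function.Injective (blockMax : Quotient π → Fin k) := fun q q' h => by
  rw [← blockMax_mk q, ← blockMax_mk q', h]

/-- The boxes of the skew shape `λ/[r]`. -/
abbrev SkewCell (lam : YoungDiagram) (r : ℕ) : Type :=
  {c : ℕ × ℕ // c ∈ lam.cells ∧ (c.1 = 0 → r ≤ c.2)}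

instance (lam : YoungDiagram) (r : ℕ) : Finite (SkewCell lam r) :=
  Finite.of_injective (fun c : SkewCell lam r => (⟨c.1, c.2.1⟩ : Cell lam))
    fun c c' h => Subtype.ext (by simpa using h)

/-- Set-partition tableaux of shape `λ ⊢ n`: the content is a set partition `π` of `{1, …, k}`
into `t` blocks, and each box of `λ/[n-t]` contains a unique block of `π`. -/
structure SetPartitionTableau (k : ℕ) (lam : YoungDiagram) where
  content : Setoid (Fin k)
  filling : SkewCell lam (lam.card - Nat.card (Quotient content)) ≃ Quotient content

namespace SetPartitionTableau

variable {k : ℕ} {lam : YoungDiagram}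

instance : Finite (SetPartitionTableau k lam) := by
  have : Finite (Setoid (Fin k)) := Finite.of_injective (fun r : Setoid (Fin k) => ⇑r)
    fun r s h => Setoid.ext fun a b => iff_of_eq (congrFun (congrFun h a) b)
  exact Finite.of_injective (β := Σ π : Setoid (Fin k),
      SkewCell lam (lam.card - Nat.card (Quotient π)) ≃ Quotient π)
    (fun T => ⟨T.content, T.filling⟩) (by
      rintro ⟨π, f⟩ ⟨π', f'⟩ h
      cases h
      rfl)

/-- The rows and columns increase in max-entry order on the blocks. -/
def IsStandard (T : SetPartitionTableau k lam) : Prop :=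
  ∀ c c', (c.1.1 = c'.1.1 ∧ c.1.2 < c'.1.2 ∨ c.1.2 = c'.1.2 ∧ c.1.1 < c'.1.1) →
    blockMax (T.filling c) < blockMax (T.filling c')

/-- The first row increases from left to right. -/
def FirstRowIncreasing (T : SetPartitionTableau k lam) : Prop :=
  ∀ c c', c.1.1 = 0 → c'.1.1 = 0 → c.1.2 < c'.1.2 →
    blockMax (T.filling c) < blockMax (T.filling c')

/-- The propagating blocks are those below the first row. -/
def IsPropagating (T : SetPartitionTableau k lam) (q : Quotient T.content) : Prop :=
  (T.filling.symm q).1.1 ≠ 0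

/-- The block in the box of `T` below the first row that corresponds to the box `c` of `λ*`. -/
def lowerBlock (T : SetPartitionTableau k lam) (c : Cell (removeFirstRow lam)) :
    Quotient T.content :=
  T.filling ⟨(c.1.1 + 1, c.1.2), mem_removeFirstRow.1 c.2, fun h => absurd h (Nat.succ_ne_zero _)⟩

theorem lowerBlock_injective (T : SetPartitionTableau k lam) :
    Function.Injective T.lowerBlock := by
  rintro ⟨⟨a, b⟩, _⟩ ⟨⟨a', b'⟩, _⟩ h
  have := congrArg Subtype.val (T.filling.injective (show T.filling _ = T.filling _ from h))
  simpa using this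

/-- The symmetric diagram `w` whose propagating and non-propagating blocks are those of `T`. -/
def symDiagram (T : SetPartitionTableau k lam) : Diagram k where
  r u v := T.content (Sum.elim id id u) (Sum.elim id id v) ∧
    (u.isLeft = v.isLeft ∨ T.IsPropagating (Quotient.mk _ (Sum.elim id id u)))
  iseqv :=
    { refl := fun u => ⟨T.content.refl' _, Or.inl rfl⟩
      symm := fun {u v} h => ⟨T.content.symm' h.1, h.2.imp Eq.symm fun hp => by
        rwa [← show Quotient.mk T.content (Sum.elim id id u) = Quotient.mk _ (Sum.elim id id v)
          from Quotient.sound h.1]⟩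
      trans := fun {u v w} h h' => ⟨T.content.trans' h.1 h'.1, by
        have he : Quotient.mk T.content (Sum.elim id id u) = Quotient.mk _ (Sum.elim id id v) :=
          Quotient.sound h.1
        rcases h.2 with h₁ | h₁
        · rcases h'.2 with h₂ | h₂
          · exact Or.inl (h₁.trans h₂)
          · exact Or.inr (by rwa [he])
        · exact Or.inr h₁⟩ }

/-- The Young tableau `t` of shape `λ*` such that `i` is placed in the position that the `i`-th
propagating block, in max-entry order, occupies in `T`. -/
noncomputable def youngTableau (T : SetPartitionTableau k lam) :
    YoungTableau (removeFirstRow lam) :=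
  rankEquiv (fun c => blockMax (T.lowerBlock c))
    (blockMax_injective.comp T.lowerBlock_injective) (card_cell _)

/-- `T'` is the tableau `d(T)`. Its blocks are those of `top(d ∘ π)`; each propagating block of
`T` is replaced by the block it is connected to, the remaining blocks (which are not connected to a
propagating block of `T`) are non-propagating, and these increase along the first row. -/
def IsAction (d : Diagram k) (T T' : SetPartitionTableau k lam) : Prop :=
  T'.content = topOfComp d T.content ∧
    (∀ c x y, T'.lowerBlock c = Quotient.mk _ x → T.lowerBlock c = Quotient.mk _ y →
      stack d (oneLine T.content) (Sum.inl x) (Sum.inr (Sum.inl y))) ∧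
    T'.FirstRowIncreasing

end SetPartitionTableau

/-- `𝒮𝒮𝒫𝒯(λ, k)`. -/
abbrev StandardSPT (k : ℕ) (lam : YoungDiagram) : Type :=
  {T : SetPartitionTableau k lam // T.IsStandard}

/-- The space `P_k^λ` with basis `N_T`, for `T ∈ 𝒮𝒮𝒫𝒯(λ, k)`. -/
abbrev NaturalModule (k : ℕ) (lam : YoungDiagram) : Type := StandardSPT k lam →₀ ℂ

open Classical in
/-- The vector `N_T` for a tableau `T` with increasing first row that need not be standard. The
part of `T` below the first row is straightened: if `n_t = ∑ c_s n_s` for the Young tableau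
`t` of `T`, then `N_T = ∑ c_s N_{T_s}`, where `T_s` is the tableau with the same propagating and
non-propagating blocks as `T` and with Young tableau `s`. -/
noncomputable def straightenedVector {k : ℕ} {lam : YoungDiagram} (T : SetPartitionTableau k lam) :
    NaturalModule k lam :=
  Finsupp.equivFunOnFinite.symm fun T' =>
    if T'.1.symDiagram = T.symDiagram then
      ∑ s : StandardYoungTableau (removeFirstRow lam),
        if T'.1.youngTableau = s.1 then (straightening T.youngTableau s : ℂ) else 0
    else 0

open Classical in
/-- `d · N_T = n ^ ℓ(d, T) N_{d(T)}` if `d(T)` is a set-partition tableau, and `0` otherwise. -/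
noncomputable def naturalActionVector {k : ℕ} {lam : YoungDiagram} (n : ℂ) (d : Diagram k)
    (T : StandardSPT k lam) : NaturalModule k lam :=
  if h : ∃ T' : SetPartitionTableau k lam, SetPartitionTableau.IsAction d T.1 T' then
    n ^ removed d (oneLine T.1.content) • straightenedVector h.choose
  else 0

/-- The action on the natural basis, extended linearly. -/
noncomputable def naturalAction (k : ℕ) (lam : YoungDiagram) (n : ℂ) :
    PartitionAlgebra k n →ₗ[ℂ] Module.End ℂ (NaturalModule k lam) :=
  PartitionAlgebra.lift fun d => Finsupp.linearCombination ℂ (naturalActionVector n d)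

/-- The restricted standard set-partition tableaux `𝒮𝒮𝒫𝒯(λ, 𝒲^m)`, `m = |λ*|`: the symmetric
diagram of `T` is a symmetric `m`-diagram in `𝒜_k`. -/
def restrictedSSPT (X : DiagramFamily) (k : ℕ) (lam : YoungDiagram) : Set (StandardSPT k lam) :=
  {T | X.Mem T.1.symDiagram ∧ IsSymmetricDiagram (removeFirstRow lam).card T.1.symDiagram}

/-- The span of the vectors `N_T` with `T ∈ 𝒮𝒮𝒫𝒯(λ, 𝒲^m)`. -/
noncomputable def restrictedModule (X : DiagramFamily) (k : ℕ) (lam : YoungDiagram) :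
    Submodule ℂ (NaturalModule k lam) :=
  Submodule.span ℂ ((fun T => Finsupp.single T (1 : ℂ)) '' restrictedSSPT X k lam)

/-- The number of elements of a block. -/
noncomputable def blockSize {k : ℕ} {π : Setoid (Fin k)} (q : Quotient π) : ℕ :=
  Nat.card {x : Fin k // Quotient.mk π x = q}

/-- All propagating blocks of `T` are singletons, and the sizes of the non-propagating blocks
satisfy `p`. -/
def HasBlockSizes {k : ℕ} {lam : YoungDiagram} (T : SetPartitionTableau k lam) (p : ℕ → Prop) :
    Prop :=
  ∀ q, (T.IsPropagating q → blockSize q = 1) ∧ (¬ T.IsPropagating q → p (blockSize q))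

/-- The shape of the blocks of the restricted set-partition tableaux. -/
def DiagramFamily.HasShape (X : DiagramFamily) {k : ℕ} {lam : YoungDiagram}
    (T : SetPartitionTableau k lam) : Prop :=
  match X with
  | partition => True
  | symmetric => HasBlockSizes T fun _ => False
  | rook => HasBlockSizes T fun s => s = 1
  | brauer => HasBlockSizes T fun s => s = 2
  | rookBrauer => HasBlockSizes T fun s => s = 1 ∨ s = 2
  | planarPartition => IsPlanar T.symDiagram
  | identity => (HasBlockSizes T fun _ => False) ∧ IsPlanar T.symDiagram
  | temperleyLieb => (HasBlockSizes T fun s => s = 2) ∧ IsPlanar T.symDiagram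
  | planarRook => (HasBlockSizes T fun s => s = 1) ∧ IsPlanar T.symDiagram
  | motzkin => (HasBlockSizes T fun s => s = 1 ∨ s = 2) ∧ IsPlanar T.symDiagram

end DiagramAlgebras

open DiagramAlgebras

/-! Both modules are realised as one and the same subspace of tensor space, that is, of the
functions on colourings of `k` points by `n` colours. A diagram acts there by the 0-1 matrix that
records which pairs of colourings are constant on its blocks. Every component deleted from the
middle row can be coloured freely in `n` ways, so this is a representation of the partition algebra
with parameter `n` (`diagramMatrix_mul`, `colourRep`).

The link with the combinatorics is the half diagram. A symmetric `m`-diagram `w` together with a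
numbering `τ` of its propagating blocks is the same as a diagram from `k` points to `m` points in
which the `m` bottom points lie in distinct propagating blocks, called full (`comp_half_transpose`,
`exists_half`). Under this dictionary the twisted conjugation is plain concatenation: `comp d (half
w τ) = half (conj d w) (σ * τ)`, where `σ` is the twist (`exists_twist`). Tableaux with increasing
first row are also full half diagrams, once a numbering of the boxes of `λ*` is fixed, and forming
`d(T)` is again concatenation with `d` (`tableauHalf_eq`, `IsAction.comp_tableauHalf`).

Each half diagram is applied to the tensor `(e_0 - e_1) ⊗ (e_2 - e_3) ⊗ ⋯`. The result vanishes if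
the half diagram is not full (`halfVec_eq_zero`), which produces the rule that the action is `0`
when the rank drops. The vectors of the full half diagrams are linearly independent because `n ≥ 2k`
leaves enough colours (`linearIndependent_halfVec`). Hence `w ⊗ v` can be sent to the combination of
the vectors of `half w τ` with the coefficients of `v`, and `N_T` to the image of `w_T ⊗ n_t`. Both
maps are injective and have the same image, which is stable under `A_k`. All module axioms and the
isomorphism follow by restriction from tensor space (`exists_restrict`, `exists_actions`).

For the straightening coefficients, Garnir relations show that the natural vectors of standard
tableaux span (`naturalVector_mem_span`). Their coefficients are unitriangular for a statistic on
tableaux, which yields both linear independence and integrality (`scalar_mem_of_coeff_mem`).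

For irreducibility, let `x` be a nonzero element of an invariant subspace. The half-diagram vectors
are real, so by positivity of the Hermitian form some transposed half diagram does not kill the
image of `x` (`eq_zero_of_transpose_mulVec`). Putting any upper half on top of that lower half gives
a diagram of `A_k` (`DiagramFamily.Mem.join`), and it carries `x` to a nonzero `w₁ ⊗ v` in the
subspace, for every `w₁`. The whole summand `w₁ ⊗ S_m` is then reached because the Specht module is
irreducible and, in the non-planar families, diagrams on `w₁` induce every permutation. In the
planar families the Specht module is one-dimensional.

That the families are closed under concatenation is proved by identifying the two middle rows one
pair of vertices at a time: each defining condition survives one identification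
(`mergeFirst_induction`). -/

namespace DiagramAlgebras

/-! ### Matrices of diagrams acting on colourings by an arbitrary finite set of colours -/

section Colour

variable {α β γ κ : Type}

/-- The colouring `f`, with colours in `κ`, is constant on the blocks of `d`. -/
def Compatible {ι : Type} (d : Setoid ι) (f : ι → κ) : Prop := ∀ x y, d x y → f x = f y

theorem compatible_stack (d : BiDiagram α β) (e : BiDiagram β γ) (a : α → κ) (b : β → κ)
    (c : γ → κ) : Compatible (stack d e) (Sum.elim a (Sum.elim b c)) ↔
      Compatible d (Sum.elim a b) ∧ Compatible e (Sum.elim b c) := by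
  constructor
  · intro h
    refine ⟨fun u v huv => ?_, fun u v huv => ?_⟩
    · have := h _ _ (Relation.EqvGen.rel _ _ (Or.inl ⟨u, v, huv, rfl, rfl⟩))
      rcases u with u | u <;> rcases v with v | v <;> simpa using this
    · have := h _ _ (Relation.EqvGen.rel _ _ (Or.inr ⟨u, v, huv, rfl, rfl⟩))
      simpa using this
  · rintro ⟨h₁, h₂⟩ x y hxy
    induction hxy with
    | rel x y h =>
      rcases h with ⟨u, v, huv, rfl, rfl⟩ | ⟨u, v, huv, rfl, rfl⟩
      · have := h₁ _ _ huv
        rcases u with u | u <;> rcases v with v | v <;> simpa using this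
      · simpa using h₂ _ _ huv
    | refl x => rfl
    | symm x y _ ih => exact ih.symm
    | trans x y z _ _ ih₁ ih₂ => exact ih₁.trans ih₂

theorem compatible_comp_of_stack {d : BiDiagram α β} {e : BiDiagram β γ} {a : α → κ}
    {b : β → κ} {c : γ → κ} (h : Compatible (stack d e) (Sum.elim a (Sum.elim b c))) :
    Compatible (comp d e) (Sum.elim a c) := by
  intro u v huv
  have := h _ _ huv
  rcases u with u | u <;> rcases v with v | v <;> simpa using this

open Classical in
/-- The extension of an outer colouring to the stacked diagram. -/
noncomputable def extendColour (d : BiDiagram α β) (e : BiDiagram β γ) (o : α ⊕ γ → κ)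
    (g : MiddleComponent d e → κ) (q : Quotient (stack d e)) : κ :=
  if h : ∃ u, Quotient.mk (stack d e) (Sum.map id Sum.inr u) = q then o h.choose
  else g ⟨q, by
    rintro (x | x | x) hx
    · exact absurd ⟨Sum.inl x, hx⟩ h
    · exact ⟨x, rfl⟩
    · exact absurd ⟨Sum.inr x, hx⟩ h⟩

theorem extendColour_outer {d : BiDiagram α β} {e : BiDiagram β γ} {o : α ⊕ γ → κ}
    (ho : Compatible (comp d e) o) (g : MiddleComponent d e → κ) (u : α ⊕ γ) :
    extendColour d e o g (Quotient.mk _ (Sum.map id Sum.inr u)) = o u := by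
  have h : ∃ u', Quotient.mk (stack d e) (Sum.map id Sum.inr u') =
    Quotient.mk (stack d e) (Sum.map id Sum.inr u) := ⟨u, rfl⟩
  rw [extendColour, dif_pos h]
  have hs : stack d e (Sum.map id Sum.inr h.choose) (Sum.map id Sum.inr u) :=
    Quotient.exact h.choose_spec
  exact ho _ _ hs

theorem extendColour_middle {d : BiDiagram α β} {e : BiDiagram β γ} (o : α ⊕ γ → κ)
    (g : MiddleComponent d e → κ) (q : MiddleComponent d e) :
    extendColour d e o g q.1 = g q := by
  have h : ¬ ∃ u, Quotient.mk (stack d e) (Sum.map id Sum.inr u) = q.1 := by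
    rintro ⟨u, hu⟩
    obtain ⟨b, hb⟩ := q.2 _ hu
    rcases u with u | u <;> simp at hb
  rw [extendColour, dif_neg h]
  rfl

/-- The colourings of the middle row compatible with a given colouring of the outer rows. -/
noncomputable def middleEquiv (d : BiDiagram α β) (e : BiDiagram β γ) (a : α → κ)
    (c : γ → κ) (ho : Compatible (comp d e) (Sum.elim a c)) :
    {b : β → κ // Compatible d (Sum.elim a b) ∧ Compatible e (Sum.elim b c)} ≃
      (MiddleComponent d e → κ) where
  toFun b q := Quotient.lift (Sum.elim a (Sum.elim b.1 c)) ((compatible_stack d e a b.1 c).2 b.2) q.1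
  invFun g := ⟨fun x => extendColour d e (Sum.elim a c) g (Quotient.mk _ (Sum.inr (Sum.inl x))), by
    rw [← compatible_stack]
    have key : Sum.elim a (Sum.elim (fun x => extendColour d e (Sum.elim a c) g
        (Quotient.mk _ (Sum.inr (Sum.inl x)))) c) =
        fun z => extendColour d e (Sum.elim a c) g (Quotient.mk _ z) := by
      funext z
      rcases z with z | z | z
      · exact (extendColour_outer ho g (Sum.inl z)).symm
      · rfl
      · exact (extendColour_outer ho g (Sum.inr z)).symm
    rw [key]
    intro x y hxy
    exact congrArg _ (Quotient.sound hxy)⟩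
  left_inv b := by
    apply Subtype.ext
    funext x
    have hs := (compatible_stack d e a b.1 c).2 b.2
    by_cases h : ∃ u, Quotient.mk (stack d e) (Sum.map id Sum.inr u) =
        Quotient.mk (stack d e) (Sum.inr (Sum.inl x))
    · obtain ⟨u, hu⟩ := h
      have h₁ := extendColour_outer ho
        (fun q => Quotient.lift (Sum.elim a (Sum.elim b.1 c)) hs q.1) u
      have h₂ := hs _ _ (Quotient.exact hu)
      simp only
      rw [← hu, h₁]
      rcases u with u | u <;> simpa using h₂
    · have hm : ∀ y, Quotient.mk (stack d e) y = Quotient.mk (stack d e) (Sum.inr (Sum.inl x)) →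
          ∃ b, y = Sum.inr (Sum.inl b) := by
        rintro (y | y | y) hy
        · exact absurd ⟨Sum.inl y, hy⟩ h
        · exact ⟨y, rfl⟩
        · exact absurd ⟨Sum.inr y, hy⟩ h
      exact extendColour_middle (Sum.elim a c)
        (fun q => Quotient.lift (Sum.elim a (Sum.elim b.1 c)) hs q.1)
        (⟨_, hm⟩ : MiddleComponent d e)
  right_inv g := by
    funext q
    obtain ⟨q, hq⟩ := q
    induction q using Quotient.inductionOn with
    | h z =>
      obtain ⟨x, rfl⟩ := hq z rfl
      exact extendColour_middle (Sum.elim a c) g ⟨_, hq⟩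

open Classical in
/-- The matrix of a diagram, indexed by colourings of its rows with colours in `κ`. -/
noncomputable def diagramMatrix (κ : Type) (d : BiDiagram α β) : Matrix (α → κ) (β → κ) ℂ :=
  fun a b => if Compatible d (Sum.elim a b) then 1 else 0

/-- Once the outer rows are coloured, a middle vertex connected to an outer vertex has a forced
colour, while each component inside the middle row takes any of the colours independently. This is
the origin of the power in the product of diagrams. -/
theorem diagramMatrix_mul [Fintype α] [Fintype β] [Fintype γ] [DecidableEq β] [Fintype κ]
    (d : BiDiagram α β) (e : BiDiagram β γ) :
    diagramMatrix κ d * diagramMatrix κ e =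
      (Fintype.card κ : ℂ) ^ removed d e • diagramMatrix κ (comp d e) := by
  classical
  ext a c
  have hsum : (diagramMatrix κ d * diagramMatrix κ e) a c =
      (Nat.card {b : β → κ // Compatible d (Sum.elim a b) ∧ Compatible e (Sum.elim b c)} : ℂ) := by
    rw [Matrix.mul_apply, Nat.card_eq_fintype_card, Fintype.card_subtype, Finset.card_filter,
      Nat.cast_sum]
    refine Finset.sum_congr rfl fun b _ => ?_
    simp only [diagramMatrix]
    by_cases h₁ : Compatible d (Sum.elim a b) <;> by_cases h₂ : Compatible e (Sum.elim b c) <;>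
      simp [h₁, h₂]
  rw [hsum, Matrix.smul_apply]
  by_cases ho : Compatible (comp d e) (Sum.elim a c)
  · have : Finite (MiddleComponent d e) := Subtype.finite
    rw [Nat.card_congr (middleEquiv d e a c ho), Nat.card_fun]
    simp [diagramMatrix, ho, removed]
  · have : IsEmpty {b : β → κ // Compatible d (Sum.elim a b) ∧ Compatible e (Sum.elim b c)} :=
      ⟨fun b => ho (compatible_comp_of_stack ((compatible_stack d e a b.1 c).2 b.2))⟩
    simp [diagramMatrix, ho]

theorem diagramMatrix_transpose (d : BiDiagram α β) :
    diagramMatrix κ (transpose d) = (diagramMatrix κ d).transpose := by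
  classical
  ext a b
  have : Compatible (transpose d) (Sum.elim a b) ↔ Compatible d (Sum.elim b a) := by
    constructor
    · intro h x y hxy
      have := h x.swap y.swap (by
        change d x.swap.swap y.swap.swap
        rwa [Sum.swap_swap, Sum.swap_swap])
      rcases x with x | x <;> rcases y with y | y <;> simpa using this
    · intro h x y hxy
      have := h x.swap y.swap hxy
      rcases x with x | x <;> rcases y with y | y <;> simpa using this
  simp [diagramMatrix, this]

theorem diagramMatrix_id [DecidableEq (α → κ)] :
    diagramMatrix κ (idDiagram α) = (1 : Matrix (α → κ) (α → κ) ℂ) := by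
  ext a b
  have : Compatible (idDiagram α) (Sum.elim a b) ↔ a = b := by
    constructor
    · intro h
      funext x
      exact h (Sum.inl x) (Sum.inr x) rfl
    · rintro rfl (u | u) (v | v) h <;> exact congrArg a h
  simp [diagramMatrix, this, Matrix.one_apply]

end Colour

/-! ### Connected components of stacked diagrams -/

section Stack

variable {α β γ δ : Type}

theorem stack_upper {d : BiDiagram α β} {e : BiDiagram β γ} {u v : α ⊕ β} (h : d u v) :
    stack d e (Sum.map id Sum.inl u) (Sum.map id Sum.inl v) :=
  Relation.EqvGen.rel _ _ (Or.inl ⟨u, v, h, rfl, rfl⟩)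

theorem stack_lower {d : BiDiagram α β} {e : BiDiagram β γ} {u v : β ⊕ γ} (h : e u v) :
    stack d e (Sum.inr u) (Sum.inr v) :=
  Relation.EqvGen.rel _ _ (Or.inr ⟨u, v, h, rfl, rfl⟩)

/-- `stack d e` is the least equivalence relation containing the edges. -/
theorem stack_le {d : BiDiagram α β} {e : BiDiagram β γ} {s : Setoid (α ⊕ (β ⊕ γ))}
    (hd : ∀ u v, d u v → s (Sum.map id Sum.inl u) (Sum.map id Sum.inl v))
    (he : ∀ u v, e u v → s (Sum.inr u) (Sum.inr v)) {x y : α ⊕ (β ⊕ γ)} (h : stack d e x y) :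
    s x y := by
  induction h with
  | rel x y h =>
    rcases h with ⟨u, v, huv, rfl, rfl⟩ | ⟨u, v, huv, rfl, rfl⟩
    · exact hd _ _ huv
    · exact he _ _ huv
  | refl x => exact s.refl' x
  | symm x y _ ih => exact s.symm' ih
  | trans x y z _ _ ih₁ ih₂ => exact s.trans' ih₁ ih₂

/-- A property that is constant along the edges is constant along the components. -/
theorem stack_induction {d : BiDiagram α β} {e : BiDiagram β γ} {π : Type*}
    (P : α ⊕ (β ⊕ γ) → π)
    (hd : ∀ u v, d u v → P (Sum.map id Sum.inl u) = P (Sum.map id Sum.inl v))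
    (he : ∀ u v, e u v → P (Sum.inr u) = P (Sum.inr v)) {x y : α ⊕ (β ⊕ γ)}
    (h : stack d e x y) : P x = P y :=
  stack_le (s := Setoid.ker P) hd he h

/-- A path that enters the bottom row of `e` comes back to the middle row within the same block of
`e`, so it can be replaced by an edge of the middle row. The two bottom rows may therefore be
different types. -/
theorem stack_upper_mono {d : BiDiagram α β} {e : BiDiagram β γ} {e' : BiDiagram β δ}
    (h : ∀ b b', e (Sum.inl b) (Sum.inl b') → e' (Sum.inl b) (Sum.inl b')) {u v : α ⊕ β}
    (huv : stack d e (Sum.map id Sum.inl u) (Sum.map id Sum.inl v)) :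
    stack d e' (Sum.map id Sum.inl u) (Sum.map id Sum.inl v) := by
  -- A bottom vertex of `e` has no counterpart in the other stack. It is represented by the union of
  -- the components of the middle vertices joined to it, which is a single component or empty.
  let A : α ⊕ (β ⊕ γ) → Set (α ⊕ (β ⊕ δ)) := Sum.elim (fun a => {p | stack d e' (Sum.inl a) p})
    (Sum.elim (fun b => {p | stack d e' (Sum.inr (Sum.inl b)) p})
      (fun c => {p | ∃ b, e (Sum.inl b) (Sum.inr c) ∧ stack d e' (Sum.inr (Sum.inl b)) p}))
  have hA : ∀ u : α ⊕ β, A (Sum.map id Sum.inl u) =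
      {p | stack d e' (Sum.map id Sum.inl u) p} := by rintro (u | u) <;> rfl
  have hcongr : ∀ x y, stack d e' x y → {p | stack d e' x p} = {p | stack d e' y p} := by
    intro x y hxy
    ext p
    exact ⟨fun hp => Setoid.trans' _ (Setoid.symm' _ hxy) hp, fun hp => Setoid.trans' _ hxy hp⟩
  have hbc : ∀ b c, e (Sum.inl b) (Sum.inr c) → A (Sum.inr (Sum.inl b)) = A (Sum.inr (Sum.inr c)) := by
    intro b c hbc
    ext p
    constructor
    · intro hp
      exact ⟨b, hbc, hp⟩
    · rintro ⟨b', hb', hp⟩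
      exact Setoid.trans' _ (stack_lower (h _ _ (e.trans' hbc (e.symm' hb')))) hp
  have key := stack_induction (d := d) (e := e) A ?_ ?_ huv
  · rw [hA, hA] at key
    have : stack d e' (Sum.map id Sum.inl v) (Sum.map id Sum.inl v) := Setoid.refl' _ _
    exact (Set.ext_iff.1 key (Sum.map id Sum.inl v)).2 this
  · intro u v huv
    rw [hA, hA]
    exact hcongr _ _ (stack_upper huv)
  · rintro (b | c) (b' | c') huv
    · exact hcongr _ _ (stack_lower (h _ _ huv))
    · exact hbc _ _ huv
    · exact (hbc _ _ (e.symm' huv)).symm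
    · ext p
      constructor
      · rintro ⟨b, hb, hp⟩
        exact ⟨b, e.trans' hb huv, hp⟩
      · rintro ⟨b, hb, hp⟩
        exact ⟨b, e.trans' hb (e.symm' huv), hp⟩

/-- On the two upper rows, the components of a stack depend only on the upper row of the lower
diagram. -/
theorem stack_upper_congr {d : BiDiagram α β} {e : BiDiagram β γ} {e' : BiDiagram β δ}
    (h : ∀ b b', e (Sum.inl b) (Sum.inl b') ↔ e' (Sum.inl b) (Sum.inl b')) (u v : α ⊕ β) :
    stack d e (Sum.map id Sum.inl u) (Sum.map id Sum.inl v) ↔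
      stack d e' (Sum.map id Sum.inl u) (Sum.map id Sum.inl v) :=
  ⟨stack_upper_mono fun b b' => (h b b').1, stack_upper_mono fun b b' => (h b b').2⟩

theorem transpose_apply {d : BiDiagram α β} {u v : β ⊕ α} :
    transpose d u v ↔ d u.swap v.swap := Iff.rfl

theorem transpose_transpose (d : BiDiagram α β) : transpose (transpose d) = d := by
  ext u v
  simp [transpose_apply]

theorem transpose_comp (d : BiDiagram α β) (e : BiDiagram β γ) :
    transpose (comp d e) = comp (transpose e) (transpose d) := by
  -- One inclusion for all diagrams suffices: the other one is the same inclusion for the transposed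
  -- diagrams.
  have key : ∀ {α β γ : Type} (d : BiDiagram α β) (e : BiDiagram β γ) u v,
      transpose (comp d e) u v → comp (transpose e) (transpose d) u v := by
    intro α β γ d e u v h
    let f : α ⊕ (β ⊕ γ) → γ ⊕ (β ⊕ α) :=
      Sum.elim (fun a => Sum.inr (Sum.inr a)) (Sum.elim (fun b => Sum.inr (Sum.inl b)) Sum.inl)
    have := stack_le (d := d) (e := e) (s := (stack (transpose e) (transpose d)).comap f) ?_ ?_ h
    · rcases u with u | u <;> rcases v with v | v <;> exact this
    · intro u v huv
      have : transpose d u.swap v.swap := by simpa [transpose_apply] using huv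
      have := stack_lower (d := transpose e) this
      rcases u with u | u <;> rcases v with v | v <;> exact this
    · intro u v huv
      have : transpose e u.swap v.swap := by simpa [transpose_apply] using huv
      have := stack_upper (e := transpose d) this
      rcases u with u | u <;> rcases v with v | v <;> exact this
  ext u v
  refine ⟨key d e u v, fun h => ?_⟩
  have h' : transpose (comp (transpose e) (transpose d)) u.swap v.swap := by
    simpa [transpose_apply] using h
  have := key _ _ _ _ h'
  rw [transpose_transpose, transpose_transpose] at this
  exact this

/-- In the composition of a diagram with its mirror image, blocks are blocks of the diagram. -/
theorem comp_transpose_apply (g : BiDiagram α β) (u v : α ⊕ α) :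
    comp g (transpose g) u v ↔ g (Sum.inl (Sum.elim id id u)) (Sum.inl (Sum.elim id id v)) ∧
      (u.isLeft = v.isLeft ∨ ∃ i, g (Sum.inl (Sum.elim id id u)) (Sum.inr i)) := by
  let fold : α ⊕ (β ⊕ α) → α ⊕ β := Sum.elim Sum.inl (Sum.elim Sum.inr Sum.inl)
  have hfold : ∀ {x y}, stack g (transpose g) x y → g (fold x) (fold y) := by
    intro x y h
    refine stack_le (s := g.comap fold) ?_ ?_ h
    · rintro (u | u) (v | v) h <;> exact h
    · rintro (u | u) (v | v) h <;> exact h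
  have hup : ∀ {x y}, g x y → stack g (transpose g) (Sum.map id Sum.inl x) (Sum.map id Sum.inl y) :=
    fun h => stack_upper h
  have hlow : ∀ {x y}, g x y → stack g (transpose g) (Sum.inr x.swap) (Sum.inr y.swap) :=
    fun {x y} h => stack_lower (by simpa [transpose_apply] using h)
  constructor
  · intro h
    have h1 := hfold h
    have h1' : g (Sum.inl (Sum.elim id id u)) (Sum.inl (Sum.elim id id v)) := by
      rcases u with u | u <;> rcases v with v | v <;> exact h1
    refine ⟨h1', ?_⟩
    by_contra hc
    push Not at hc
    -- If the block of `u` contains no middle vertex, then being in this block and on the same side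
    -- as `u` is preserved by all edges, so `u` and its mirror image stay disconnected.
    have key := stack_induction (d := g) (e := transpose g)
      (fun z => g (Sum.inl (Sum.elim id id u)) (fold z) ∧
        Sum.elim (fun _ => true) (fun _ => false) z = u.isLeft) ?_ ?_ h
    · have h2 : g (Sum.inl (Sum.elim id id u)) (fold (Sum.map id Sum.inr u)) := by
        rcases u with u | u <;> exact g.refl' _
      have h3 := (key.mp ⟨h2, by rcases u with u | u <;> rfl⟩).2
      apply hc.1
      rw [← h3]
      rcases v with v | v <;> rfl
    · rintro (a | b) (a' | b') hab
      · exact propext ⟨fun h => ⟨g.trans' h.1 hab, h.2⟩, fun h => ⟨g.trans' h.1 (g.symm' hab), h.2⟩⟩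
      · exact propext ⟨fun h => absurd (g.trans' h.1 hab) (hc.2 b'), fun h => absurd h.1 (hc.2 b')⟩
      · exact propext ⟨fun h => absurd h.1 (hc.2 b),
          fun h => absurd (g.trans' h.1 (g.symm' hab)) (hc.2 b)⟩
      · exact propext ⟨fun h => absurd h.1 (hc.2 b), fun h => absurd h.1 (hc.2 b')⟩
    · rintro (b | a) (b' | a') hab
      · exact propext ⟨fun h => absurd h.1 (hc.2 b), fun h => absurd h.1 (hc.2 b')⟩
      · exact propext ⟨fun h => absurd h.1 (hc.2 b),
          fun h => absurd (g.trans' h.1 (g.symm' hab)) (hc.2 b)⟩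
      · exact propext ⟨fun h => absurd (g.trans' h.1 hab) (hc.2 b'), fun h => absurd h.1 (hc.2 b')⟩
      · exact propext ⟨fun h => ⟨g.trans' h.1 hab, h.2⟩, fun h => ⟨g.trans' h.1 (g.symm' hab), h.2⟩⟩
  · rintro ⟨h, h'⟩
    rcases h' with h' | ⟨i, hi⟩
    · rcases u with u | u <;> rcases v with v | v <;> simp at h'
      · exact hup h
      · exact hlow h
    · have hi' := g.trans' (g.symm' h) hi
      rcases u with u | u <;> rcases v with v | v
      · exact hup h
      · exact (stack g (transpose g)).trans' (hup hi) (hlow (g.symm' hi'))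
      · exact (stack g (transpose g)).trans' (hlow hi) (hup (g.symm' hi'))
      · exact hlow h

end Stack

/-! ### Half diagrams -/

section Full

variable {α β L : Type}

/-- A diagram with bottom row `L` is full if its bottom vertices lie in distinct propagating
blocks. -/
def IsFull (h : BiDiagram α L) : Prop :=
  (∀ i, ∃ x, h (Sum.inl x) (Sum.inr i)) ∧ ∀ i j, h (Sum.inr i) (Sum.inr j) → i = j

/-- A full diagram consists of the set partition of its top row and, for each label, a block
carrying it. One representative of each labelled block is enough to compare the labels. -/
theorem IsFull.ext {g h : BiDiagram α L} (hg : IsFull g) (hh : IsFull h)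
    (htop : ∀ x y, g (Sum.inl x) (Sum.inl y) ↔ h (Sum.inl x) (Sum.inl y))
    (hlab : ∀ i, ∃ x, g (Sum.inl x) (Sum.inr i) ∧ h (Sum.inl x) (Sum.inr i)) : g = h := by
  have key : ∀ x i, g (Sum.inl x) (Sum.inr i) ↔ h (Sum.inl x) (Sum.inr i) := by
    intro x i
    obtain ⟨y, hy, hy'⟩ := hlab i
    exact ⟨fun hx => h.trans' ((htop _ _).1 (g.trans' hx (g.symm' hy))) hy',
      fun hx => g.trans' ((htop _ _).2 (h.trans' hx (h.symm' hy'))) hy⟩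
  ext (x | i) (y | j)
  · exact htop x y
  · exact key x j
  · exact ⟨fun hx => h.symm' ((key _ _).1 (g.symm' hx)), fun hx => g.symm' ((key _ _).2 (h.symm' hx))⟩
  · constructor
    · intro hij
      rw [hg.2 _ _ hij]
    · intro hij
      rw [hh.2 _ _ hij]

theorem removed_eq_zero {d : BiDiagram α β} (e : BiDiagram β L)
    (h : ∀ b, ∃ a, d (Sum.inl a) (Sum.inr b)) : removed d e = 0 := by
  have : IsEmpty (MiddleComponent d e) := by
    refine ⟨fun ⟨q, hq⟩ => ?_⟩
    induction q using Quotient.inductionOn with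
    | h z =>
      obtain ⟨b, rfl⟩ := hq z rfl
      obtain ⟨a, ha⟩ := h b
      obtain ⟨b', hb'⟩ := hq (Sum.inl a) (Quotient.sound (stack_upper (e := e) ha))
      exact Sum.inl_ne_inr hb'
  exact Nat.card_of_isEmpty

/-- Full diagrams connect all their bottom vertices to the top, so stacking anything below them
deletes nothing. Associativity of the number of deleted components then gives the equality. -/
theorem removed_comp_transpose [Finite α] [Finite β] [Finite L] {d : BiDiagram α β}
    {h : BiDiagram β L} (hh : IsFull h) (hdh : IsFull (comp d h)) {γ : Type} [Finite γ]
    (e : BiDiagram L γ) : removed d (comp h e) = removed d h := by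
  have := (comp_assoc_and_removed d h e).2
  rw [removed_eq_zero _ hh.1, removed_eq_zero _ hdh.1] at this
  omega

theorem comp_comp_transpose [Finite α] [Finite β] [Finite L] (d : BiDiagram α β)
    (h : BiDiagram β L) :
    comp (comp d (comp h (transpose h))) (transpose d) =
      comp (comp d h) (transpose (comp d h)) := by
  rw [transpose_comp, ← (comp_assoc_and_removed d h (transpose h)).1,
    (comp_assoc_and_removed (comp d h) (transpose h) (transpose d)).1]

theorem IsFull.transpose_comp_self {h : BiDiagram α L} (hh : IsFull h) :
    comp (transpose h) h = idDiagram L := by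
  have := comp_transpose_apply (transpose h)
  rw [transpose_transpose] at this
  ext u v
  rw [this]
  constructor
  · rintro ⟨h1, -⟩
    have := hh.2 _ _ h1
    rcases u with u | u <;> rcases v with v | v <;> exact this
  · intro huv
    have huv' : Sum.elim id id u = Sum.elim id id v := by
      rcases u with u | u <;> rcases v with v | v <;> exact huv
    rw [huv']
    refine ⟨Setoid.refl' _ _, Or.inr ?_⟩
    obtain ⟨x, hx⟩ := hh.1 (Sum.elim id id v)
    exact ⟨x, h.symm' hx⟩

/-- Between rows of the same finite size, fullness forces a permutation diagram: distinct labels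
choose distinct top vertices, and these exhaust the row. -/
theorem IsFull.comp_transpose_self [Finite L] {q : BiDiagram L L} (hq : IsFull q) :
    comp q (transpose q) = idDiagram L := by
  choose f hf using hq.1
  have hinj : Function.Injective f := fun i j hij => hq.2 _ _
    (q.trans' (q.symm' (hf i)) (by rw [hij]; exact hf j))
  have hsurj := Finite.surjective_of_injective hinj
  ext u v
  rw [comp_transpose_apply]
  obtain ⟨i, hi⟩ := hsurj (Sum.elim id id u)
  obtain ⟨j, hj⟩ := hsurj (Sum.elim id id v)
  have hid : idDiagram L u v ↔ Sum.elim id id u = Sum.elim id id v := by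
    rcases u with u | u <;> rcases v with v | v <;> exact Iff.rfl
  rw [hid, ← hi, ← hj]
  constructor
  · rintro ⟨h1, -⟩
    rw [hq.2 i j (q.trans' (q.symm' (hf i)) (q.trans' h1 (hf j)))]
  · intro hij
    rw [hij]
    exact ⟨q.refl' _, Or.inr ⟨j, hf j⟩⟩

/-- A bottom vertex whose block in `q` misses the middle row can never be connected to the top by
adding `g`. -/
theorem IsFull.right_of_comp {g : BiDiagram α β} {q : BiDiagram β L} (h : IsFull (comp g q)) :
    IsFull q := by
  refine ⟨fun i => ?_, fun i j hij => h.2 i j (stack_lower hij)⟩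
  by_contra hc
  push Not at hc
  obtain ⟨x, hx⟩ := h.1 i
  have key := stack_induction (d := g) (e := q)
    (fun z => Sum.elim (fun _ => False) (fun z => q z (Sum.inr i)) z) ?_ ?_ hx
  · exact key.mpr (q.refl' _)
  · rintro (u | u) (v | v) huv
    · rfl
    · exact propext ⟨False.elim, fun hv => hc v hv⟩
    · exact propext ⟨fun hv => hc u hv, False.elim⟩
    · exact propext ⟨fun hv => absurd hv (hc u), fun hv => absurd hv (hc v)⟩
  · intro u v huv
    exact propext ⟨fun hv => q.trans' (q.symm' huv) hv, fun hv => q.trans' huv hv⟩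

/-- Here `q` is a permutation of the labels, and it cancels against its mirror image. -/
theorem comp_perm_conj [Finite α] [Finite L] {g : BiDiagram α L} {q : BiDiagram L L}
    (h : IsFull (comp g q)) :
    comp (comp g q) (transpose (comp g q)) = comp g (transpose g) := by
  rw [← comp_comp_transpose, h.right_of_comp.comp_transpose_self, (comp_id_and_removed g).1]

/-- Full diagrams correspond to symmetric diagrams of maximal rank. -/
theorem rank_comp_transpose {k : ℕ} [Fintype L] (g : BiDiagram (Fin k) L) :
    rank (comp g (transpose g)) ≤ Fintype.card L ∧
      (rank (comp g (transpose g)) = Fintype.card L ↔ IsFull g) := by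
  classical
  set W : Diagram k := comp g (transpose g) with hW
  let Q := {q : Quotient W // (∃ i : Fin k, Quotient.mk W (Sum.inl i) = q) ∧
    ∃ j : Fin k, Quotient.mk W (Sum.inr j) = q}
  -- Each propagating block of the product carries a label of `g`. Choosing one injects the blocks
  -- into `L`, and the rank is maximal exactly when this injection is a bijection.
  have hex : ∀ q : Q, ∃ i x, g (Sum.inl x) (Sum.inr i) ∧ Quotient.mk W (Sum.inl x) = q.1 := by
    rintro ⟨q, ⟨x, hx⟩, ⟨y, hy⟩⟩
    have : W (Sum.inl x) (Sum.inr y) := Quotient.exact (hx.trans hy.symm)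
    rw [hW, comp_transpose_apply] at this
    obtain ⟨i, hi⟩ := this.2.resolve_left (by simp)
    exact ⟨i, x, hi, hx⟩
  choose f x hf hx using hex
  have hinj : Function.Injective f := by
    intro q q' h
    apply Subtype.ext
    rw [← hx q, ← hx q']
    apply Quotient.sound
    change W _ _
    rw [hW, comp_transpose_apply]
    exact ⟨g.trans' (hf q) (by rw [h]; exact g.symm' (hf q')), Or.inl rfl⟩
  have hle : Nat.card Q ≤ Nat.card L := Nat.card_le_card_of_injective f hinj
  rw [Nat.card_eq_fintype_card (α := L)] at hle
  refine ⟨hle, fun h => ?_, fun h => ?_⟩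
  · have hbij : Function.Bijective f :=
      (Nat.bijective_iff_injective_and_card f).2 ⟨hinj, h.trans (Nat.card_eq_fintype_card).symm⟩
    refine ⟨fun i => ?_, fun i j hij => ?_⟩
    · obtain ⟨q, rfl⟩ := hbij.2 i
      exact ⟨_, hf q⟩
    · obtain ⟨q, rfl⟩ := hbij.2 i
      obtain ⟨q', rfl⟩ := hbij.2 j
      congr 1
      apply Subtype.ext
      rw [← hx q, ← hx q']
      apply Quotient.sound
      change W _ _
      rw [hW, comp_transpose_apply]
      exact ⟨g.trans' (hf q) (g.trans' hij (g.symm' (hf q'))), Or.inl rfl⟩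
  · refine le_antisymm hle ?_
    choose y hy using h.1
    have hWy : ∀ i, W (Sum.inl (y i)) (Sum.inr (y i)) := fun i => by
      rw [hW, comp_transpose_apply]
      exact ⟨g.refl' _, Or.inr ⟨i, hy i⟩⟩
    let e : L → Q := fun i => ⟨Quotient.mk W (Sum.inl (y i)), ⟨y i, rfl⟩,
      ⟨y i, Quotient.sound (W.symm' (hWy i))⟩⟩
    have he : Function.Injective e := by
      intro i j hij
      have : W (Sum.inl (y i)) (Sum.inl (y j)) := Quotient.exact (congrArg Subtype.val hij)
      rw [hW, comp_transpose_apply] at this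
      exact h.2 _ _ (g.trans' (g.symm' (hy i)) (g.trans' this.1 (hy j)))
    rw [← Nat.card_eq_fintype_card]
    exact Nat.card_le_card_of_injective e he

theorem propagates_comp_transpose {k : ℕ} {g : BiDiagram (Fin k) L} {x : Fin k} :
    Propagates (comp g (transpose g)) x ↔ ∃ i, g (Sum.inl x) (Sum.inr i) := by
  constructor
  · rintro ⟨y, hy⟩
    rw [comp_transpose_apply] at hy
    exact hy.2.resolve_left (by simp)
  · intro h
    refine ⟨x, ?_⟩
    rw [comp_transpose_apply]
    exact ⟨g.refl' _, Or.inr h⟩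

theorem IsFull.isSymmetricDiagram {k : ℕ} [Fintype L] {g : BiDiagram (Fin k) L} (hg : IsFull g) :
    IsSymmetricDiagram (Fintype.card L) (comp g (transpose g)) := by
  refine ⟨by rw [transpose_comp, transpose_transpose], (rank_comp_transpose g).2.2 hg,
    fun i hi => ?_⟩
  rw [comp_transpose_apply]
  exact ⟨g.refl' _, Or.inr (propagates_comp_transpose.1 hi)⟩

end Full

/-! ### The index of a propagating block -/

section BlockIndex

variable {k : ℕ}

theorem card_filter_lt_lt {ι : Type*} [LinearOrder ι] {Y : Finset ι} {a b : ι} (ha : a ∈ Y) :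
    (Y.filter (· < a)).card < (Y.filter (· < b)).card ↔ a < b := by
  constructor
  · intro h
    by_contra hc
    refine absurd (Finset.card_le_card ?_) (not_le.2 h)
    intro y hy
    rw [Finset.mem_filter] at hy ⊢
    exact ⟨hy.1, hy.2.trans_le (not_lt.1 hc)⟩
  · intro h
    refine Finset.card_lt_card ⟨fun y hy => ?_, fun hs => ?_⟩
    · rw [Finset.mem_filter] at hy ⊢
      exact ⟨hy.1, hy.2.trans h⟩
    · have := hs (Finset.mem_filter.2 ⟨ha, h⟩)
      exact absurd (Finset.mem_filter.1 this).2 (lt_irrefl _)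

theorem exists_card_filter_lt {ι : Type*} [LinearOrder ι] {Y : Finset ι} {i : ℕ}
    (hi : i < Y.card) : ∃ a ∈ Y, (Y.filter (· < a)).card = i := by
  have himg : Y.image (fun a => (Y.filter (· < a)).card) = Finset.range Y.card := by
    apply Finset.eq_of_subset_of_card_le
    · intro j hj
      obtain ⟨a, ha, rfl⟩ := Finset.mem_image.1 hj
      refine Finset.mem_range.2 (Finset.card_lt_card ⟨Finset.filter_subset _ _, fun hs => ?_⟩)
      exact absurd (Finset.mem_filter.1 (hs ha)).2 (lt_irrefl _)
    · rw [Finset.card_range, Finset.card_image_of_injOn]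
      intro a ha b hb hab
      rcases lt_trichotomy a b with h | h | h
      · exact absurd ((card_filter_lt_lt ha).2 h) (by simpa using hab.ge)
      · exact h
      · exact absurd ((card_filter_lt_lt hb).2 h) (by simpa using hab.le)
  have : i ∈ Y.image (fun a => (Y.filter (· < a)).card) := by
    rw [himg]
    exact Finset.mem_range.2 hi
  exact Finset.mem_image.1 this

open Classical in
/-- The maximal entries of the top rows of the propagating blocks. -/
noncomputable def propMaxima (w : Diagram k) : Finset (Fin k) :=
  Finset.univ.filter fun y => Propagates w y ∧ ∀ z, w (Sum.inl y) (Sum.inl z) → z ≤ y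

theorem mem_propMaxima {w : Diagram k} {y : Fin k} :
    y ∈ propMaxima w ↔ Propagates w y ∧ ∀ z, w (Sum.inl y) (Sum.inl z) → z ≤ y := by
  simp [propMaxima]

theorem Propagates.congr {w : Diagram k} {x y : Fin k} (h : Propagates w x)
    (hxy : w (Sum.inl x) (Sum.inl y)) : Propagates w y :=
  h.imp fun _ hj => w.trans' (w.symm' hxy) hj

theorem exists_top_max (w : Diagram k) (x : Fin k) :
    ∃ y, w (Sum.inl x) (Sum.inl y) ∧ ∀ z, w (Sum.inl x) (Sum.inl z) → z ≤ y := by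
  classical
  obtain ⟨y, hy, hmax⟩ := (Finset.univ.filter fun y => w (Sum.inl x) (Sum.inl y)).exists_max_image id
    ⟨x, by simp⟩
  refine ⟨y, (Finset.mem_filter.1 hy).2, fun z hz => hmax z ?_⟩
  simpa using hz

theorem exists_propMaxima {w : Diagram k} {x : Fin k} (hx : Propagates w x) :
    ∃ y ∈ propMaxima w, w (Sum.inl x) (Sum.inl y) := by
  obtain ⟨y, hy, hmax⟩ := exists_top_max w x
  exact ⟨y, mem_propMaxima.2 ⟨hx.congr hy, fun z hz => hmax z (w.trans' hy hz)⟩, hy⟩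

theorem propMaxima_eq {w : Diagram k} {y z : Fin k} (hy : y ∈ propMaxima w)
    (hz : z ∈ propMaxima w) (h : w (Sum.inl y) (Sum.inl z)) : y = z :=
  le_antisymm ((mem_propMaxima.1 hz).2 _ (w.symm' h)) ((mem_propMaxima.1 hy).2 _ h)

theorem card_propMaxima (w : Diagram k) : (propMaxima w).card = rank w := by
  rw [rank, ← Nat.card_eq_finsetCard]
  refine Nat.card_congr (Equiv.ofBijective (fun y => ⟨Quotient.mk w (Sum.inl y.1), ⟨y.1, rfl⟩,
    (mem_propMaxima.1 y.2).1.imp fun j hj => Quotient.sound (w.symm' hj)⟩) ⟨?_, ?_⟩)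
  · intro y z h
    exact Subtype.ext (propMaxima_eq y.2 z.2 (Quotient.exact (congrArg Subtype.val h)))
  · rintro ⟨q, ⟨x, hx⟩, ⟨j, hj⟩⟩
    obtain ⟨y, hy, hxy⟩ := exists_propMaxima (w := w) ⟨j, Quotient.exact (hx.trans hj.symm)⟩
    exact ⟨⟨y, hy⟩, Subtype.ext ((Quotient.sound (w.symm' hxy)).trans hx)⟩

/-- Being smaller than some entry of a block means being smaller than its maximum, so the index is
the position of that maximum in `propMaxima w`. -/
theorem blockIndex_eq {w : Diagram k} {x y : Fin k} (hy : y ∈ propMaxima w)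
    (hxy : w (Sum.inl x) (Sum.inl y)) :
    blockIndex w x = ((propMaxima w).filter (· < y)).card := by
  classical
  rw [blockIndex]
  congr 1
  ext z
  simp only [Finset.mem_filter, Finset.mem_univ, true_and, mem_propMaxima]
  refine and_congr_right fun _ => ⟨?_, fun h => ⟨y, hxy, h⟩⟩
  rintro ⟨a, ha, hza⟩
  exact hza.trans_le ((mem_propMaxima.1 hy).2 _ (w.trans' (w.symm' hxy) ha))

theorem blockIndex_lt {w : Diagram k} {x : Fin k} (hx : Propagates w x) :
    blockIndex w x < rank w := by
  obtain ⟨y, hy, hxy⟩ := exists_propMaxima hx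
  rw [blockIndex_eq hy hxy, ← card_propMaxima]
  refine Finset.card_lt_card ⟨Finset.filter_subset _ _, fun hs => ?_⟩
  exact absurd (Finset.mem_filter.1 (hs hy)).2 (lt_irrefl _)

theorem exists_blockIndex {w : Diagram k} {i : ℕ} (hi : i < rank w) :
    ∃ x, Propagates w x ∧ blockIndex w x = i := by
  rw [← card_propMaxima] at hi
  obtain ⟨y, hy, rfl⟩ := exists_card_filter_lt hi
  exact ⟨y, (mem_propMaxima.1 hy).1, blockIndex_eq hy (w.refl' _)⟩

theorem blockIndex_lt_blockIndex {w : Diagram k} {x y x' y' : Fin k} (hx : x' ∈ propMaxima w)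
    (hy : y' ∈ propMaxima w) (hxx : w (Sum.inl x) (Sum.inl x'))
    (hyy : w (Sum.inl y) (Sum.inl y')) : blockIndex w x < blockIndex w y ↔ x' < y' := by
  rw [blockIndex_eq hx hxx, blockIndex_eq hy hyy, card_filter_lt_lt hx]

theorem blockIndex_congr {w : Diagram k} {x y : Fin k} (h : w (Sum.inl x) (Sum.inl y)) :
    blockIndex w x = blockIndex w y := by
  classical
  rw [blockIndex, blockIndex]
  congr 1
  ext z
  simp only [Finset.mem_filter, Finset.mem_univ, true_and]
  exact and_congr_right fun _ => exists_congr fun a => and_congr_left fun _ =>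
    ⟨fun ha => w.trans' (w.symm' h) ha, fun ha => w.trans' h ha⟩

theorem blockIndex_inj {w : Diagram k} {x y : Fin k} (hx : Propagates w x) (hy : Propagates w y) :
    blockIndex w x = blockIndex w y ↔ w (Sum.inl x) (Sum.inl y) := by
  refine ⟨fun h => ?_, blockIndex_congr⟩
  obtain ⟨x', hx', hxx⟩ := exists_propMaxima hx
  obtain ⟨y', hy', hyy⟩ := exists_propMaxima hy
  have h1 := blockIndex_lt_blockIndex hx' hy' hxx hyy
  have h2 := blockIndex_lt_blockIndex hy' hx' hyy hxx
  have : x' = y' := le_antisymm (not_lt.1 fun hc => by have := h2.2 hc; omega)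
    (not_lt.1 fun hc => by have := h1.2 hc; omega)
  subst this
  exact w.trans' hxx (w.symm' hyy)

end BlockIndex

/-! ### The half diagram of a symmetric diagram, with its propagating blocks labelled -/

section Half

variable {k m : ℕ}

open Classical in
/-- The label of a top vertex: the index of its block if this is propagating. -/
noncomputable def halfLabel (w : Diagram k) (x : Fin k) : ℕ ⊕ Quotient w :=
  if Propagates w x then Sum.inl (blockIndex w x) else Sum.inr (Quotient.mk w (Sum.inl x))

/-- The half diagram of `w` in which the bottom vertex `i` lies in the `σ i`-th propagating
block of `w`. -/
noncomputable def half (w : Diagram k) (σ : Equiv.Perm (Fin m)) : BiDiagram (Fin k) (Fin m) :=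
  Setoid.ker (Sum.elim (halfLabel w) fun i => Sum.inl (σ i : ℕ))

theorem half_inl_inl {w : Diagram k} {σ : Equiv.Perm (Fin m)} {x y : Fin k} :
    half w σ (Sum.inl x) (Sum.inl y) ↔ w (Sum.inl x) (Sum.inl y) := by
  change halfLabel w x = halfLabel w y ↔ _
  by_cases hx : Propagates w x <;> by_cases hy : Propagates w y
  · simp [halfLabel, hx, hy, blockIndex_inj]
  · simp only [halfLabel, hx, hy, if_true, if_false, reduceCtorEq, false_iff]
    exact fun h => hy (hx.congr h)
  · simp only [halfLabel, hx, hy, if_true, if_false, reduceCtorEq, false_iff]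
    exact fun h => hx (hy.congr (w.symm' h))
  · simp only [halfLabel, hx, hy, if_false, Sum.inr.injEq]
    exact Quotient.eq

theorem half_inl_inr {w : Diagram k} {σ : Equiv.Perm (Fin m)} {x : Fin k} {i : Fin m} :
    half w σ (Sum.inl x) (Sum.inr i) ↔ Propagates w x ∧ blockIndex w x = σ i := by
  change halfLabel w x = Sum.inl (σ i : ℕ) ↔ _
  by_cases hx : Propagates w x <;> simp [halfLabel, hx]

theorem half_inr_inr {w : Diagram k} {σ : Equiv.Perm (Fin m)} {i j : Fin m} :
    half w σ (Sum.inr i) (Sum.inr j) ↔ i = j := by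
  change (Sum.inl (σ i : ℕ) : ℕ ⊕ Quotient w) = Sum.inl (σ j : ℕ) ↔ _
  rw [Sum.inl.injEq, Fin.val_inj, σ.injective.eq_iff]

theorem isFull_half {w : Diagram k} (hw : rank w = m) (σ : Equiv.Perm (Fin m)) :
    IsFull (half w σ) := by
  refine ⟨fun i => ?_, fun i j => half_inr_inr.1⟩
  obtain ⟨x, hx, hi⟩ := exists_blockIndex (w := w) (i := σ i) (by rw [hw]; exact (σ i).2)
  exact ⟨x, half_inl_inr.2 ⟨hx, hi⟩⟩

/-- The numbering `σ` disappears when the half is reflected, because symmetry of `w` joins every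
propagating block to its own mirror image. -/
theorem comp_half_transpose {w : Diagram k} (hw : IsSymmetricDiagram m w)
    (σ : Equiv.Perm (Fin m)) : comp (half w σ) (transpose (half w σ)) = w := by
  obtain ⟨hsym, hrank, hmirror⟩ := hw
  have hswap : ∀ u v, w u v ↔ w u.swap v.swap := fun u v => by
    conv_lhs => rw [hsym]
    exact transpose_apply
  have hp : ∀ x, (∃ i, half w σ (Sum.inl x) (Sum.inr i)) ↔ Propagates w x := by
    intro x
    constructor
    · rintro ⟨i, hi⟩
      exact (half_inl_inr.1 hi).1
    · intro hx
      refine ⟨σ.symm ⟨blockIndex w x, by rw [← hrank]; exact blockIndex_lt hx⟩, ?_⟩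
      rw [half_inl_inr]
      simp [hx]
  have hcross : ∀ x y, w (Sum.inl x) (Sum.inr y) ↔ w (Sum.inl x) (Sum.inl y) ∧ Propagates w x := by
    intro x y
    constructor
    · intro h
      have hx : Propagates w x := ⟨y, h⟩
      exact ⟨w.trans' (hmirror x hx) ((hswap _ _).1 h), hx⟩
    · rintro ⟨h, hx⟩
      exact w.trans' (hmirror x hx) ((hswap _ _).1 h)
  ext u v
  rw [comp_transpose_apply, hp, half_inl_inl]
  rcases u with u | u <;> rcases v with v | v
  · simp
  · simp [hcross]
  · rw [hswap (Sum.inr u)]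
    simp [hcross]
  · rw [hswap (Sum.inr u)]
    simp

/-- The labels of `g` meet each propagating block of its symmetric diagram once; reading off the
index of the block of each label gives `σ`. So full diagrams are the same as pairs of a symmetric
diagram and a permutation. -/
theorem exists_half {g : BiDiagram (Fin k) (Fin m)} (hg : IsFull g) :
    ∃ σ : Equiv.Perm (Fin m), g = half (comp g (transpose g)) σ := by
  set W : Diagram k := comp g (transpose g) with hW
  have hrank : rank W = m := by simpa using (rank_comp_transpose g).2.2 hg
  choose x hx using hg.1
  have hprop : ∀ i, Propagates W (x i) := fun i => propagates_comp_transpose.2 ⟨i, hx i⟩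
  have htop : ∀ a b, g (Sum.inl a) (Sum.inl b) ↔ W (Sum.inl a) (Sum.inl b) := fun a b => by
    rw [hW, comp_transpose_apply]
    simp
  let f : Fin m → Fin m := fun i => ⟨blockIndex W (x i), by rw [← hrank]; exact blockIndex_lt (hprop i)⟩
  have hf : Function.Injective f := by
    intro i j hij
    have := (blockIndex_inj (hprop i) (hprop j)).1 (congrArg Fin.val hij)
    exact hg.2 _ _ (g.trans' (g.symm' (hx i)) (g.trans' ((htop _ _).2 this) (hx j)))
  let σ := Equiv.ofBijective f (Finite.injective_iff_bijective.1 hf)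
  refine ⟨σ, hg.ext (isFull_half hrank σ) (fun a b => ?_) fun i => ⟨x i, hx i, ?_⟩⟩
  · rw [htop, half_inl_inl]
  · exact half_inl_inr.2 ⟨hprop i, rfl⟩

theorem half_injective {w : Diagram k} (hw : rank w = m) {σ τ : Equiv.Perm (Fin m)}
    (h : half w σ = half w τ) : σ = τ := by
  ext i
  obtain ⟨x, hx⟩ := (isFull_half hw σ).1 i
  have hx' := hx
  rw [h] at hx'
  rw [← (half_inl_inr.1 hx).2, (half_inl_inr.1 hx').2]

theorem conj_eq {d w : Diagram k} (hw : IsSymmetricDiagram m w) (τ : Equiv.Perm (Fin m)) :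
    conj d w = comp (comp d (half w τ)) (transpose (comp d (half w τ))) := by
  rw [← comp_comp_transpose, comp_half_transpose hw, conj]

theorem isFull_comp_half {d w : Diagram k} (hw : IsSymmetricDiagram m w)
    (τ : Equiv.Perm (Fin m)) : IsFull (comp d (half w τ)) ↔ rank (conj d w) = m := by
  rw [conj_eq hw τ, ← (rank_comp_transpose _).2, Fintype.card_fin]

theorem isSymmetricDiagram_conj {d w : Diagram k} (hw : IsSymmetricDiagram m w)
    (h : rank (conj d w) = m) : IsSymmetricDiagram m (conj d w) := by
  have := ((isFull_comp_half hw 1).2 h).isSymmetricDiagram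
  rwa [Fintype.card_fin, ← conj_eq hw] at this

theorem removed_half {d w : Diagram k} (hw : IsSymmetricDiagram m w) (h : rank (conj d w) = m)
    (τ : Equiv.Perm (Fin m)) : removed d (half w τ) = removed d w := by
  rw [← removed_comp_transpose (isFull_half hw.2.1 τ) ((isFull_comp_half hw τ).2 h)
    (transpose (half w τ)), comp_half_transpose hw]

/-- The twist exists, and it describes the composition with labelled half diagrams. -/
theorem exists_twist {d w : Diagram k} (hw : IsSymmetricDiagram m w) (h : rank (conj d w) = m) :
    ∃ σ : Equiv.Perm (Fin m), IsTwist d w σ ∧ ∀ τ, comp d (half w τ) = half (conj d w) (σ * τ) := by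
  have key : ∀ τ : Equiv.Perm (Fin m), ∃ σ : Equiv.Perm (Fin m),
      comp d (half w τ) = half (conj d w) σ ∧ ∀ (i : Fin m) (x y : Fin k), Propagates w x →
        blockIndex w x = τ i → stack d w (Sum.inl y) (Sum.inr (Sum.inl x)) →
          blockIndex (conj d w) y = σ i := by
    intro τ
    obtain ⟨σ, hσ⟩ := exists_half ((isFull_comp_half hw τ).2 h)
    rw [← conj_eq hw] at hσ
    refine ⟨σ, hσ, fun i x y hx hi hxy => ?_⟩
    have h1 : stack d (half w τ) (Sum.inl y) (Sum.inr (Sum.inl x)) :=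
      (stack_upper_congr (e := w) (e' := half w τ) (fun b b' => half_inl_inl.symm) (Sum.inl y)
        (Sum.inr x)).1 hxy
    have h2 : half w τ (Sum.inl x) (Sum.inr i) := half_inl_inr.2 ⟨hx, hi⟩
    have h3 : comp d (half w τ) (Sum.inl y) (Sum.inr i) :=
      (stack d (half w τ)).trans' h1 (stack_lower h2)
    rw [hσ] at h3
    exact (half_inl_inr.1 h3).2
  obtain ⟨σ, hσ, ht⟩ := key 1
  refine ⟨σ, fun i => ht i, fun τ => ?_⟩
  obtain ⟨σ', hσ', ht'⟩ := key τ
  rw [hσ']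
  congr 1
  ext i
  -- The label `i` of `half w τ` sits on the same block as the label `τ i` of `half w 1`. Following
  -- this block up through `d` computes both permutations at once.
  obtain ⟨x, hx, hi⟩ := exists_blockIndex (w := w) (i := τ i) (by rw [hw.2.1]; exact (τ i).2)
  have hfull := (isFull_comp_half hw τ).2 h
  obtain ⟨y, hy⟩ := hfull.1 i
  have h1 : stack d (half w τ) (Sum.inl y) (Sum.inr (Sum.inl x)) :=
    (stack d (half w τ)).trans' hy ((stack d (half w τ)).symm'
      (stack_lower (half_inl_inr.2 ⟨hx, hi⟩)))
  have h2 : stack d w (Sum.inl y) (Sum.inr (Sum.inl x)) :=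
    (stack_upper_congr (e := w) (e' := half w τ) (fun b b' => half_inl_inl.symm) (Sum.inl y)
      (Sum.inr x)).2 h1
  rw [← ht' i x y hx hi h2, ht (τ i) x y hx hi h2]
  rfl

end Half

/-! ### Tensor space and the vectors of labelled half diagrams -/

section TensorSpace

variable {k m n : ℕ}

/-- The action of the partition algebra on the functions on colourings by `n` colours, that is, on
the `k`-th tensor power of the permutation module `ℂⁿ`. -/
noncomputable def colourRep (k n : ℕ) :
    PartitionAlgebra k (n : ℂ) →ₐ[ℂ] Module.End ℂ ((Fin k → Fin n) → ℂ) :=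
  AlgHom.ofLinearMap
    (PartitionAlgebra.lift fun d => Matrix.mulVecLin (diagramMatrix (Fin n) d))
    (by
      rw [PartitionAlgebra.one_def, PartitionAlgebra.lift_ofDiagram, diagramMatrix_id,
        Matrix.mulVecLin_one]
      rfl)
    (by
      intro a b
      let F : PartitionAlgebra k (n : ℂ) →ₗ[ℂ] Module.End ℂ ((Fin k → Fin n) → ℂ) :=
        PartitionAlgebra.lift fun d => Matrix.mulVecLin (diagramMatrix (Fin n) d)
      have h : (PartitionAlgebra.mulLin (n := (n : ℂ)) (k := k)).compr₂ F =
          (LinearMap.mul ℂ (Module.End ℂ ((Fin k → Fin n) → ℂ))).compl₁₂ F F := by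
        refine PartitionAlgebra.lin_ext fun d => PartitionAlgebra.lin_ext fun e => ?_
        change F (PartitionAlgebra.ofDiagram _ d * PartitionAlgebra.ofDiagram _ e) =
          F (PartitionAlgebra.ofDiagram _ d) * F (PartitionAlgebra.ofDiagram _ e)
        simp only [F, PartitionAlgebra.ofDiagram_mul, map_smul, PartitionAlgebra.lift_ofDiagram]
        change _ = Matrix.mulVecLin _ ∘ₗ Matrix.mulVecLin _
        rw [← Matrix.mulVecLin_mul, diagramMatrix_mul, Fintype.card_fin]
        ext : 1
        simp
      exact congrArg (fun G => G a b) h)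

theorem colourRep_ofDiagram (d : Diagram k) (y : (Fin k → Fin n) → ℂ) :
    colourRep k n (PartitionAlgebra.ofDiagram _ d) y = (diagramMatrix (Fin n) d).mulVec y := by
  change (PartitionAlgebra.lift (n := (n : ℂ)) fun d => Matrix.mulVecLin (diagramMatrix (Fin n) d))
    (PartitionAlgebra.ofDiagram _ d) y = _
  rw [PartitionAlgebra.lift_ofDiagram]
  rfl

/-- The coefficients of `e_{2i} - e_{2i+1}`. -/
def altCoeff (i : ℕ) (a : ℕ) : ℂ := if a = 2 * i then 1 else if a = 2 * i + 1 then -1 else 0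

/-- The tensor `(e_0 - e_1) ⊗ (e_2 - e_3) ⊗ ⋯` with `m` factors. -/
noncomputable def altTensor (m n : ℕ) : (Fin m → Fin n) → ℂ := fun c => ∏ i : Fin m, altCoeff i (c i)

theorem altCoeff_ne_zero {i a : ℕ} (h : altCoeff i a ≠ 0) : a = 2 * i ∨ a = 2 * i + 1 := by
  unfold altCoeff at h
  split_ifs at h with h1 h2
  · exact Or.inl h1
  · exact Or.inr h2
  · exact absurd rfl h

theorem altTensor_ne_zero {c : Fin m → Fin n} (h : altTensor m n c ≠ 0) (i : Fin m) :
    (c i : ℕ) = 2 * i ∨ (c i : ℕ) = 2 * i + 1 :=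
  altCoeff_ne_zero (Finset.prod_ne_zero_iff.1 h i (Finset.mem_univ i))

/-- The vector `h · altTensor` of a half diagram `h`. -/
noncomputable def halfVec (n : ℕ) {α : Type} (h : BiDiagram α (Fin m)) : (α → Fin n) → ℂ :=
  (diagramMatrix (Fin n) h).mulVec (altTensor m n)

theorem halfVec_apply {α : Type} (h : BiDiagram α (Fin m)) (f : α → Fin n) :
    halfVec n h f = ∑ c, diagramMatrix (Fin n) h f c * altTensor m n c := rfl

theorem exists_of_halfVec_ne_zero {α : Type} {h : BiDiagram α (Fin m)} {f : α → Fin n}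
    (hf : halfVec n h f ≠ 0) : ∃ c, Compatible h (Sum.elim f c) ∧ altTensor m n c ≠ 0 := by
  rw [halfVec_apply] at hf
  obtain ⟨c, -, hc⟩ := Finset.exists_ne_zero_of_sum_ne_zero hf
  refine ⟨c, ?_, right_ne_zero_of_mul hc⟩
  by_contra hcc
  exact left_ne_zero_of_mul hc (if_neg hcc)

/-- Fullness fails in two ways. If the label `i` is isolated, exchanging the colours `2i` and `2i+1`
at `i` preserves compatibility and negates the tensor, so the sum is its own negative. If two labels
share a block, they must have the same colour, but their factors have disjoint supports. -/
theorem halfVec_eq_zero (hmn : 2 * m ≤ n) {α : Type} {h : BiDiagram α (Fin m)} (hh : ¬ IsFull h) :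
    halfVec n h = 0 := by
  classical
  by_cases h2 : ∀ i j, h (Sum.inr i) (Sum.inr j) → i = j
  · have h1 : ∃ i, ∀ x, ¬ h (Sum.inl x) (Sum.inr i) := by
      by_contra hc
      push Not at hc
      exact hh ⟨hc, h2⟩
    obtain ⟨i, hi⟩ := h1
    funext f
    rw [halfVec_apply]
    have hiso : ∀ z, h z (Sum.inr i) → z = Sum.inr i := by
      rintro (x | j) hz
      · exact absurd hz (hi x)
      · rw [h2 _ _ hz]
    let a : Fin n := ⟨2 * i, by omega⟩
    let b : Fin n := ⟨2 * i + 1, by omega⟩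
    let e : (Fin m → Fin n) → (Fin m → Fin n) := fun c => Function.update c i (Equiv.swap a b (c i))
    have he : Function.Involutive e := by
      intro c
      simp [e]
    have hcomp : ∀ c, Compatible h (Sum.elim f c) → Compatible h (Sum.elim f (e c)) := by
      intro c hc x y hxy
      by_cases hx : x = Sum.inr i
      · subst hx
        rw [hiso y (h.symm' hxy)]
      · have hy : y ≠ Sum.inr i := fun hy => hx (hiso x (hy ▸ hxy))
        have key : ∀ z, z ≠ Sum.inr i → Sum.elim f (e c) z = Sum.elim f c z := by
          rintro (z | z) hz
          · rfl
          · simp only [Sum.elim_inr, e]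
            rw [Function.update_of_ne fun hzi => hz (by rw [hzi])]
        rw [key x hx, key y hy]
        exact hc x y hxy
    have hmat : ∀ c, diagramMatrix (Fin n) h f (e c) = diagramMatrix (Fin n) h f c := by
      intro c
      have : Compatible h (Sum.elim f (e c)) ↔ Compatible h (Sum.elim f c) :=
        ⟨fun hc => by simpa [he c] using hcomp _ hc, hcomp c⟩
      simp only [diagramMatrix, this]
    have halt : ∀ c, altTensor m n (e c) = - altTensor m n c := by
      intro c
      unfold altTensor
      rw [← Finset.mul_prod_erase _ _ (Finset.mem_univ i),
        ← Finset.mul_prod_erase _ (fun j : Fin m => altCoeff j (c j)) (Finset.mem_univ i),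
        ← neg_mul]
      congr 1
      · simp only [e, Function.update_self]
        by_cases hca : c i = a
        · rw [hca, Equiv.swap_apply_left]
          simp [altCoeff, a, b]
        · by_cases hcb : c i = b
          · rw [hcb, Equiv.swap_apply_right]
            simp [altCoeff, a, b]
          · rw [Equiv.swap_apply_of_ne_of_ne hca hcb]
            have ha' : (c i : ℕ) ≠ 2 * i := fun hh => hca (Fin.ext hh)
            have hb' : (c i : ℕ) ≠ 2 * i + 1 := fun hh => hcb (Fin.ext hh)
            simp [altCoeff, ha', hb']
      · refine Finset.prod_congr rfl fun j hj => ?_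
        simp only [e]
        rw [Function.update_of_ne (Finset.ne_of_mem_erase hj)]
    have hsum : ∑ c, diagramMatrix (Fin n) h f c * altTensor m n c =
        - ∑ c, diagramMatrix (Fin n) h f c * altTensor m n c := by
      rw [← Finset.sum_neg_distrib, ← Equiv.sum_comp he.toPerm]
      refine Finset.sum_congr rfl fun c _ => ?_
      change diagramMatrix (Fin n) h f (e c) * altTensor m n (e c) = _
      rw [hmat, halt, mul_neg]
    exact self_eq_neg.1 hsum
  · push Not at h2
    obtain ⟨i, j, hij, hne⟩ := h2
    funext f
    by_contra hc
    obtain ⟨c, hc1, hc2⟩ := exists_of_halfVec_ne_zero hc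
    have := congrArg Fin.val (hc1 _ _ hij)
    simp only [Sum.elim_inr] at this
    have h3 := altTensor_ne_zero hc2 i
    have h4 := altTensor_ne_zero hc2 j
    exact hne (Fin.ext (by omega))

/-- A colouring of the top row that separates the blocks of a full diagram; it uses the colour `2i`
for the block labelled by `i`, and it does not use the colours `2i+1` for `i < m`. -/
theorem exists_colouring (hkn : 2 * k ≤ n) {h : BiDiagram (Fin k) (Fin m)} (hh : IsFull h) :
    ∃ f : Fin k → Fin n, (∀ x (i : Fin m), (f x : ℕ) ≠ 2 * i + 1) ∧
      ∀ x y, h x y ↔ Sum.elim (fun x => (f x : ℕ)) (fun i : Fin m => 2 * (i : ℕ)) x =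
        Sum.elim (fun x => (f x : ℕ)) (fun i : Fin m => 2 * (i : ℕ)) y := by
  classical
  let U := {q : Quotient h // (∃ x, Quotient.mk h (Sum.inl x) = q) ∧
    ∀ i : Fin m, Quotient.mk h (Sum.inr i) ≠ q}
  choose r hr using hh.1
  have hinj : Function.Injective (Sum.elim r fun q : U => q.2.1.choose) := by
    have hmix : ∀ (i : Fin m) (q : U), r i ≠ q.2.1.choose := by
      intro i q hiq
      have h1 := q.2.1.choose_spec
      rw [← hiq] at h1
      exact q.2.2 i ((Quotient.sound (h.symm' (hr i))).trans h1)
    rintro (i | q) (j | q') hij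
    · exact congrArg Sum.inl (hh.2 _ _ (h.trans' (h.symm' (hr i))
        (by simp only [Sum.elim_inl] at hij; rw [hij]; exact hr j)))
    · exact absurd hij (hmix i q')
    · exact absurd hij.symm (hmix j q)
    · refine congrArg Sum.inr (Subtype.ext ?_)
      have h1 := q.2.1.choose_spec
      have h2 := q'.2.1.choose_spec
      simp only [Sum.elim_inr] at hij
      rw [← h1, ← h2, hij]
  have hcard := Nat.card_le_card_of_injective _ hinj
  have : Finite U := Finite.of_injective (fun q : U => q.2.1.choose)
    fun q q' hq => Sum.inr_injective (hinj hq)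
  have := Fintype.ofFinite U
  rw [Nat.card_sum, Nat.card_eq_fintype_card, Nat.card_eq_fintype_card, Nat.card_eq_fintype_card,
    Fintype.card_fin, Fintype.card_fin] at hcard
  -- The labelled blocks and the `U` unlabelled ones have distinct representatives in the top row,
  -- so `m + |U| ≤ k`. With `2k ≤ n` there is room for the unlabelled blocks among the colours from
  -- `2m` on.
  obtain ⟨e⟩ : Nonempty (U ↪ Fin (n - 2 * m)) :=
    Function.Embedding.nonempty_of_card_le (by rw [Fintype.card_fin]; omega)
  have hU : ∀ x, (¬ ∃ i, h (Sum.inl x) (Sum.inr i)) → (∃ y, Quotient.mk h (Sum.inl y) =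
      Quotient.mk h (Sum.inl x)) ∧ ∀ i : Fin m, Quotient.mk h (Sum.inr i) ≠
        Quotient.mk h (Sum.inl x) :=
    fun x hx => ⟨⟨x, rfl⟩, fun i hi => hx ⟨i, h.symm' (Quotient.exact hi)⟩⟩
  let f : Fin k → Fin n := fun x =>
    if hx : ∃ i, h (Sum.inl x) (Sum.inr i) then ⟨2 * hx.choose, by have := hx.choose.2; omega⟩
    else ⟨2 * m + e ⟨_, hU x hx⟩, by have := (e ⟨_, hU x hx⟩).2; omega⟩
  have hf1 : ∀ x i, h (Sum.inl x) (Sum.inr i) → (f x : ℕ) = 2 * i := by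
    intro x i hxi
    have hx : ∃ i, h (Sum.inl x) (Sum.inr i) := ⟨i, hxi⟩
    simp only [f, dif_pos hx]
    rw [hh.2 _ _ (h.trans' (h.symm' hx.choose_spec) hxi)]
  have hf2 : ∀ x (hx : ¬ ∃ i, h (Sum.inl x) (Sum.inr i)), (f x : ℕ) = 2 * m + e ⟨_, hU x hx⟩ := by
    intro x hx
    simp only [f, dif_neg hx]
  refine ⟨f, fun x i => ?_, ?_⟩
  · by_cases hx : ∃ i, h (Sum.inl x) (Sum.inr i)
    · obtain ⟨j, hj⟩ := hx
      rw [hf1 x j hj]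
      omega
    · rw [hf2 x hx]
      omega
  · have hlab : ∀ x i, h (Sum.inl x) (Sum.inr i) ↔ (f x : ℕ) = 2 * i := by
      refine fun x i => ⟨hf1 x i, fun hxi => ?_⟩
      by_cases hx : ∃ i, h (Sum.inl x) (Sum.inr i)
      · obtain ⟨j, hj⟩ := hx
        rw [hf1 x j hj] at hxi
        have : i = j := Fin.ext (by omega)
        rwa [this]
      · rw [hf2 x hx] at hxi
        omega
    rintro (x | i) (y | j)
    · simp only [Sum.elim_inl]
      by_cases hx : ∃ i, h (Sum.inl x) (Sum.inr i)
      · obtain ⟨i, hi⟩ := hx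
        rw [hf1 x i hi, eq_comm, ← hlab]
        exact ⟨fun hxy => h.trans' (h.symm' hxy) hi, fun hy => h.trans' hi (h.symm' hy)⟩
      · by_cases hy : ∃ i, h (Sum.inl y) (Sum.inr i)
        · obtain ⟨i, hi⟩ := hy
          rw [hf1 y i hi, ← hlab]
          exact ⟨fun hxy => h.trans' hxy hi, fun hx => h.trans' hx (h.symm' hi)⟩
        · rw [hf2 x hx, hf2 y hy, Nat.add_left_cancel_iff, Fin.val_inj, e.injective.eq_iff,
            Subtype.mk.injEq]
          exact Quotient.eq.symm
    · exact hlab x j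
    · simp only [Sum.elim_inl, Sum.elim_inr]
      rw [eq_comm, ← hlab]
      exact ⟨h.symm', h.symm'⟩
    · simp only [Sum.elim_inr]
      refine ⟨fun hij => by rw [hh.2 _ _ hij], fun hij => ?_⟩
      have : i = j := Fin.ext (by omega)
      rw [this]

/-- The matrix of values of these vectors at the separating colourings is triangular for refinement:
the vector of `h` can be nonzero at the colouring of `h'` only if `h ≤ h'`, and it is nonzero at its
own. -/
theorem linearIndependent_halfVec (hkn : 2 * k ≤ n) :
    LinearIndependent ℂ fun h : {h : BiDiagram (Fin k) (Fin m) // IsFull h} => halfVec n h.1 := by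
  classical
  choose f hf1 hf2 using fun h : {h : BiDiagram (Fin k) (Fin m) // IsFull h} =>
    exists_colouring hkn h.2
  -- Every label is connected to the top row, where the colours `2i+1` are avoided. Of the two
  -- colours in the support of the tensor only `2i` remains.
  have hc : ∀ (h h' : {h : BiDiagram (Fin k) (Fin m) // IsFull h}) (c : Fin m → Fin n),
      Compatible h.1 (Sum.elim (f h') c) → altTensor m n c ≠ 0 → ∀ i, (c i : ℕ) = 2 * i := by
    intro h h' c hc hne i
    obtain ⟨x, hx⟩ := h.2.1 i
    have h1 : f h' x = c i := hc _ _ hx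
    have h2 := hf1 h' x i
    rw [h1] at h2
    exact (altTensor_ne_zero hne i).resolve_right h2
  have hle : ∀ h h', halfVec n h.1 (f h') ≠ 0 → h ≤ h' := by
    intro h h' hne
    obtain ⟨c, hc1, hc2⟩ := exists_of_halfVec_ne_zero hne
    have hci := hc h h' c hc1 hc2
    intro x y hxy
    rw [hf2 h']
    have := congrArg Fin.val (hc1 _ _ hxy)
    rcases x with x | x <;> rcases y with y | y <;> simpa [hci] using this
  have hone : ∀ h, halfVec n h.1 (f h) ≠ 0 := by
    intro h
    have hm : ∀ i : Fin m, 2 * (i : ℕ) < n := by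
      intro i
      obtain ⟨x, hx⟩ := h.2.1 i
      have := (hf2 h _ _).1 hx
      simp only [Sum.elim_inl, Sum.elim_inr] at this
      rw [← this]
      exact (f h x).2
    let c : Fin m → Fin n := fun i => ⟨2 * i, hm i⟩
    have hcc : Compatible h.1 (Sum.elim (f h) c) := by
      intro x y hxy
      have := (hf2 h _ _).1 hxy
      apply Fin.ext
      rcases x with x | x <;> rcases y with y | y <;> exact this
    rw [halfVec_apply, Finset.sum_eq_single c]
    · simp [diagramMatrix, hcc, altTensor, altCoeff, c]
    · intro c' _ hne
      by_contra h0
      have h1 : Compatible h.1 (Sum.elim (f h) c') := by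
        by_contra hcc'
        exact left_ne_zero_of_mul h0 (if_neg hcc')
      refine hne (funext fun i => Fin.ext ?_)
      exact hc h h c' h1 (right_ne_zero_of_mul h0) i
    · exact fun h => absurd (Finset.mem_univ _) h
  rw [linearIndependent_iff']
  intro s g hg h hs
  by_contra hgh
  -- Evaluating the relation at the colouring of a finest `h'` in its support leaves a single term.
  obtain ⟨h', -, hmin⟩ := (s.filter fun h => g h ≠ 0).exists_le_minimal
    (Finset.mem_filter.2 ⟨hs, hgh⟩)
  have hmem := Finset.mem_filter.1 hmin.1
  have := congrFun hg (f h')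
  rw [Finset.sum_apply, Finset.sum_eq_single_of_mem h' hmem.1] at this
  · exact (mul_ne_zero hmem.2 (hone h')) this
  · intro h'' hs'' hne
    by_contra hc
    have hc' : g h'' * halfVec n h''.1 (f h') ≠ 0 := hc
    have hle' := hle _ _ (right_ne_zero_of_mul hc')
    exact hne (le_antisymm hle' (hmin.2 (Finset.mem_filter.2 ⟨hs'', left_ne_zero_of_mul hc'⟩) hle'))

instance {α β : Type} [Finite α] [Finite β] : Finite (BiDiagram α β) :=
  Finite.of_injective (fun r : Setoid (α ⊕ β) => ⇑r)
    fun _ _ h => Setoid.ext fun a b => iff_of_eq (congrFun (congrFun h a) b)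

/-- The vector in tensor space of the element `w ⊗ v`. -/
noncomputable def symVec (n : ℕ) (w : Diagram k) :
    SymGroupAlgebra m →ₗ[ℂ] ((Fin k → Fin n) → ℂ) where
  toFun v := ∑ τ, v.coeff τ • halfVec n (half w τ)
  map_add' v v' := by simp [add_smul, Finset.sum_add_distrib]
  map_smul' c v := by simp [Finset.smul_sum, mul_smul]

theorem symVec_apply (w : Diagram k) (v : SymGroupAlgebra m) :
    symVec n w v = ∑ τ, v.coeff τ • halfVec n (half w τ) := rfl

/-- Different pairs of a symmetric diagram and a numbering have different half diagrams, so all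
coefficients of all the `v i` can be read off from the independent vectors. -/
theorem symVec_eq_zero (hkn : 2 * k ≤ n) {ι : Type} [Fintype ι] {w : ι → Diagram k}
    (hw : Function.Injective w) (hsym : ∀ i, IsSymmetricDiagram m (w i))
    {v : ι → SymGroupAlgebra m} (h : ∑ i, symVec n (w i) (v i) = 0) (i : ι) : v i = 0 := by
  classical
  let H : ι × Equiv.Perm (Fin m) → {h : BiDiagram (Fin k) (Fin m) // IsFull h} :=
    fun p => ⟨half (w p.1) p.2, isFull_half (hsym p.1).2.1 p.2⟩
  have hH : Function.Injective H := by
    rintro ⟨i, σ⟩ ⟨j, τ⟩ hij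
    have h1 : half (w i) σ = half (w j) τ := congrArg Subtype.val hij
    have h2 : i = j := hw (by
      rw [← comp_half_transpose (hsym i) σ, ← comp_half_transpose (hsym j) τ, h1])
    subst h2
    rw [half_injective (hsym i).2.1 h1]
  have hli := (linearIndependent_halfVec (m := m) hkn).comp H hH
  rw [Fintype.linearIndependent_iff] at hli
  have := hli (fun p => (v p.1).coeff p.2) (by
    rw [Fintype.sum_prod_type]
    exact h)
  ext τ
  exact this (i, τ)

theorem diagramMatrix_mulVec_halfVec {α β : Type} [Fintype α] [Fintype β] [DecidableEq β]
    (d : BiDiagram α β)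
    (h : BiDiagram β (Fin m)) : (diagramMatrix (Fin n) d).mulVec (halfVec n h) =
      (n : ℂ) ^ removed d h • halfVec n (comp d h) := by
  rw [halfVec, Matrix.mulVec_mulVec, diagramMatrix_mul, Matrix.smul_mulVec, Fintype.card_fin]
  rfl

/-- The power of `n` does not depend on the numbering `τ`, and replacing `τ` by `σ * τ` in the half
diagrams is left multiplication by `σ` in the group algebra. This is the twisted action in tensor
space. -/
theorem diagramMatrix_mulVec_symVec {d w : Diagram k} {σ : Equiv.Perm (Fin m)}
    (hw : IsSymmetricDiagram m w) (h : rank (conj d w) = m)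
    (hσ : ∀ τ, comp d (half w τ) = half (conj d w) (σ * τ)) (v : SymGroupAlgebra m) :
    (diagramMatrix (Fin n) d).mulVec (symVec n w v) =
      (n : ℂ) ^ removed d w • symVec n (conj d w) (ofPerm σ * v) := by
  rw [symVec_apply, symVec_apply, Matrix.mulVec_sum, Finset.smul_sum,
    ← Equiv.sum_comp (Equiv.mulLeft σ) fun τ => (n : ℂ) ^ removed d w •
      (ofPerm σ * v).coeff τ • halfVec n (half (conj d w) τ)]
  refine Finset.sum_congr rfl fun τ _ => ?_
  rw [Equiv.coe_mulLeft, Matrix.mulVec_smul, diagramMatrix_mulVec_halfVec, hσ, removed_half hw h]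
  simp [ofPerm, MonoidAlgebra.coeff_single_mul_apply, smul_smul, mul_comm]

theorem diagramMatrix_mulVec_symVec_eq_zero (hmn : 2 * m ≤ n) {d w : Diagram k}
    (hw : IsSymmetricDiagram m w) (h : rank (conj d w) ≠ m) (v : SymGroupAlgebra m) :
    (diagramMatrix (Fin n) d).mulVec (symVec n w v) = 0 := by
  rw [symVec_apply, Matrix.mulVec_sum]
  refine Finset.sum_eq_zero fun τ _ => ?_
  rw [Matrix.mulVec_smul, diagramMatrix_mulVec_halfVec,
    halfVec_eq_zero hmn (mt (isFull_comp_half hw τ).1 h), smul_zero, smul_zero]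

theorem star_halfVec {α : Type} (h : BiDiagram α (Fin m)) : star (halfVec n h) = halfVec n h := by
  funext f
  rw [Pi.star_apply, halfVec_apply, star_sum]
  refine Finset.sum_congr rfl fun c _ => ?_
  have h1 : star (diagramMatrix (Fin n) h f c) = diagramMatrix (Fin n) h f c := by
    unfold diagramMatrix
    split_ifs <;> simp
  have h2 : star (altTensor m n c) = altTensor m n c := by
    unfold altTensor
    rw [star_prod]
    refine Finset.prod_congr rfl fun i _ => ?_
    unfold altCoeff
    split_ifs <;> simp
  rw [star_mul', h1, h2]

open scoped ComplexOrder in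
/-- Positivity of the form on tensor space. -/
theorem eq_zero_of_transpose_mulVec {ι : Type} [Fintype ι] {w : ι → Diagram k}
    {v : ι → SymGroupAlgebra m} {y : (Fin k → Fin n) → ℂ} (hy : y = ∑ i, symVec n (w i) (v i))
    (h : ∀ i τ, (diagramMatrix (Fin n) (transpose (half (m := m) (w i) τ))).mulVec y = 0) :
    y = 0 := by
  rw [← dotProduct_star_self_eq_zero]
  -- Only one copy of `y` is expanded. Each term then pairs a half diagram applied to the
  -- alternating tensor with `y`, and the matrix moves to the other side as its transpose.
  nth_rewrite 1 [hy]
  rw [star_sum, sum_dotProduct]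
  refine Finset.sum_eq_zero fun i _ => ?_
  rw [symVec_apply, star_sum, sum_dotProduct]
  refine Finset.sum_eq_zero fun τ _ => ?_
  rw [star_smul, star_halfVec, smul_dotProduct, halfVec, dotProduct_comm,
    Matrix.dotProduct_mulVec, ← Matrix.mulVec_transpose, ← diagramMatrix_transpose, h, zero_dotProduct,
    smul_zero]

end TensorSpace

/-! ### Young symmetrizers in terms of permutations of the boxes -/

section FiberPerms

variable {X ι : Type}

theorem perm_apply_inv (p : Equiv.Perm X) (x : X) : p (p⁻¹ x) = x := p.apply_symm_apply x

/-- The permutations preserving the fibres of `f`. -/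
def fiberPerms (f : X → ι) : Subgroup (Equiv.Perm X) where
  carrier := {p | ∀ x, f (p x) = f x}
  mul_mem' {p q} hp hq x := (hp _).trans (hq x)
  one_mem' _ := rfl
  inv_mem' {p} hp x := by
    have := hp (p⁻¹ x)
    rw [perm_apply_inv] at this
    exact this.symm

theorem swap_mem_fiberPerms [DecidableEq X] {f : X → ι} {x y : X} (h : f x = f y) :
    Equiv.swap x y ∈ fiberPerms f := by
  intro z
  rcases eq_or_ne z x with rfl | hx
  · rw [Equiv.swap_apply_left, h]
  · rcases eq_or_ne z y with rfl | hy
    · rw [Equiv.swap_apply_right, h]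
    · rw [Equiv.swap_apply_of_ne_of_ne hx hy]

noncomputable instance [Finite X] (f : X → ι) : Fintype (fiberPerms f) := Fintype.ofFinite _

/-- A fibrewise permutation relating two fibrewise increasing functions is trivial. -/
theorem eq_one_of_increasing [Finite X] {f : X → ι} {key : X → ℕ}
    (hinj : ∀ x y, f x = f y → key x = key y → x = y) {p : Equiv.Perm X} (hp : p ∈ fiberPerms f)
    {β : Type} [LinearOrder β] {s : X → β} (hs : ∀ x y, f x = f y → key x < key y → s x < s y)
    (hsp : ∀ x y, f x = f y → key x < key y → s (p x) < s (p y)) : p = 1 := by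
  have hmono : ∀ x y, f x = f y → key x < key y → key (p x) < key (p y) := by
    intro x y hxy hk
    have hf : f (p x) = f (p y) := by rw [hp x, hp y, hxy]
    have h1 := hsp x y hxy hk
    by_contra hc
    rcases (not_lt.1 hc).lt_or_eq with h | h
    · exact absurd (hs _ _ hf.symm h) (not_lt.2 h1.le)
    · exact absurd h1 (by rw [hinj _ _ hf h.symm]; exact lt_irrefl _)
  -- If all smaller keys are fixed but `x` is not, then `p x` and `p⁻¹ x` both have larger keys than
  -- `x`. Applying the monotone `p` to `x` and `p⁻¹ x` gives the contradiction `key (p x) < key x`.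
  have key_fix : ∀ N x, key x = N → p x = x := by
    intro N
    induction N using Nat.strong_induction_on with
    | _ N ih =>
      intro x hx
      by_contra hne
      have h1 : key x < key (p x) := by
        by_contra hc
        rcases (not_lt.1 hc).lt_or_eq with h | h
        · exact hne (p.injective (ih _ (hx ▸ h) (p x) rfl))
        · exact hne (hinj _ _ (hp x) h)
      have hy : f (p⁻¹ x) = f x := (fiberPerms f).inv_mem hp x
      have h2 : key x < key (p⁻¹ x) := by
        by_contra hc
        have hfix : p⁻¹ x = x → False := fun h => hne (by rw [Equiv.Perm.inv_eq_iff_eq] at h; exact h.symm)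
        rcases (not_lt.1 hc).lt_or_eq with h | h
        · have := ih _ (hx ▸ h) (p⁻¹ x) rfl
          rw [perm_apply_inv] at this
          exact hfix this.symm
        · exact hfix (hinj _ _ hy h)
      have h3 := hmono _ _ hy.symm h2
      rw [perm_apply_inv] at h3
      omega
  ext x
  rw [key_fix _ x rfl]
  rfl

end FiberPerms

section Specht

variable {μ : YoungDiagram}

/-- The permutation of the boxes `a` as an element of the group algebra, through `t_c`. -/
noncomputable def ofCell (μ : YoungDiagram) : Equiv.Perm (Cell μ) →* SymGroupAlgebra μ.card :=
  (MonoidAlgebra.of ℂ _).comp (columnReading μ).permCongrHom.toMonoidHom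

theorem ofCell_apply (a : Equiv.Perm (Cell μ)) :
    ofCell μ a = ofPerm ((columnReading μ).permCongr a) := rfl

/-- The group of permutations of the boxes that preserve the columns. -/
abbrev colPerms (μ : YoungDiagram) : Subgroup (Equiv.Perm (Cell μ)) := fiberPerms fun c => c.1.2

/-- The group of permutations of the boxes that preserve the rows. -/
abbrev rowPerms (μ : YoungDiagram) : Subgroup (Equiv.Perm (Cell μ)) := fiberPerms fun c => c.1.1

/-- The sum of `sign(a) a` over a group of permutations of the boxes. -/
noncomputable def signedSum {ι : Type} (f : Cell μ → ι) : SymGroupAlgebra μ.card :=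
  ∑ a : fiberPerms f, ((Equiv.Perm.sign a.1 : ℤ) : ℂ) • ofCell μ a.1

/-- The sum of a group of permutations of the boxes. -/
noncomputable def plainSum {ι : Type} (f : Cell μ → ι) : SymGroupAlgebra μ.card :=
  ∑ a : fiberPerms f, ofCell μ a.1

theorem sign_mul_sign_cast (a : Equiv.Perm (Cell μ)) :
    ((Equiv.Perm.sign a : ℤ) : ℂ) * ((Equiv.Perm.sign a : ℤ) : ℂ) = 1 := by
  rcases Int.units_eq_one_or (Equiv.Perm.sign a) with h | h <;> simp [h]

theorem sign_mul_cast (a b : Equiv.Perm (Cell μ)) : ((Equiv.Perm.sign (a * b) : ℤ) : ℂ) =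
    ((Equiv.Perm.sign a : ℤ) : ℂ) * ((Equiv.Perm.sign b : ℤ) : ℂ) := by
  simp

theorem ofCell_mul_signedSum {ι : Type} {f : Cell μ → ι} {a : Equiv.Perm (Cell μ)}
    (ha : a ∈ fiberPerms f) :
    ofCell μ a * signedSum f = ((Equiv.Perm.sign a : ℤ) : ℂ) • signedSum f := by
  rw [signedSum, Finset.mul_sum, Finset.smul_sum,
    ← Equiv.sum_comp (Equiv.mulLeft (⟨a, ha⟩ : fiberPerms f)) fun b => ((Equiv.Perm.sign a : ℤ) : ℂ) •
      ((Equiv.Perm.sign b.1 : ℤ) : ℂ) • ofCell μ b.1]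
  refine Finset.sum_congr rfl fun b _ => ?_
  simp only [Equiv.coe_mulLeft, Subgroup.coe_mul, smul_smul, mul_smul_comm, map_mul (ofCell μ)]
  rw [sign_mul_cast, ← mul_assoc, sign_mul_sign_cast, one_mul]

theorem signedSum_mul_ofCell {ι : Type} {f : Cell μ → ι} {a : Equiv.Perm (Cell μ)}
    (ha : a ∈ fiberPerms f) :
    signedSum f * ofCell μ a = ((Equiv.Perm.sign a : ℤ) : ℂ) • signedSum f := by
  rw [signedSum, Finset.sum_mul, Finset.smul_sum,
    ← Equiv.sum_comp (Equiv.mulRight (⟨a, ha⟩ : fiberPerms f)) fun b =>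
      ((Equiv.Perm.sign a : ℤ) : ℂ) • ((Equiv.Perm.sign b.1 : ℤ) : ℂ) • ofCell μ b.1]
  refine Finset.sum_congr rfl fun b _ => ?_
  simp only [Equiv.coe_mulRight, Subgroup.coe_mul, smul_smul, smul_mul_assoc, map_mul (ofCell μ)]
  rw [sign_mul_cast, mul_left_comm, sign_mul_sign_cast, mul_one]

theorem ofCell_mul_plainSum {ι : Type} {f : Cell μ → ι} {a : Equiv.Perm (Cell μ)}
    (ha : a ∈ fiberPerms f) : ofCell μ a * plainSum f = plainSum f := by
  rw [plainSum, Finset.mul_sum,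
    ← Equiv.sum_comp (Equiv.mulLeft (⟨a, ha⟩ : fiberPerms f)) fun b => ofCell μ b.1]
  refine Finset.sum_congr rfl fun b _ => ?_
  simp only [Equiv.coe_mulLeft, Subgroup.coe_mul, map_mul (ofCell μ)]

/-- Transporting along `t_c` turns the column and row groups into groups of permutations of the
boxes, so that all later arguments take place on the diagram itself. -/
theorem youngSymmetrizer_eq (μ : YoungDiagram) : youngSymmetrizer μ =
    signedSum (fun c : Cell μ => c.1.2) * plainSum fun c => c.1.1 := by
  classical
  have hmem : ∀ {f : ℕ × ℕ → ℕ} (a : Equiv.Perm (Cell μ)),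
      (a ∈ fiberPerms fun c : Cell μ => f c.1) ↔ ∀ x, f ((columnReading μ).symm
        ((columnReading μ).permCongr a x)).1 = f ((columnReading μ).symm x).1 := by
    intro f a
    refine ⟨fun h x => by simpa using h ((columnReading μ).symm x), fun h c => ?_⟩
    simpa using h (columnReading μ c)
  have hsum : ∀ {f : ℕ × ℕ → ℕ} {G : Set (Equiv.Perm (Fin μ.card))}
      (hG : ∀ g, g ∈ G ↔ ∀ x, f ((columnReading μ).symm (g x)).1 = f ((columnReading μ).symm x).1)
      (F : Equiv.Perm (Fin μ.card) → SymGroupAlgebra μ.card),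
      ∑ g ∈ Finset.univ.filter (· ∈ G), F g =
        ∑ a : fiberPerms fun c : Cell μ => f c.1, F ((columnReading μ).permCongr a.1) := by
    intro f G hG F
    symm
    refine Finset.sum_bij (fun a _ => (columnReading μ).permCongr a.1) (fun a _ => ?_)
      (fun a _ b _ h => Subtype.ext ((columnReading μ).permCongr.injective h)) (fun g hg => ?_)
      (fun a _ => rfl)
    · rw [Finset.mem_filter, hG]
      exact ⟨Finset.mem_univ _, (hmem a.1).1 a.2⟩
    · rw [Finset.mem_filter, hG] at hg
      refine ⟨⟨(columnReading μ).permCongr.symm g, (hmem _).2 ?_⟩, Finset.mem_univ _, by ext; simp⟩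
      simpa using hg.2
  rw [youngSymmetrizer, signedSum, plainSum, Finset.sum_mul_sum,
    hsum (f := Prod.snd) (G := columnGroup μ) fun g => Iff.rfl]
  refine Finset.sum_congr rfl fun a _ => ?_
  rw [hsum (f := Prod.fst) (G := rowGroup μ) fun g => Iff.rfl]
  refine Finset.sum_congr rfl fun b _ => ?_
  rw [Equiv.Perm.sign_permCongr, smul_mul_assoc, ofCell_apply, ofCell_apply]
  congr 1
  exact map_mul (MonoidAlgebra.of ℂ _) _ _

theorem ofPerm_mul {m : ℕ} (σ τ : Equiv.Perm (Fin m)) : ofPerm σ * ofPerm τ = ofPerm (σ * τ) :=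
  (map_mul (MonoidAlgebra.of ℂ _) _ _).symm

theorem ofPerm_tableauPerm_trans (t : YoungTableau μ) (a : Equiv.Perm (Cell μ)) :
    ofPerm (tableauPerm (Equiv.trans a t)) = ofPerm (tableauPerm t) * ofCell μ a := by
  rw [ofCell_apply, ofPerm_mul]
  congr 1
  ext x
  simp [tableauPerm]

theorem naturalVector_trans (t : YoungTableau μ) (a : Equiv.Perm (Cell μ)) :
    naturalVector (Equiv.trans a t) = ofPerm (tableauPerm t) * (ofCell μ a * youngSymmetrizer μ) := by
  rw [naturalVector, ofPerm_tableauPerm_trans, mul_assoc]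

theorem naturalVector_trans_col (t : YoungTableau μ) {a : Equiv.Perm (Cell μ)}
    (ha : a ∈ colPerms μ) :
    naturalVector (Equiv.trans a t) = ((Equiv.Perm.sign a : ℤ) : ℂ) • naturalVector t := by
  rw [naturalVector_trans, youngSymmetrizer_eq, ← mul_assoc (ofCell μ a), ofCell_mul_signedSum ha,
    smul_mul_assoc, mul_smul_comm, naturalVector, youngSymmetrizer_eq]

/-- The coefficients of Young's natural vectors. -/
theorem naturalVector_eq_sum (t : YoungTableau μ) : naturalVector t =
    ∑ a : colPerms μ, ∑ b : rowPerms μ, ((Equiv.Perm.sign a.1 : ℤ) : ℂ) •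
      ofPerm (tableauPerm (Equiv.trans (a.1 * b.1) t)) := by
  rw [naturalVector, youngSymmetrizer_eq, signedSum, plainSum, Finset.sum_mul_sum, Finset.mul_sum]
  refine Finset.sum_congr rfl fun a _ => ?_
  rw [Finset.mul_sum]
  refine Finset.sum_congr rfl fun b _ => ?_
  rw [ofPerm_tableauPerm_trans, map_mul, smul_mul_assoc, mul_smul_comm]

/-! ### Garnir relations -/

open Classical in
/-- The permutations of the boxes that fix all boxes outside `Z`. -/
noncomputable abbrev outside (Z : Finset (Cell μ)) (c : Cell μ) : Option (Cell μ) :=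
  if c ∈ Z then none else some c

theorem mem_of_mem_fiberPerms_outside {Z : Finset (Cell μ)} {p : Equiv.Perm (Cell μ)}
    (hp : p ∈ fiberPerms (outside Z)) {c : Cell μ} (hc : c ∈ Z) : p c ∈ Z := by
  by_contra h
  have := hp c
  simp [outside, hc, h] at this

theorem apply_eq_of_mem_fiberPerms_outside {Z : Finset (Cell μ)} {p : Equiv.Perm (Cell μ)}
    (hp : p ∈ fiberPerms (outside Z)) {c : Cell μ} (hc : c ∉ Z) : p c = c := by
  have h := hp c
  by_cases h' : p c ∈ Z <;> simp [outside, hc, h'] at h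
  exact h

/-- For each column permutation `a`, the transposition of the two given boxes changes the sign of
the alternating sum over `Z`, but it is absorbed by `a` times the row sum, since `a⁻¹` puts both
boxes in one row. Each term equals its own negative. -/
theorem sum_mul_eq_zero_of_pair {Z : Finset (Cell μ)}
    (hZ : ∀ a ∈ colPerms μ, ∃ c ∈ Z, ∃ c' ∈ Z, c ≠ c' ∧ (a⁻¹ c).1.1 = (a⁻¹ c').1.1) :
    signedSum (outside Z) * youngSymmetrizer μ = 0 := by
  classical
  rw [youngSymmetrizer_eq, signedSum.eq_1 fun c : Cell μ => c.1.2, Finset.sum_mul, Finset.mul_sum]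
  refine Finset.sum_eq_zero fun a _ => ?_
  obtain ⟨c, hc, c', hc', hne, hrow⟩ := hZ a.1 a.2
  have hswap : Equiv.swap c c' ∈ fiberPerms (outside Z) :=
    swap_mem_fiberPerms (by simp [outside, hc, hc'])
  have hconj : Equiv.swap c c' * a.1 = a.1 * Equiv.swap (a.1⁻¹ c) (a.1⁻¹ c') := by
    rw [Equiv.swap_apply_apply, inv_inv]
    group
  have h1 : ofCell μ (Equiv.swap c c') * (ofCell μ a.1 * plainSum fun c : Cell μ => c.1.1) =
      ofCell μ a.1 * plainSum fun c : Cell μ => c.1.1 := by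
    rw [← mul_assoc, ← map_mul, hconj, map_mul, mul_assoc,
      ofCell_mul_plainSum (swap_mem_fiberPerms hrow)]
  have h2 : signedSum (outside Z) * (ofCell μ a.1 * plainSum fun c : Cell μ => c.1.1) =
      - (signedSum (outside Z) * (ofCell μ a.1 * plainSum fun c : Cell μ => c.1.1)) := by
    conv_lhs => rw [← h1, ← mul_assoc, signedSum_mul_ofCell hswap, Equiv.Perm.sign_swap hne]
    simp
  have h3 := add_eq_zero_iff_eq_neg.2 h2
  rw [← two_smul ℂ, smul_eq_zero_iff_right two_ne_zero] at h3
  rw [smul_mul_assoc, mul_smul_comm, h3, smul_zero]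

/-- The statistic that increases when a tableau is straightened. -/
noncomputable def colStat (t : YoungTableau μ) : ℤ := ∑ c, ((t c : ℕ) : ℤ) * c.1.2

/-- The statistic that is maximal at the column standard tableau in a column class. -/
noncomputable def rowStat (t : YoungTableau μ) : ℤ := ∑ c, ((t c : ℕ) : ℤ) * c.1.1

theorem sum_trans (t : YoungTableau μ) (a : Equiv.Perm (Cell μ)) (f : Cell μ → ℤ) :
    ∑ c, (((Equiv.trans a t) c : ℕ) : ℤ) * f c = ∑ c, ((t c : ℕ) : ℤ) * f (a⁻¹ c) := by
  rw [← Equiv.sum_comp a fun c => ((t c : ℕ) : ℤ) * f (a⁻¹ c)]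
  simp

theorem colStat_trans_col (t : YoungTableau μ) {a : Equiv.Perm (Cell μ)} (ha : a ∈ colPerms μ) :
    colStat (Equiv.trans a t) = colStat t := by
  rw [colStat, sum_trans t a fun c => c.1.2, colStat]
  refine Finset.sum_congr rfl fun c _ => ?_
  have : (a⁻¹ c).1.2 = c.1.2 := (colPerms μ).inv_mem ha c
  rw [this]

theorem rowStat_trans_row (t : YoungTableau μ) {b : Equiv.Perm (Cell μ)} (hb : b ∈ rowPerms μ) :
    rowStat (Equiv.trans b t) = rowStat t := by
  rw [rowStat, sum_trans t b fun c => c.1.1, rowStat]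
  refine Finset.sum_congr rfl fun c _ => ?_
  have : (b⁻¹ c).1.1 = c.1.1 := (rowPerms μ).inv_mem hb c
  rw [this]

/-- The columns increase from top to bottom. -/
def ColIncreasing (t : YoungTableau μ) : Prop :=
  ∀ c c' : Cell μ, c.1.2 = c'.1.2 → c.1.1 < c'.1.1 → t c < t c'

/-- A tableau that maximizes the row statistic in its column class is column increasing. -/
theorem colIncreasing_of_maximal {t : YoungTableau μ}
    (h : ∀ a ∈ colPerms μ, rowStat (Equiv.trans a t) ≤ rowStat t) : ColIncreasing t := by
  classical
  intro c c' hcol hrow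
  by_contra hc
  have hne : c ≠ c' := fun hcc => by rw [hcc] at hrow; exact lt_irrefl _ hrow
  have hlt : t c' < t c := lt_of_le_of_ne (not_lt.1 hc) fun h => hne (t.injective h).symm
  refine absurd (h _ (swap_mem_fiberPerms (f := fun c : Cell μ => c.1.2) hcol)) (not_le.2 ?_)
  -- Exchanging two entries that decrease down a column increases the statistic by the product of
  -- the two gaps.
  have hdiff : rowStat (Equiv.trans (Equiv.swap c c') t) - rowStat t =
      (((t c : ℕ) : ℤ) - (t c' : ℕ)) * ((c'.1.1 : ℤ) - c.1.1) := by
    rw [rowStat, rowStat, ← Finset.sum_sub_distrib]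
    rw [← Finset.sum_subset (Finset.subset_univ {c, c'})]
    · rw [Finset.sum_pair hne]
      simp only [Equiv.trans_apply, Equiv.swap_apply_left, Equiv.swap_apply_right]
      ring
    · intro d _ hd
      simp only [Finset.mem_insert, Finset.mem_singleton, not_or] at hd
      rw [Equiv.trans_apply, Equiv.swap_apply_of_ne_of_ne hd.1 hd.2, sub_self]
  have h1 : (0 : ℤ) < ((t c : ℕ) : ℤ) - (t c' : ℕ) := by
    have : (t c' : ℕ) < t c := hlt
    omega
  have h2 : (0 : ℤ) < (c'.1.1 : ℤ) - c.1.1 := by omega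
  have := mul_pos h1 h2
  omega

theorem exists_colIncreasing (t : YoungTableau μ) :
    ∃ a ∈ colPerms μ, ColIncreasing (Equiv.trans a t) ∧
      ∀ a' ∈ colPerms μ, rowStat (Equiv.trans a' t) ≤ rowStat (Equiv.trans a t) := by
  obtain ⟨a, ha⟩ := Finite.exists_max fun a : colPerms μ => rowStat (Equiv.trans a.1 t)
  refine ⟨a.1, a.2, colIncreasing_of_maximal fun a' ha' => ?_, fun a' ha' => ha ⟨a', ha'⟩⟩
  have := ha (a * ⟨a', ha'⟩)
  rwa [show Equiv.trans (a * ⟨a', ha'⟩ : colPerms μ).1 t = Equiv.trans a' (Equiv.trans a.1 t)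
    from rfl] at this

theorem cell_ext {c c' : Cell μ} (h1 : c.1.1 = c'.1.1) (h2 : c.1.2 = c'.1.2) : c = c' :=
  Subtype.ext (Prod.ext h1 h2)

/-- Any maximiser of the statistic in the column class is column increasing, and there is only one
column increasing tableau in the class, namely `t`. -/
theorem rowStat_le {t : YoungTableau μ} (ht : ColIncreasing t) {a : Equiv.Perm (Cell μ)}
    (ha : a ∈ colPerms μ) : rowStat (Equiv.trans a t) ≤ rowStat t ∧
      (rowStat (Equiv.trans a t) = rowStat t → a = 1) := by
  have huniq : ∀ a ∈ colPerms μ, ColIncreasing (Equiv.trans a t) → a = 1 := by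
    intro a ha h
    exact eq_one_of_increasing (f := fun c : Cell μ => c.1.2) (key := fun c => c.1.1)
      (fun c c' h2 h1 => cell_ext h1 h2) ha (s := t) (fun c c' => ht c c') (fun c c' => h c c')
  obtain ⟨b, hb, hinc, hmax⟩ := exists_colIncreasing t
  have hb1 := huniq b hb hinc
  rw [hb1, show Equiv.trans (1 : Equiv.Perm (Cell μ)) t = t from rfl] at hmax
  refine ⟨hmax a ha, fun heq => huniq a ha (colIncreasing_of_maximal fun a' ha' => ?_)⟩
  rw [heq]
  exact hmax (a * a') ((colPerms μ).mul_mem ha ha')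

/-- The boxes taking part in the Garnir relation at the boxes `(i, j)` and `(i, j')`. -/
noncomputable def garnirSet (c c' : Cell μ) : Finset (Cell μ) :=
  Finset.univ.filter fun d =>
    d.1.2 = c.1.2 ∧ c.1.1 ≤ d.1.1 ∨ d.1.2 = c'.1.2 ∧ d.1.1 ≤ c'.1.1

theorem mem_garnirSet {c c' d : Cell μ} : d ∈ garnirSet c c' ↔
    d.1.2 = c.1.2 ∧ c.1.1 ≤ d.1.1 ∨ d.1.2 = c'.1.2 ∧ d.1.1 ≤ c'.1.1 := by
  simp [garnirSet]

theorem cell_mem {i j i' j' : ℕ} (h : (i, j) ∈ μ.cells) (hi : i' ≤ i) (hj : j' ≤ j) :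
    (i', j') ∈ μ.cells :=
  μ.isLowerSet (show ((i', j') : ℕ × ℕ) ≤ (i, j) from ⟨hi, hj⟩) h

/-- The part of the right column down to the row of `c`, followed by the part of the left column
from that row on, has one box more than the left column, because the row of `c` is used in both. -/
theorem card_garnirSet {c c' : Cell μ} (hrow : c.1.1 = c'.1.1) (hcol : c.1.2 < c'.1.2) :
    μ.colLen c.1.2 < (garnirSet c c').card := by
  have hc : c.1.1 < μ.colLen c.1.2 := YoungDiagram.mem_iff_lt_colLen.1 c.2
  have hmem : ∀ r : Fin (μ.colLen c.1.2 + 1), ((if r.1 ≤ c.1.1 then (r.1, c'.1.2)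
      else (r.1 - 1, c.1.2)) : ℕ × ℕ) ∈ μ.cells := by
    intro r
    split_ifs with h
    · exact cell_mem (μ := μ) c'.2 (h.trans hrow.le) le_rfl
    · exact YoungDiagram.mem_iff_lt_colLen.2 (by omega)
  let F : Fin (μ.colLen c.1.2 + 1) → Cell μ := fun r => ⟨_, hmem r⟩
  have hF : Function.Injective F := by
    intro r r' h
    have := congrArg Subtype.val h
    simp only [F] at this
    apply Fin.ext
    split_ifs at this <;> simp only [Prod.mk.injEq] at this <;> omega
  have hle : (Finset.univ.image F).card ≤ (garnirSet c c').card := by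
    refine Finset.card_le_card fun d hd => ?_
    obtain ⟨r, -, rfl⟩ := Finset.mem_image.1 hd
    rw [mem_garnirSet]
    simp only [F]
    split_ifs with h
    · exact Or.inr ⟨rfl, h.trans hrow.le⟩
    · exact Or.inl ⟨rfl, by simp only; omega⟩
  rw [Finset.card_image_of_injective _ hF, Finset.card_univ, Fintype.card_fin] at hle
  omega

/-- The left column is at least as long as the right one, so a column permutation keeps the Garnir
boxes in the first `colLen` rows of the left column. There are more boxes than such rows, and two of
them must share a row. -/
theorem garnir {c c' : Cell μ} (hrow : c.1.1 = c'.1.1) (hcol : c.1.2 < c'.1.2) :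
    signedSum (outside (garnirSet c c')) * youngSymmetrizer μ = 0 := by
  refine sum_mul_eq_zero_of_pair fun a ha => ?_
  obtain ⟨d, hd, d', hd', hne, heq⟩ := Finset.exists_ne_map_eq_of_card_lt_of_maps_to
    (s := garnirSet c c') (t := Finset.range (μ.colLen c.1.2)) (f := fun d => (a⁻¹ d).1.1)
    (by rw [Finset.card_range]; exact card_garnirSet hrow hcol) (by
      intro d hd
      have h1 : (a⁻¹ d).1.1 < μ.colLen (a⁻¹ d).1.2 := YoungDiagram.mem_iff_lt_colLen.1 (a⁻¹ d).2
      have h2 : (a⁻¹ d).1.2 = d.1.2 := (colPerms μ).inv_mem ha d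
      rw [h2] at h1
      simp only [Finset.coe_range, Set.mem_Iio]
      refine h1.trans_le (μ.colLen_anti _ _ ?_)
      rcases mem_garnirSet.1 hd with h | h <;> omega)
  exact ⟨d, hd, d', hd', hne, heq⟩

/-- At a descent every entry of the left part of the Garnir set is at least `t c` and every entry of
the right part is smaller. A permutation mixing the two parts moves large entries to the right and
small ones to the left, which raises the statistic. -/
theorem colStat_lt {t : YoungTableau μ} (ht : ColIncreasing t) {c c' : Cell μ}
    (hcol : c.1.2 < c'.1.2) (hdesc : t c' < t c) {p : Equiv.Perm (Cell μ)}
    (hp : p ∈ fiberPerms (outside (garnirSet c c'))) (hpc : p ∉ colPerms μ) :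
    colStat t < colStat (Equiv.trans p t) := by
  have hpi := (fiberPerms (outside (garnirSet c c'))).inv_mem hp
  have hA : ∀ d : Cell μ, d.1.2 = c.1.2 → c.1.1 ≤ d.1.1 → (t c : ℕ) ≤ t d := by
    intro d h1 h2
    rcases h2.lt_or_eq with h | h
    · exact (ht c d h1.symm h).le
    · rw [cell_ext h h1.symm]
  have hB : ∀ d : Cell μ, d.1.2 = c'.1.2 → d.1.1 ≤ c'.1.1 → (t d : ℕ) < t c := by
    intro d h1 h2
    rcases h2.lt_or_eq with h | h
    · exact (ht d c' h1 h).trans hdesc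
    · rw [cell_ext h h1]
      exact hdesc
  -- Subtracting the constant `t c` is harmless, since the column shifts add up to zero; it makes
  -- every summand nonnegative.
  have hdiff : colStat (Equiv.trans p t) - colStat t =
      ∑ d, ((t d : ℕ) - (t c : ℕ) : ℤ) * (((p⁻¹ d).1.2 : ℤ) - d.1.2) := by
    have h0 : ∑ d : Cell μ, (((p⁻¹ d).1.2 : ℤ) - d.1.2) = 0 := by
      rw [Finset.sum_sub_distrib, Equiv.sum_comp p⁻¹ fun d : Cell μ => (d.1.2 : ℤ), sub_self]
    rw [colStat, sum_trans t p fun c => c.1.2, colStat, ← Finset.sum_sub_distrib]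
    simp only [sub_mul, Finset.sum_sub_distrib, ← Finset.mul_sum]
    rw [Finset.sum_sub_distrib] at h0
    simp only [mul_sub, Finset.sum_sub_distrib, h0]
    ring
  have hnn : ∀ d, 0 ≤ ((t d : ℕ) - (t c : ℕ) : ℤ) * (((p⁻¹ d).1.2 : ℤ) - d.1.2) := by
    intro d
    by_cases hd : d ∈ garnirSet c c'
    · have hd' := mem_garnirSet.1 (mem_of_mem_fiberPerms_outside hpi hd)
      rcases mem_garnirSet.1 hd with h | h
      · have := hA d h.1 h.2
        exact mul_nonneg (by omega) (by omega)
      · have := hB d h.1 h.2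
        exact mul_nonneg_of_nonpos_of_nonpos (by omega) (by omega)
    · rw [apply_eq_of_mem_fiberPerms_outside hpi hd, sub_self, mul_zero]
  have hpos : 0 < ∑ d, ((t d : ℕ) - (t c : ℕ) : ℤ) * (((p⁻¹ d).1.2 : ℤ) - d.1.2) := by
    refine lt_of_le_of_ne (Finset.sum_nonneg fun d _ => hnn d) fun h0 => hpc ?_
    have hz := (Finset.sum_eq_zero_iff_of_nonneg fun d _ => hnn d).1 h0.symm
    have hBB : ∀ d : Cell μ, d.1.2 = c'.1.2 → d ∈ garnirSet c c' → (p⁻¹ d).1.2 = d.1.2 := by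
      intro d hd1 hd
      have h1 := hB d hd1 (by rcases mem_garnirSet.1 hd with h | h <;> omega)
      have := (mul_eq_zero.1 (hz d (Finset.mem_univ _))).resolve_left (by omega)
      omega
    suffices h : p⁻¹ ∈ colPerms μ by simpa using (colPerms μ).inv_mem h
    -- When the sum vanishes, `p⁻¹` maps the right part into itself, hence onto itself. No box of
    -- the left part can then land there, so `p⁻¹` preserves columns.
    let B : Finset (Cell μ) := (garnirSet c c').filter fun d => d.1.2 = c'.1.2
    have hBm : Set.MapsTo (p⁻¹ : Equiv.Perm (Cell μ)) (B : Set (Cell μ)) B := by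
      intro d hd
      have hd := Finset.mem_filter.1 (Finset.mem_coe.1 hd)
      exact Finset.mem_coe.2 (Finset.mem_filter.2 ⟨mem_of_mem_fiberPerms_outside hpi hd.1,
        (hBB d hd.2 hd.1).trans hd.2⟩)
    have hBs := Finset.surjOn_of_injOn_of_card_le _ hBm (p⁻¹.injective.injOn) le_rfl
    intro d
    change (p⁻¹ d).1.2 = d.1.2
    by_cases hd : d ∈ garnirSet c c'
    · rcases mem_garnirSet.1 hd with h | h
      · have hd' := mem_of_mem_fiberPerms_outside hpi hd
        rcases mem_garnirSet.1 hd' with h' | h'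
        · rw [h.1, h'.1]
        · obtain ⟨d'', hd1, hd2⟩ := hBs (Finset.mem_coe.2 (Finset.mem_filter.2 ⟨hd', h'.1⟩))
          have := (Finset.mem_filter.1 (Finset.mem_coe.1 hd1)).2
          rw [p⁻¹.injective hd2] at this
          omega
      · exact hBB d h.1 hd
    · rw [apply_eq_of_mem_fiberPerms_outside hpi hd]
  omega

/-- Straightening: after sorting the columns, a tableau that is not standard has a descent in a row,
and the Garnir relation there expresses its vector through tableaux with a larger column statistic.
The induction is on the distance of the statistic from its maximum. -/
theorem naturalVector_mem_span (t : YoungTableau μ) : naturalVector t ∈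
    Submodule.span ℂ (Set.range fun s : StandardYoungTableau μ => naturalVector s.1) := by
  have : Nonempty (YoungTableau μ) := ⟨t⟩
  obtain ⟨tmax, htmax⟩ := Finite.exists_max (fun t : YoungTableau μ => colStat t)
  obtain ⟨N, hN⟩ : ∃ N : ℕ, (N : ℤ) = colStat tmax - colStat t :=
    ⟨(colStat tmax - colStat t).toNat, Int.toNat_of_nonneg (by have := htmax t; omega)⟩
  induction N using Nat.strong_induction_on generalizing t with
  | _ N ih =>
    obtain ⟨a, ha, hinc, -⟩ := exists_colIncreasing t
    suffices h : naturalVector (Equiv.trans a t) ∈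
        Submodule.span ℂ (Set.range fun s : StandardYoungTableau μ => naturalVector s.1) by
      rw [naturalVector_trans_col t ha] at h
      have := Submodule.smul_mem _ ((Equiv.Perm.sign a : ℤ) : ℂ) h
      rwa [smul_smul, sign_mul_sign_cast, one_smul] at this
    have hstat := colStat_trans_col t ha
    rw [← hstat] at hN
    generalize (Equiv.trans a t : YoungTableau μ) = s at hinc hN
    clear hstat ha a t
    by_cases hstd : YoungTableau.IsStandard s
    · exact Submodule.subset_span ⟨⟨s, hstd⟩, rfl⟩
    · obtain ⟨c, c', hrow, hcol, hdesc⟩ : ∃ c c' : Cell μ, c.1.1 = c'.1.1 ∧ c.1.2 < c'.1.2 ∧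
          s c' < s c := by
        by_contra hc
        push Not at hc
        refine hstd fun c c' h => ?_
        rcases h with ⟨h1, h2⟩ | ⟨h1, h2⟩
        · refine lt_of_le_of_ne (hc c c' h1 h2) fun he => ?_
          rw [s.injective he] at h2
          exact lt_irrefl _ h2
        · exact hinc c c' h1 h2
      set H := fiberPerms (outside (garnirSet c c')) with hH
      have hg : ∑ p : H, ((Equiv.Perm.sign p.1 : ℤ) : ℂ) • naturalVector (Equiv.trans p.1 s) = 0 := by
        have := congrArg (fun z => ofPerm (tableauPerm s) * z) (garnir hrow hcol)
        simp only [mul_zero, signedSum, Finset.sum_mul, Finset.mul_sum] at this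
        rw [← this]
        refine Finset.sum_congr rfl fun p _ => ?_
        rw [naturalVector_trans, smul_mul_assoc, mul_smul_comm]
      classical
      rw [← Finset.sum_filter_add_sum_filter_not _ fun p : H => p.1 ∈ colPerms μ] at hg
      -- The column-preserving terms of the Garnir relation all equal the vector of `s`, because the
      -- two signs cancel. Their number is positive, since the identity is one of them, so it can be
      -- divided out over `ℂ`; integrality of the coefficients is obtained separately from
      -- triangularity.
      have h1 : ∑ p ∈ Finset.univ.filter (fun p : H => p.1 ∈ colPerms μ),
          ((Equiv.Perm.sign p.1 : ℤ) : ℂ) • naturalVector (Equiv.trans p.1 s) =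
          ((Finset.univ.filter fun p : H => p.1 ∈ colPerms μ).card : ℂ) • naturalVector s := by
        rw [Finset.sum_congr rfl (g := fun _ => naturalVector s), Finset.sum_const,
          Nat.cast_smul_eq_nsmul]
        intro p hp
        rw [naturalVector_trans_col s (Finset.mem_filter.1 hp).2, smul_smul, sign_mul_sign_cast,
          one_smul]
      have hcard : ((Finset.univ.filter fun p : H => p.1 ∈ colPerms μ).card : ℂ) ≠ 0 := by
        rw [Nat.cast_ne_zero]
        exact Finset.card_ne_zero_of_mem (a := 1)
          (Finset.mem_filter.2 ⟨Finset.mem_univ _, (colPerms μ).one_mem⟩)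
      rw [h1, add_eq_zero_iff_eq_neg] at hg
      have h2 : ((Finset.univ.filter fun p : H => p.1 ∈ colPerms μ).card : ℂ) • naturalVector s ∈
          Submodule.span ℂ (Set.range fun s : StandardYoungTableau μ => naturalVector s.1) := by
        rw [hg]
        refine Submodule.neg_mem _ (Submodule.sum_mem _ fun p hp => Submodule.smul_mem _ _ ?_)
        have hlt := colStat_lt hinc hcol hdesc p.2 (Finset.mem_filter.1 hp).2
        have hle := htmax (Equiv.trans p.1 s)
        exact ih (colStat tmax - colStat (Equiv.trans p.1 s)).toNat (by omega) _
          (Int.toNat_of_nonneg (by omega))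
      have := Submodule.smul_mem _
        ((Finset.univ.filter fun p : H => p.1 ∈ colPerms μ).card : ℂ)⁻¹ h2
      rwa [smul_smul, inv_mul_cancel₀ hcard, one_smul] at this

end Specht

/-! ### Unitriangularity, integral straightening and the Specht module -/

section Specht

variable {μ : YoungDiagram}

theorem coeff_ofPerm {m : ℕ} (σ τ : Equiv.Perm (Fin m)) [Decidable (σ = τ)] :
    (ofPerm σ).coeff τ = if σ = τ then 1 else 0 := by
  classical
  rw [ofPerm, MonoidAlgebra.of_apply, MonoidAlgebra.coeff_single, Finsupp.single_apply]

theorem tableauPerm_injective : Function.Injective (tableauPerm (μ := μ)) := by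
  intro t t' h
  ext c
  have := Equiv.congr_fun h (columnReading μ c)
  simp only [tableauPerm, Equiv.trans_apply, Equiv.symm_apply_apply] at this
  rw [this]

/-- The coefficient of `n_t` at the tableau `s`. -/
noncomputable def naturalCoeff (t s : YoungTableau μ) : ℤ :=
  open Classical in ∑ a : colPerms μ, ∑ b : rowPerms μ,
    if Equiv.trans (a.1 * b.1) t = s then (Equiv.Perm.sign a.1 : ℤ) else 0

theorem coeff_naturalVector (t s : YoungTableau μ) :
    (naturalVector t).coeff (tableauPerm s) = naturalCoeff t s := by
  classical
  rw [naturalVector_eq_sum, naturalCoeff, MonoidAlgebra.coeff_sum, Finsupp.finsetSum_apply,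
    Int.cast_sum]
  refine Finset.sum_congr rfl fun a _ => ?_
  rw [MonoidAlgebra.coeff_sum, Finsupp.finsetSum_apply, Int.cast_sum]
  refine Finset.sum_congr rfl fun b _ => ?_
  rw [MonoidAlgebra.coeff_smul, Finsupp.smul_apply, coeff_ofPerm]
  simp only [tableauPerm_injective.eq_iff]
  split_ifs <;> simp

theorem trans_mul (t : YoungTableau μ) (a b : Equiv.Perm (Cell μ)) :
    Equiv.trans (a * b) t = Equiv.trans b (Equiv.trans a t) := rfl

theorem StandardYoungTableau.colIncreasing (s : StandardYoungTableau μ) : ColIncreasing s.1 :=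
  fun c c' h1 h2 => s.2 c c' (Or.inr ⟨h1, h2⟩)

theorem StandardYoungTableau.eq_one_of_row (s : StandardYoungTableau μ) {b : Equiv.Perm (Cell μ)}
    (hb : b ∈ rowPerms μ) (h : YoungTableau.IsStandard (Equiv.trans b s.1)) : b = 1 :=
  eq_one_of_increasing (f := fun c : Cell μ => c.1.1) (key := fun c => c.1.2)
    (fun _ _ h1 h2 => cell_ext h1 h2) hb (s := s.1) (fun c c' h1 h2 => s.2 c c' (Or.inl ⟨h1, h2⟩))
    (fun c c' h1 h2 => h c c' (Or.inl ⟨h1, h2⟩))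

/-- Leading terms: the coefficients of the natural vectors of standard tableaux are triangular. -/
theorem naturalCoeff_standard (s s' : StandardYoungTableau μ) (h : naturalCoeff s.1 s'.1 ≠ 0) :
    rowStat s'.1 < rowStat s.1 ∨ s = s' := by
  classical
  obtain ⟨a, -, ha⟩ := Finset.exists_ne_zero_of_sum_ne_zero h
  obtain ⟨b, -, hb⟩ := Finset.exists_ne_zero_of_sum_ne_zero ha
  have hab : Equiv.trans (a.1 * b.1) s.1 = s'.1 := by
    by_contra hc
    exact hb (if_neg hc)
  rw [trans_mul] at hab
  -- Row permutations do not change the statistic, and a column permutation of a column increasing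
  -- tableau lowers it unless it is trivial.
  have hle := rowStat_le s.colIncreasing a.2
  have hr : rowStat s'.1 = rowStat (Equiv.trans a.1 s.1) := by
    rw [← hab, rowStat_trans_row _ b.2]
  rw [hr]
  rcases hle.1.lt_or_eq with hlt | heq
  · exact Or.inl hlt
  · right
    rw [hle.2 heq] at hab
    change Equiv.trans b.1 s.1 = s'.1 at hab
    have := s.eq_one_of_row b.2 (by rw [hab]; exact s'.2)
    rw [this] at hab
    exact Subtype.ext hab

/-- A column permutation and a row permutation with trivial product are both trivial, so only the
identity term contributes. -/
theorem naturalCoeff_self (t : YoungTableau μ) : naturalCoeff t t = 1 := by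
  classical
  have key : ∀ (a : colPerms μ) (b : rowPerms μ), Equiv.trans (a.1 * b.1) t = t →
      a = 1 ∧ b = 1 := by
    intro a b hab
    have hab' : ∀ c, a.1 (b.1 c) = c := fun c => t.injective (Equiv.congr_fun hab c)
    have hb : ∀ c, b.1 c = c := fun c => by
      have h1 := a.2 (b.1 c)
      simp only [hab'] at h1
      exact cell_ext (b.2 c) h1.symm
    exact ⟨Subtype.ext (Equiv.ext fun c => by have := hab' c; rwa [hb] at this),
      Subtype.ext (Equiv.ext hb)⟩
  rw [naturalCoeff, Finset.sum_eq_single 1, Finset.sum_eq_single 1]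
  · refine (if_pos ?_).trans ?_
    · rfl
    · simp
  · exact fun b _ hb => if_neg fun h => hb (key _ _ h).2
  · exact fun h => absurd (Finset.mem_univ _) h
  · exact fun a _ ha => Finset.sum_eq_zero fun b _ => if_neg fun h => ha (key _ _ h).1
  · exact fun h => absurd (Finset.mem_univ _) h

/-- If a combination of standard natural vectors has all its coefficients in a subgroup of `ℂ`,
then so do the scalars. -/
theorem scalar_mem_of_coeff_mem (G : AddSubgroup ℂ) {c : StandardYoungTableau μ → ℂ}
    (h : ∀ σ, (∑ s, c s • naturalVector s.1).coeff σ ∈ G) (s : StandardYoungTableau μ) :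
    c s ∈ G := by
  classical
  by_contra hs
  -- For a bad scalar with the largest row statistic, the other terms that contribute at `s` come
  -- from larger statistics and so have scalars in `G`. The diagonal coefficient `1` then puts `c s`
  -- in `G` as well.
  obtain ⟨s, hs, hmax⟩ := (Finset.univ.filter fun s => c s ∉ G).exists_max_image
    (fun s => rowStat s.1) ⟨s, by simpa using hs⟩
  rw [Finset.mem_filter] at hs
  have h1 := h (tableauPerm s.1)
  rw [MonoidAlgebra.coeff_sum, Finsupp.finsetSum_apply, ← Finset.add_sum_erase _ _ (Finset.mem_univ s)] at h1
  simp only [MonoidAlgebra.coeff_smul, Finsupp.smul_apply, coeff_naturalVector, smul_eq_mul,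
    naturalCoeff_self, Int.cast_one, mul_one] at h1
  refine hs.2 ((AddSubgroup.add_mem_cancel_right _ (AddSubgroup.sum_mem _ fun s' hs' => ?_)).1 h1)
  by_cases h0 : naturalCoeff s'.1 s.1 = 0
  · rw [h0, Int.cast_zero, mul_zero]
    exact G.zero_mem
  · have hlt := (naturalCoeff_standard s' s h0).resolve_right (Finset.ne_of_mem_erase hs')
    have hc : c s' ∈ G := by
      by_contra hc
      exact absurd (hmax s' (Finset.mem_filter.2 ⟨Finset.mem_univ _, hc⟩)) (not_le.2 hlt)
    rw [mul_comm, ← zsmul_eq_mul]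
    exact G.zsmul_mem hc _

/-- This is the triangularity statement for the zero subgroup. -/
theorem linearIndependent_naturalVector :
    LinearIndependent ℂ fun s : StandardYoungTableau μ => naturalVector s.1 := by
  rw [Fintype.linearIndependent_iff]
  intro c hc s
  have := scalar_mem_of_coeff_mem ⊥ (c := c) (fun σ => by rw [hc]; rfl) s
  simpa using this

/-- The complex coefficients from the Garnir relations are integers by triangularity for the
subgroup `ℤ` of `ℂ`, as the natural vectors have integer coefficients. -/
theorem existsUnique_isStraightening (t : YoungTableau μ) :
    ∃! c : StandardYoungTableau μ → ℤ, IsStraightening t c := by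
  obtain ⟨c, hc⟩ := (Submodule.mem_span_range_iff_exists_fun ℂ).1 (naturalVector_mem_span t)
  have hint : ∀ s, ∃ z : ℤ, (z : ℂ) = c s := by
    intro s
    have := scalar_mem_of_coeff_mem (Int.castAddHom ℂ).range (c := c) (fun σ => by
      obtain ⟨t', rfl⟩ : ∃ t' : YoungTableau μ, tableauPerm t' = σ :=
        ⟨(columnReading μ).trans σ, by ext; simp [tableauPerm]⟩
      rw [hc, coeff_naturalVector]
      exact ⟨_, rfl⟩) s
    exact this
  choose z hz using hint
  refine ⟨z, by simp only [IsStraightening, hz, hc], fun z' hz' => funext fun s => ?_⟩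
  have h0 : ∑ s : StandardYoungTableau μ, ((z' s : ℂ) - z s) • naturalVector s.1 = 0 := by
    simp only [sub_smul, Finset.sum_sub_distrib, hz, hc]
    rw [← show naturalVector t = _ from hz', sub_self]
  have := Fintype.linearIndependent_iff.1 linearIndependent_naturalVector _ h0 s
  exact_mod_cast sub_eq_zero.1 this

theorem isStraightening_straightening (t : YoungTableau μ) :
    IsStraightening t (straightening t) := by
  have h := (existsUnique_isStraightening t).exists
  rw [straightening, dif_pos h]
  exact h.choose_spec

/-! ### Irreducibility of the Specht module -/

theorem naturalVector_mem_spechtModule (t : YoungTableau μ) :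
    naturalVector t ∈ spechtModule μ :=
  Submodule.smul_mem _ (ofPerm (tableauPerm t)) (Submodule.mem_span_singleton_self _)

theorem mem_spechtModule_iff {x : SymGroupAlgebra μ.card} :
    x ∈ spechtModule μ ↔ ∃ y, y * youngSymmetrizer μ = x :=
  Submodule.mem_span_singleton

theorem eq_sum_ofPerm {m : ℕ} (y : SymGroupAlgebra m) : y = ∑ σ, y.coeff σ • ofPerm σ := by
  classical
  ext τ
  rw [MonoidAlgebra.coeff_sum, Finsupp.finsetSum_apply, Finset.sum_eq_single τ]
  · rw [MonoidAlgebra.coeff_smul, Finsupp.smul_apply, coeff_ofPerm, if_pos rfl, smul_eq_mul, mul_one]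
  · intro σ _ h
    rw [MonoidAlgebra.coeff_smul, Finsupp.smul_apply, coeff_ofPerm, if_neg h, smul_zero]
  · exact fun h => absurd (Finset.mem_univ _) h

theorem spechtModule_mem_span {x : SymGroupAlgebra μ.card} (hx : x ∈ spechtModule μ) : x ∈
    Submodule.span ℂ (Set.range fun s : StandardYoungTableau μ => naturalVector s.1) := by
  obtain ⟨y, rfl⟩ := mem_spechtModule_iff.1 hx
  rw [eq_sum_ofPerm y, Finset.sum_mul]
  refine Submodule.sum_mem _ fun σ _ => ?_
  rw [smul_mul_assoc]
  refine Submodule.smul_mem _ _ ?_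
  have : ofPerm σ * youngSymmetrizer μ = naturalVector ((columnReading μ).trans σ) := by
    rw [naturalVector]
    congr 2
    ext
    simp [tableauPerm]
  rw [this]
  exact naturalVector_mem_span _

theorem youngSymmetrizer_ne_zero (μ : YoungDiagram) : youngSymmetrizer μ ≠ 0 := by
  intro h
  have h1 : naturalVector (columnReading μ) = 0 := by rw [naturalVector, h, mul_zero]
  have h2 := coeff_naturalVector (columnReading μ) (columnReading μ)
  rw [h1, naturalCoeff_self] at h2
  simp at h2

/-- If no two boxes in a column have images in the same row, then `q` is a product of a column
permutation and a row permutation. -/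
theorem exists_col_mul_row {q : Equiv.Perm (Cell μ)}
    (hq : ∀ c d : Cell μ, c.1.2 = d.1.2 → (q⁻¹ c).1.1 = (q⁻¹ d).1.1 → c = d) :
    ∃ a ∈ colPerms μ, ∃ b ∈ rowPerms μ, q = a * b := by
  classical
  let Nc : ℕ := (Finset.univ.sup fun c : Cell μ => c.1.2) + 1
  have hNc : ∀ c : Cell μ, c.1.2 < Nc := fun c =>
    Nat.lt_succ_of_le (Finset.le_sup (f := fun c : Cell μ => c.1.2) (Finset.mem_univ c))
  have hcard : ∀ j i, ((Finset.univ : Finset (Cell μ)).filter fun c => c.1.2 = j ∧ c.1.1 < i).card =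
      min (μ.colLen j) i := by
    intro j i
    rw [← Finset.card_range (min (μ.colLen j) i)]
    refine Finset.card_bij (fun c _ => c.1.1) (fun c hc => ?_) (fun c hc d hd h => ?_)
      (fun r hr => ?_)
    · obtain ⟨-, h1, h2⟩ := Finset.mem_filter.1 hc
      have := YoungDiagram.mem_iff_lt_colLen.1 c.2
      rw [h1] at this
      exact Finset.mem_range.2 (lt_min this h2)
    · exact cell_ext h ((Finset.mem_filter.1 hc).2.1.trans (Finset.mem_filter.1 hd).2.1.symm)
    · simp only [Finset.mem_range, lt_min_iff] at hr
      exact ⟨⟨(r, j), YoungDiagram.mem_iff_lt_colLen.2 hr.1⟩, by simpa using hr.2, rfl⟩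
  -- The number `L j i` counts the boxes of column `j` that `q⁻¹` sends to the first `i` rows. Each
  -- is at most `min (colLen j) i`, and both sides have the same sum over `j`, namely the number of
  -- boxes in the first `i` rows. So all bounds are attained; for `i = colLen j`, no box of column
  -- `j` goes below row `colLen j`.
  let L : ℕ → ℕ → ℕ := fun j i =>
    ((Finset.univ : Finset (Cell μ)).filter fun c => c.1.2 = j ∧ (q⁻¹ c).1.1 < i).card
  have hL : ∀ j i, L j i ≤ min (μ.colLen j) i := by
    intro j i
    refine le_min ?_ ?_
    · calc L j i ≤ ((Finset.univ : Finset (Cell μ)).filter fun c =>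
              c.1.2 = j ∧ c.1.1 < μ.colLen j).card := by
            refine Finset.card_le_card fun c hc => ?_
            obtain ⟨-, h1, -⟩ := Finset.mem_filter.1 hc
            have := YoungDiagram.mem_iff_lt_colLen.1 c.2
            rw [h1] at this
            exact Finset.mem_filter.2 ⟨Finset.mem_univ _, h1, this⟩
        _ = μ.colLen j := by rw [hcard, min_self]
    · rw [← Finset.card_range i]
      refine Finset.card_le_card_of_injOn (fun c => (q⁻¹ c).1.1) (fun c hc => ?_)
        fun c hc d hd h => ?_
      · simpa using (Finset.mem_filter.1 hc).2.2
      · exact hq c d ((Finset.mem_filter.1 hc).2.1.trans (Finset.mem_filter.1 hd).2.1.symm) h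
  have hfib : ∀ (P : Cell μ → Prop) [DecidablePred P], ((Finset.univ : Finset (Cell μ)).filter P).card =
      ∑ j ∈ Finset.range Nc, ((Finset.univ : Finset (Cell μ)).filter fun c => c.1.2 = j ∧ P c).card := by
    intro P _
    rw [Finset.card_eq_sum_card_fiberwise (f := fun c : Cell μ => c.1.2) (t := Finset.range Nc)
      (fun c _ => by simpa using hNc c)]
    refine Finset.sum_congr rfl fun j _ => ?_
    rw [Finset.filter_filter]
    congr 1
    ext c
    simp [and_comm]
  have hsum : ∀ i, ∑ j ∈ Finset.range Nc, L j i = ∑ j ∈ Finset.range Nc, min (μ.colLen j) i := by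
    intro i
    refine (hfib fun c => (q⁻¹ c).1.1 < i).symm.trans ?_
    rw [← Finset.sum_congr rfl fun j _ => hcard j i,
      ← hfib fun c => c.1.1 < i]
    refine Finset.card_bij (fun c _ => q⁻¹ c) (fun c hc => ?_) (fun c _ d _ h => q⁻¹.injective h)
      fun c hc => ⟨q c, ?_, by simp⟩
    · simpa using hc
    · simpa using hc
  have heq : ∀ j, j < Nc → L j (μ.colLen j) = μ.colLen j := by
    intro j hj
    have := (Finset.sum_eq_sum_iff_of_le fun j' _ => hL j' (μ.colLen j)).1 (hsum (μ.colLen j)) j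
      (Finset.mem_range.2 hj)
    rwa [min_self] at this
  have hmem : ∀ c : Cell μ, ((q⁻¹ c).1.1, c.1.2) ∈ μ.cells := by
    intro c
    refine YoungDiagram.mem_iff_lt_colLen.2 ?_
    have h1 := heq c.1.2 (hNc c)
    have h2 : (Finset.univ : Finset (Cell μ)).filter (fun d => d.1.2 = c.1.2 ∧ (q⁻¹ d).1.1 <
        μ.colLen c.1.2) = (Finset.univ : Finset (Cell μ)).filter (fun d => d.1.2 = c.1.2 ∧ d.1.1 <
        μ.colLen c.1.2) := by
      refine Finset.eq_of_subset_of_card_le (fun d hd => ?_) ?_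
      · obtain ⟨-, h1, -⟩ := Finset.mem_filter.1 hd
        have := YoungDiagram.mem_iff_lt_colLen.1 d.2
        rw [h1] at this
        exact Finset.mem_filter.2 ⟨Finset.mem_univ _, h1, this⟩
      · rw [hcard, min_self]
        exact h1.ge
    have h3 : c ∈ (Finset.univ : Finset (Cell μ)).filter (fun d => d.1.2 = c.1.2 ∧ d.1.1 <
        μ.colLen c.1.2) :=
      Finset.mem_filter.2 ⟨Finset.mem_univ _, rfl, YoungDiagram.mem_iff_lt_colLen.1 c.2⟩
    rw [← h2] at h3
    exact (Finset.mem_filter.1 h3).2.2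
  -- Keeping the column of `c` and taking the row of `q⁻¹ c` defines a column permutation `p`, and
  -- then `p * q` preserves rows.
  let e : Cell μ → Cell μ := fun c => ⟨_, hmem c⟩
  have he : Function.Injective e := by
    intro c d h
    have := congrArg Subtype.val h
    simp only [e, Prod.mk.injEq] at this
    exact hq c d this.2 this.1
  let p : Equiv.Perm (Cell μ) := Equiv.ofBijective e (Finite.injective_iff_bijective.1 he)
  have hp : p ∈ colPerms μ := fun c => rfl
  refine ⟨p⁻¹, (colPerms μ).inv_mem hp, p * q, fun c => ?_, by group⟩
  change (q⁻¹ (q c)).1.1 = c.1.1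
  simp

/-- For a single permutation `q` there are two cases: either `q` factors as a column times a row
permutation and gives plus or minus the symmetrizer, or two boxes of a column come from one row and
their transposition makes the product its own negative. -/
theorem signedSum_mul_mul_plainSum (z : SymGroupAlgebra μ.card) : ∃ r : ℂ,
    signedSum (fun c : Cell μ => c.1.2) * z * plainSum (fun c : Cell μ => c.1.1) =
      r • youngSymmetrizer μ := by
  classical
  have key : ∀ q : Equiv.Perm (Cell μ), ∃ r : ℂ, signedSum (fun c : Cell μ => c.1.2) * ofCell μ q *
      plainSum (fun c : Cell μ => c.1.1) = r • youngSymmetrizer μ := by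
    intro q
    by_cases hq : ∀ c d : Cell μ, c.1.2 = d.1.2 → (q⁻¹ c).1.1 = (q⁻¹ d).1.1 → c = d
    · obtain ⟨a, ha, b, hb, rfl⟩ := exists_col_mul_row hq
      refine ⟨((Equiv.Perm.sign a : ℤ) : ℂ), ?_⟩
      rw [map_mul, ← mul_assoc, signedSum_mul_ofCell ha, mul_assoc, ofCell_mul_plainSum hb,
        smul_mul_assoc, youngSymmetrizer_eq]
    · push Not at hq
      obtain ⟨c, d, hcol, hrow, hne⟩ := hq
      refine ⟨0, ?_⟩
      have hconj : Equiv.swap c d * q = q * Equiv.swap (q⁻¹ c) (q⁻¹ d) := by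
        rw [Equiv.swap_apply_apply, inv_inv]
        group
      have h1 : ofCell μ (Equiv.swap c d) * (ofCell μ q * plainSum fun c : Cell μ => c.1.1) =
          ofCell μ q * plainSum fun c : Cell μ => c.1.1 := by
        rw [← mul_assoc, ← map_mul, hconj, map_mul, mul_assoc,
          ofCell_mul_plainSum (swap_mem_fiberPerms hrow)]
      have h2 : signedSum (fun c : Cell μ => c.1.2) * (ofCell μ q * plainSum fun c : Cell μ => c.1.1) =
          - (signedSum (fun c : Cell μ => c.1.2) *
            (ofCell μ q * plainSum fun c : Cell μ => c.1.1)) := by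
        conv_lhs => rw [← h1, ← mul_assoc, signedSum_mul_ofCell (swap_mem_fiberPerms
          (f := fun c : Cell μ => c.1.2) hcol), Equiv.Perm.sign_swap hne]
        simp
      have h3 := add_eq_zero_iff_eq_neg.2 h2
      rw [← two_smul ℂ, smul_eq_zero_iff_right two_ne_zero] at h3
      rw [mul_assoc, h3, zero_smul]
  have hperm : ∀ σ : Equiv.Perm (Fin μ.card), ∃ q, ofCell μ q = ofPerm σ := fun σ =>
    ⟨(columnReading μ).permCongr.symm σ, by rw [ofCell_apply, Equiv.apply_symm_apply]⟩
  choose q hq using hperm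
  choose r hr using key
  refine ⟨∑ σ, z.coeff σ * r (q σ), ?_⟩
  conv_lhs => rw [eq_sum_ofPerm z]
  rw [Finset.mul_sum, Finset.sum_mul, Finset.sum_smul]
  refine Finset.sum_congr rfl fun σ _ => ?_
  rw [mul_smul_comm, smul_mul_assoc, ← hq, hr, smul_smul]

theorem signedSum_mul_mem (x : SymGroupAlgebra μ.card) (hx : x ∈ spechtModule μ) :
    ∃ r : ℂ, signedSum (fun c : Cell μ => c.1.2) * x = r • youngSymmetrizer μ := by
  obtain ⟨y, rfl⟩ := mem_spechtModule_iff.1 hx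
  obtain ⟨r, hr⟩ := signedSum_mul_mul_plainSum (y * signedSum fun c : Cell μ => c.1.2)
  refine ⟨r, ?_⟩
  rw [← hr, youngSymmetrizer_eq]
  simp only [mul_assoc]

theorem signedSum_mul_youngSymmetrizer (μ : YoungDiagram) : ∃ r : ℂ, r ≠ 0 ∧
    signedSum (fun c : Cell μ => c.1.2) * youngSymmetrizer μ = r • youngSymmetrizer μ := by
  refine ⟨Fintype.card (colPerms μ), Nat.cast_ne_zero.2 Fintype.card_ne_zero, ?_⟩
  rw [youngSymmetrizer_eq, ← mul_assoc]
  have h : signedSum (fun c : Cell μ => c.1.2) * signedSum (fun c : Cell μ => c.1.2) =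
      (Fintype.card (colPerms μ) : ℂ) • signedSum (fun c : Cell μ => c.1.2) := by
    nth_rewrite 1 [signedSum]
    rw [Finset.sum_mul, Finset.sum_congr rfl (g := fun _ => signedSum fun c : Cell μ => c.1.2),
      Finset.sum_const, Finset.card_univ, Nat.cast_smul_eq_nsmul]
    intro a _
    rw [smul_mul_assoc, ofCell_mul_signedSum a.2, smul_smul, sign_mul_sign_cast, one_smul]
  rw [h, smul_mul_assoc]

/-- The Specht module is irreducible. -/
theorem spechtModule_irreducible {U : Submodule (SymGroupAlgebra μ.card) (SymGroupAlgebra μ.card)}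
    (hU : U ≤ spechtModule μ) : U = ⊥ ∨ U = spechtModule μ := by
  have hp : youngSymmetrizer μ ∈ spechtModule μ := Submodule.mem_span_singleton_self _
  have hspan : ∀ W : Submodule (SymGroupAlgebra μ.card) (SymGroupAlgebra μ.card),
      ∀ r : ℂ, r ≠ 0 → r • youngSymmetrizer μ ∈ W → spechtModule μ ≤ W := by
    intro W r hr hW
    refine (Submodule.span_singleton_le_iff_mem _ _).2 ?_
    have := W.smul_mem (algebraMap ℂ (SymGroupAlgebra μ.card) r⁻¹) hW
    rwa [algebraMap_smul, smul_smul, inv_mul_cancel₀ hr, one_smul] at this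
  -- With a complement from Maschke's theorem, the symmetrizer splits as `u + w`. The column sum
  -- maps both parts to multiples of the symmetrizer, and these add up to a nonzero multiple. So the
  -- symmetrizer lies in `U` or in `W`; in the latter case `U ≤ W` and `U = 0`.
  obtain ⟨W, hW⟩ := MonoidAlgebra.Submodule.exists_isCompl U
  obtain ⟨u, hu, w, hw, huw⟩ := Submodule.mem_sup.1
    (show youngSymmetrizer μ ∈ U ⊔ W by rw [hW.sup_eq_top]; trivial)
  have hwS : w ∈ spechtModule μ := by
    rw [← add_sub_cancel_left u w, huw]
    exact Submodule.sub_mem _ hp (hU hu)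
  obtain ⟨r₁, h₁⟩ := signedSum_mul_mem u (hU hu)
  obtain ⟨r₂, h₂⟩ := signedSum_mul_mem w hwS
  obtain ⟨r, hr, h⟩ := signedSum_mul_youngSymmetrizer μ
  have hu' : r₁ • youngSymmetrizer μ ∈ U := h₁ ▸ U.smul_mem _ hu
  have hw' : r₂ • youngSymmetrizer μ ∈ W := h₂ ▸ W.smul_mem _ hw
  by_cases hr₁ : r₁ = 0
  · have hr₂ : r₂ ≠ 0 := by
      rintro rfl
      rw [← huw, mul_add, h₁, h₂, hr₁, huw, zero_smul, add_zero] at h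
      exact (smul_ne_zero hr (youngSymmetrizer_ne_zero μ)) h.symm
    left
    rw [eq_bot_iff, ← hW.inf_eq_bot]
    exact le_inf le_rfl (hU.trans (hspan W r₂ hr₂ hw'))
  · exact Or.inr (le_antisymm hU (hspan U r₁ hr₁ hu'))

/-- If `μ` has one row, then the Specht module is one-dimensional. -/
theorem spechtModule_oneRow (hμ : OneRow μ) {x : SymGroupAlgebra μ.card}
    (hx : x ∈ spechtModule μ) : ∃ r : ℂ, x = r • youngSymmetrizer μ := by
  have hrow : ∀ q : Equiv.Perm (Cell μ), q ∈ rowPerms μ := fun q c => by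
    change (q c).1.1 = c.1.1
    rw [hμ _ (q c).2, hμ _ c.2]
  have hcol : ∀ q ∈ colPerms μ, q = 1 := fun q hq => Equiv.ext fun c =>
    cell_ext (hrow q c) (hq c)
  have hp : youngSymmetrizer μ = plainSum fun c : Cell μ => c.1.1 := by
    have : signedSum (fun c : Cell μ => c.1.2) = 1 := by
      rw [signedSum, Finset.sum_eq_single 1]
      · simp
      · exact fun a _ ha => absurd (Subtype.ext (hcol a.1 a.2)) ha
      · exact fun h => absurd (Finset.mem_univ _) h
    rw [youngSymmetrizer_eq, this, one_mul]
  obtain ⟨y, rfl⟩ := mem_spechtModule_iff.1 hx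
  refine ⟨∑ σ, y.coeff σ, ?_⟩
  conv_lhs => rw [eq_sum_ofPerm y]
  rw [Finset.sum_mul, Finset.sum_smul]
  refine Finset.sum_congr rfl fun σ _ => ?_
  have : ofPerm σ = ofCell μ ((columnReading μ).permCongr.symm σ) := by
    rw [ofCell_apply, Equiv.apply_symm_apply]
  rw [smul_mul_assoc, this, hp, ofCell_mul_plainSum (hrow _)]

end Specht

/-! ### Closure of the diagram families under concatenation -/

section Merge

variable {Z : Type}

/-- The equivalence relation in which the classes of `p` and `q` are merged. -/
def mergeSetoid (R : Setoid Z) (p q : Z) : Setoid Z where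
  r x y := R x y ∨ (R x p ∧ R q y) ∨ (R x q ∧ R p y)
  iseqv :=
    { refl := fun x => Or.inl (R.refl' x)
      symm := fun {x y} h => by
        rcases h with h | ⟨h₁, h₂⟩ | ⟨h₁, h₂⟩
        · exact Or.inl (R.symm' h)
        · exact Or.inr (Or.inr ⟨R.symm' h₂, R.symm' h₁⟩)
        · exact Or.inr (Or.inl ⟨R.symm' h₂, R.symm' h₁⟩)
      trans := fun {x y z} h h' => by
        rcases h with h | ⟨h₁, h₂⟩ | ⟨h₁, h₂⟩ <;> rcases h' with h' | ⟨h₁', h₂'⟩ | ⟨h₁', h₂'⟩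
        · exact Or.inl (R.trans' h h')
        · exact Or.inr (Or.inl ⟨R.trans' h h₁', h₂'⟩)
        · exact Or.inr (Or.inr ⟨R.trans' h h₁', h₂'⟩)
        · exact Or.inr (Or.inl ⟨h₁, R.trans' h₂ h'⟩)
        · exact Or.inl (R.trans' h₁ (R.trans' (R.symm' h₁') (R.trans' (R.symm' h₂) h₂')))
        · exact Or.inl (R.trans' h₁ h₂')
        · exact Or.inr (Or.inr ⟨h₁, R.trans' h₂ h'⟩)
        · exact Or.inl (R.trans' h₁ h₂')
        · exact Or.inl (R.trans' h₁ (R.trans' (R.symm' h₁') (R.trans' (R.symm' h₂) h₂'))) }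

/-- Distinct vertices of `S` in the same class have distinct signs. -/
def SignSeparated (sg : Z → Bool) (R : Setoid Z) (S : Set Z) : Prop :=
  ∀ x ∈ S, ∀ y ∈ S, R x y → sg x = sg y → x = y

/-- A class contains at most two vertices of `S`. -/
def AtMostTwo (R : Setoid Z) (S : Set Z) : Prop :=
  ∀ x ∈ S, ∀ y ∈ S, ∀ z ∈ S, R x y → R x z → x = y ∨ x = z ∨ y = z

/-- No class contains exactly one vertex of `S`. -/
def NoSingleton (R : Setoid Z) (S : Set Z) : Prop := ∀ x ∈ S, ∃ y ∈ S, y ≠ x ∧ R x y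

/-- The classes of vertices in `S` do not cross. -/
def NonCrossing (pos : Z → ℕ) (R : Setoid Z) (S : Set Z) : Prop :=
  ∀ a ∈ S, ∀ b ∈ S, ∀ a' ∈ S, ∀ b' ∈ S, pos a < pos b → pos b < pos a' → pos a' < pos b' →
    R a a' → R b b' → R a b

variable {R : Setoid Z} {S : Set Z} {p q : Z}

/-- If `x` and `y` are newly joined through `p` and `q`, then `x` is opposite to one of these and
`y` to the other. As `p` and `q` are opposite, so are `x` and `y`. -/
theorem SignSeparated.merge {sg : Z → Bool} (h : SignSeparated sg R S) (hp : p ∈ S) (hq : q ∈ S)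
    (hpq : sg p ≠ sg q) : SignSeparated sg (mergeSetoid R p q) (S \ {p, q}) := by
  rintro x ⟨hx, hx'⟩ y ⟨hy, hy'⟩ hxy hs
  simp only [Set.mem_insert_iff, Set.mem_singleton_iff, not_or] at hx' hy'
  rcases hxy with hxy | ⟨h₁, h₂⟩ | ⟨h₁, h₂⟩
  · exact h x hx y hy hxy hs
  · have a₁ : sg x ≠ sg p := fun hc => hx'.1 (h x hx p hp h₁ hc)
    have a₂ : sg q ≠ sg y := fun hc => hy'.2 (h q hq y hy h₂ hc).symm
    revert hpq hs a₁ a₂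
    cases sg x <;> cases sg y <;> cases sg p <;> cases sg q <;> simp
  · have a₁ : sg x ≠ sg q := fun hc => hx'.2 (h x hx q hq h₁ hc)
    have a₂ : sg p ≠ sg y := fun hc => hy'.1 (h p hp y hy h₂ hc).symm
    revert hpq hs a₁ a₂
    cases sg x <;> cases sg y <;> cases sg p <;> cases sg q <;> simp

/-- Besides `p` and `q`, each of the two merged classes has at most one vertex of `S`. -/
theorem AtMostTwo.merge (h : AtMostTwo R S) (hp : p ∈ S) (hq : q ∈ S) (hpq : p ≠ q) :
    AtMostTwo (mergeSetoid R p q) (S \ {p, q}) := by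
  rintro x ⟨hx, hx'⟩ y ⟨hy, hy'⟩ z ⟨hz, hz'⟩ hxy hxz
  simp only [Set.mem_insert_iff, Set.mem_singleton_iff, not_or] at hx' hy' hz'
  rcases hxy with hxy | ⟨h₁, h₂⟩ | ⟨h₁, h₂⟩ <;> rcases hxz with hxz | ⟨h₁', h₂'⟩ | ⟨h₁', h₂'⟩
  · exact h x hx y hy z hz hxy hxz
  · have := h x hx y hy p hp hxy h₁'
    grind
  · have := h x hx y hy q hq hxy h₁'
    grind
  · have := h x hx z hz p hp hxz h₁
    grind
  · have := h q hq y hy z hz h₂ h₂'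
    grind
  · have := h x hx p hp q hq h₁ h₁'
    grind
  · have := h x hx z hz q hq hxz h₁
    grind
  · have := h x hx p hp q hq h₁' h₁
    grind
  · have := h p hp y hy z hz h₂ h₂'
    grind

/-- A vertex that loses its partner `p` acquires the partner of `q`. The bound on the class sizes
guarantees that `q` is not in the class of `x` and `p`, so that this partner is a new vertex. -/
theorem NoSingleton.merge (h : NoSingleton R S) (h2 : AtMostTwo R S) (hp : p ∈ S) (hq : q ∈ S)
    (hpq : p ≠ q) : NoSingleton (mergeSetoid R p q) (S \ {p, q}) := by
  rintro x ⟨hx, hx'⟩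
  simp only [Set.mem_insert_iff, Set.mem_singleton_iff, not_or] at hx'
  have key : ∀ p' ∈ S, ∀ q' ∈ S, p' ≠ q' → x ≠ p' → x ≠ q' → R x p' →
      ∃ y ∈ S, y ≠ p' ∧ y ≠ q' ∧ y ≠ x ∧ R q' y := by
    intro p' hp' q' hq' hpq' hxp hxq hxp'
    obtain ⟨y, hy, hne, hqy⟩ := h q' hq'
    have hxq' : ¬ R x q' := fun hc => by
      have := h2 x hx p' hp' q' hq' hxp' hc
      grind
    exact ⟨y, hy, fun hc => hxq' (R.trans' hxp' (R.symm' (hc ▸ hqy))), hne,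
      fun hc => hxq' (R.symm' (hc ▸ hqy)), hqy⟩
  obtain ⟨y, hy, hyx, hxy⟩ := h x hx
  by_cases hyp : y = p
  · subst hyp
    obtain ⟨z, hz, h₁, h₂, h₃, h₄⟩ := key y hy q hq hpq hx'.1 hx'.2 hxy
    exact ⟨z, ⟨hz, by simp [h₁, h₂]⟩, h₃, Or.inr (Or.inl ⟨hxy, h₄⟩)⟩
  · by_cases hyq : y = q
    · subst hyq
      obtain ⟨z, hz, h₁, h₂, h₃, h₄⟩ := key y hy p hp hpq.symm hx'.2 hx'.1 hxy
      exact ⟨z, ⟨hz, by simp [h₁, h₂]⟩, h₃, Or.inr (Or.inr ⟨hxy, h₄⟩)⟩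
    · exact ⟨y, ⟨hy, by simp [hyp, hyq]⟩, hyx, Or.inl hxy⟩

/-- No other vertex of `S` lies between `p` and `q`, so a connection through them that crosses
another chord already crosses it on one side of the junction. -/
theorem NonCrossing.merge {pos : Z → ℕ} (h : NonCrossing pos R S) (hp : p ∈ S) (hq : q ∈ S)
    (hadj : ∀ z ∈ S, z ≠ p → z ≠ q → (pos z < pos p ∧ pos z < pos q) ∨ (pos p < pos z ∧ pos q < pos z)) :
    NonCrossing pos (mergeSetoid R p q) (S \ {p, q}) := by
  rintro a ⟨ha, ha'⟩ b ⟨hb, hb'⟩ c ⟨hc, hc'⟩ d ⟨hd, hd'⟩ hab hbc hcd hac hbd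
  simp only [Set.mem_insert_iff, Set.mem_singleton_iff, not_or] at ha' hb' hc' hd'
  have pa := hadj a ha ha'.1 ha'.2
  have pb := hadj b hb hb'.1 hb'.2
  have pc := hadj c hc hc'.1 hc'.2
  have pd := hadj d hd hd'.1 hd'.2
  -- The pair `x, y` lies either between `b` and `d` or outside. In the first case the chord from
  -- `a` to `x` crosses the one from `b` to `d`; in the second case the chord from `y` to `c` does.
  have key₁ : ∀ x ∈ S, ∀ y ∈ S, (x = p ∧ y = q ∨ x = q ∧ y = p) → R a x → R y c → R b d →
      R a b ∨ (R a x ∧ R y b) := by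
    intro x hx y hy hxy hax hyc hbd
    have px : pos b < pos x ∧ pos x < pos d ∨ pos y < pos b ∨ pos d < pos y := by
      rcases hxy with ⟨rfl, rfl⟩ | ⟨rfl, rfl⟩ <;> omega
    rcases px with px | px | px
    · exact Or.inl (h a ha b hb x hx d hd hab px.1 px.2 hax hbd)
    · exact Or.inr ⟨hax, h y hy b hb c hc d hd px hbc hcd hyc hbd⟩
    · exact Or.inr ⟨hax, R.trans' hyc (R.symm' (h b hb c hc d hd y hy hbc hcd px hbd (R.symm' hyc)))⟩
  have key₂ : ∀ x ∈ S, ∀ y ∈ S, (x = p ∧ y = q ∨ x = q ∧ y = p) → R b x → R y d → R a c →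
      R a b ∨ (R a y ∧ R x b) := by
    intro x hx y hy hxy hbx hyd hac
    have px : pos a < pos y ∧ pos y < pos c ∨ pos x < pos a ∨ pos c < pos x := by
      rcases hxy with ⟨rfl, rfl⟩ | ⟨rfl, rfl⟩ <;> omega
    rcases px with px | px | px
    · exact Or.inr ⟨h a ha y hy c hc d hd px.1 px.2 hcd hac hyd, R.symm' hbx⟩
    · exact Or.inl (R.trans' (R.symm' (h x hx a ha b hb c hc px hab hbc (R.symm' hbx) hac))
        (R.symm' hbx))
    · exact Or.inl (h a ha b hb c hc x hx hab hbc px hac hbx)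
  rcases hac with hac | ⟨h₁, h₂⟩ | ⟨h₁, h₂⟩ <;> rcases hbd with hbd | ⟨h₁', h₂'⟩ | ⟨h₁', h₂'⟩
  · exact Or.inl (h a ha b hb c hc d hd hab hbc hcd hac hbd)
  · exact (key₂ p hp q hq (Or.inl ⟨rfl, rfl⟩) h₁' h₂' hac).imp id Or.inr
  · exact (key₂ q hq p hp (Or.inr ⟨rfl, rfl⟩) h₁' h₂' hac).imp id Or.inl
  · exact (key₁ p hp q hq (Or.inl ⟨rfl, rfl⟩) h₁ h₂ hbd).imp id Or.inl
  · exact Or.inl (R.trans' h₁ (R.symm' h₁'))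
  · exact Or.inr (Or.inl ⟨h₁, R.symm' h₁'⟩)
  · exact (key₁ q hq p hp (Or.inr ⟨rfl, rfl⟩) h₁ h₂ hbd).imp id Or.inr
  · exact Or.inr (Or.inr ⟨h₁, R.symm' h₁'⟩)
  · exact Or.inl (R.trans' h₁ (R.symm' h₁'))

end Merge

/-! ### Concatenation as successive identification of the two middle rows -/

section FourRows

variable {k : ℕ}

/-- The two diagrams side by side. -/
def disjointSetoid (d e : Diagram k) : Setoid ((Fin k ⊕ Fin k) ⊕ (Fin k ⊕ Fin k)) where
  r := Sum.LiftRel d e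
  iseqv :=
    { refl := by
        rintro (x | x)
        · exact Sum.LiftRel.inl (d.refl' x)
        · exact Sum.LiftRel.inr (e.refl' x)
      symm := by
        rintro _ _ (h | h)
        · exact Sum.LiftRel.inl (d.symm' h)
        · exact Sum.LiftRel.inr (e.symm' h)
      trans := by
        rintro _ _ _ (h | h) (h' | h')
        · exact Sum.LiftRel.inl (d.trans' h h')
        · exact Sum.LiftRel.inr (e.trans' h h') }

/-- The bottom vertex `i` of the upper diagram. -/
abbrev upperMid (i : Fin k) : (Fin k ⊕ Fin k) ⊕ (Fin k ⊕ Fin k) := Sum.inl (Sum.inr i)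

/-- The top vertex `i` of the lower diagram. -/
abbrev lowerMid (i : Fin k) : (Fin k ⊕ Fin k) ⊕ (Fin k ⊕ Fin k) := Sum.inr (Sum.inl i)

/-- The first `j` vertices of the middle rows are identified. -/
def mergeFirst (d e : Diagram k) : ℕ → Setoid ((Fin k ⊕ Fin k) ⊕ (Fin k ⊕ Fin k))
  | 0 => disjointSetoid d e
  | j + 1 => if h : j < k then mergeSetoid (mergeFirst d e j) (upperMid ⟨j, h⟩) (lowerMid ⟨j, h⟩)
      else mergeFirst d e j

/-- The vertices other than the first `j` vertices of the middle rows. -/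
def remaining (k j : ℕ) : Set ((Fin k ⊕ Fin k) ⊕ (Fin k ⊕ Fin k)) :=
  {z | ∀ i : Fin k, (i : ℕ) < j → z ≠ upperMid i ∧ z ≠ lowerMid i}

/-- A condition on a relation and a set of vertices passes to the concatenation if it holds for the
diagrams side by side and survives the identification and removal of one middle pair. -/
theorem mergeFirst_induction (d e : Diagram k)
    {P : Setoid ((Fin k ⊕ Fin k) ⊕ (Fin k ⊕ Fin k)) → Set ((Fin k ⊕ Fin k) ⊕ (Fin k ⊕ Fin k)) → Prop}
    (h0 : P (disjointSetoid d e) Set.univ)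
    (hs : ∀ R, ∀ i : Fin k, P R (remaining k i) → P (mergeSetoid R (upperMid i) (lowerMid i))
      (remaining k i \ {upperMid i, lowerMid i})) : P (mergeFirst d e k) (remaining k k) := by
  have key : ∀ j ≤ k, P (mergeFirst d e j) (remaining k j) := by
    intro j
    induction j with
    | zero =>
      intro _
      have : remaining k 0 = Set.univ := by
        ext z
        simp [remaining]
      rw [this]
      exact h0
    | succ j ih =>
      intro hj
      have hr : remaining k (j + 1) = remaining k j \ {upperMid ⟨j, hj⟩, lowerMid ⟨j, hj⟩} := by
        ext z
        constructor
        · intro hz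
          refine ⟨fun i hi => hz i (by omega), ?_⟩
          have := hz ⟨j, hj⟩ (Nat.lt_succ_self j)
          simp [this]
        · rintro ⟨hz, hz'⟩ i hi
          rcases Nat.lt_succ_iff_lt_or_eq.1 hi with h | h
          · exact hz i h
          · have : i = ⟨j, hj⟩ := Fin.ext h
            subst this
            simpa using hz'
      rw [mergeFirst, dif_pos (show j < k from hj), hr]
      exact hs _ ⟨j, hj⟩ (ih (by omega))
  exact key k le_rfl

/-- The outer vertices among the vertices of four rows. -/
def outer : Fin k ⊕ Fin k → (Fin k ⊕ Fin k) ⊕ (Fin k ⊕ Fin k) := Sum.map Sum.inl Sum.inr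

theorem outer_mem (u : Fin k ⊕ Fin k) : outer u ∈ remaining k k := by
  intro i _
  rcases u with u | u <;> simp [outer]

theorem exists_outer {z : (Fin k ⊕ Fin k) ⊕ (Fin k ⊕ Fin k)} (hz : z ∈ remaining k k) :
    ∃ u, outer u = z := by
  rcases z with (z | z) | (z | z)
  · exact ⟨Sum.inl z, rfl⟩
  · exact absurd rfl (hz z z.2).1
  · exact absurd rfl (hz z z.2).2
  · exact ⟨Sum.inr z, rfl⟩

theorem outer_injective : Function.Injective (outer (k := k)) :=
  Sum.map_injective.2 ⟨Sum.inl_injective, Sum.inr_injective⟩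

theorem mergeFirst_outer (d e : Diagram k) (u v : Fin k ⊕ Fin k) :
    mergeFirst d e k (outer u) (outer v) ↔ comp d e u v := by
  let f : (Fin k ⊕ Fin k) ⊕ (Fin k ⊕ Fin k) → Fin k ⊕ (Fin k ⊕ Fin k) :=
    Sum.elim (Sum.map id Sum.inl) Sum.inr
  let g : Fin k ⊕ (Fin k ⊕ Fin k) → (Fin k ⊕ Fin k) ⊕ (Fin k ⊕ Fin k) :=
    Sum.elim (fun x => Sum.inl (Sum.inl x)) (Sum.elim upperMid fun x => Sum.inr (Sum.inr x))
  constructor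
  · intro h
    have key := mergeFirst_induction d e
      (P := fun R _ => ∀ x y, R x y → stack d e (f x) (f y)) ?_ ?_ _ _ h
    · rcases u with u | u <;> rcases v with v | v <;> exact key
    · rintro _ _ (h | h)
      · exact stack_upper h
      · exact stack_lower h
    · rintro R i hR x y (h | ⟨h₁, h₂⟩ | ⟨h₁, h₂⟩)
      · exact hR _ _ h
      · have := hR _ _ h₂
        exact (stack d e).trans' (hR _ _ h₁) this
      · have := hR _ _ h₂
        exact (stack d e).trans' (hR _ _ h₁) this
  · intro h
    have hmono : ∀ j, ∀ x y, disjointSetoid d e x y → mergeFirst d e j x y := by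
      intro j
      induction j with
      | zero => exact fun x y h => h
      | succ j ih =>
        intro x y h
        rw [mergeFirst]
        by_cases hj : j < k
        · rw [dif_pos hj]
          exact Or.inl (ih x y h)
        · rw [dif_neg hj]
          exact ih x y h
    have hmid : ∀ j, ∀ i : Fin k, (i : ℕ) < j → mergeFirst d e j (upperMid i) (lowerMid i) := by
      intro j
      induction j with
      | zero => exact fun i hi => absurd hi (Nat.not_lt_zero _)
      | succ j ih =>
        intro i hi
        rw [mergeFirst]
        rcases Nat.lt_succ_iff_lt_or_eq.1 hi with h | h
        · by_cases hj : j < k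
          · rw [dif_pos hj]
            exact Or.inl (ih i h)
          · rw [dif_neg hj]
            exact ih i h
        · subst h
          rw [dif_pos i.2]
          exact Or.inr (Or.inl ⟨Setoid.refl' _ _, Setoid.refl' _ _⟩)
    have hg : ∀ v, mergeFirst d e k (g (Sum.inr v)) (Sum.inr v) := by
      rintro (v | v)
      · exact hmid k v v.2
      · exact Setoid.refl' _ _
    have key := stack_le (d := d) (e := e) (s := (mergeFirst d e k).comap g) ?_ ?_ h
    · rcases u with u | u <;> rcases v with v | v <;> exact key
    · intro x y hxy
      have := hmono k _ _ (show disjointSetoid d e (Sum.inl x) (Sum.inl y) from Sum.LiftRel.inl hxy)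
      rcases x with x | x <;> rcases y with y | y <;> exact this
    · intro x y hxy
      have := hmono k _ _ (show disjointSetoid d e (Sum.inr x) (Sum.inr y) from Sum.LiftRel.inr hxy)
      exact (mergeFirst d e k).trans' (hg x)
        ((mergeFirst d e k).trans' this ((mergeFirst d e k).symm' (hg y)))

theorem upperMid_mem (i : Fin k) : upperMid i ∈ remaining k i := fun j hj =>
  ⟨fun h => by simp at h; omega, by simp⟩

theorem lowerMid_mem (i : Fin k) : lowerMid i ∈ remaining k i := fun j hj =>
  ⟨by simp, fun h => by simp at h; omega⟩

theorem SignSeparated.comp {d e : Diagram k} (hd : SignSeparated Sum.isLeft d Set.univ)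
    (he : SignSeparated Sum.isLeft e Set.univ) : SignSeparated Sum.isLeft (comp d e) Set.univ := by
  have key := mergeFirst_induction d e (P := SignSeparated (Sum.elim Sum.isLeft Sum.isLeft)) ?_ ?_
  · intro u _ v _ huv hs
    refine outer_injective (key _ (outer_mem u) _ (outer_mem v) ((mergeFirst_outer d e u v).2 huv) ?_)
    rcases u with u | u <;> rcases v with v | v <;> exact hs
  · rintro _ - _ - (h | h) hs
    · exact congrArg Sum.inl (hd _ trivial _ trivial h hs)
    · exact congrArg Sum.inr (he _ trivial _ trivial h hs)
  · exact fun R i h => h.merge (upperMid_mem i) (lowerMid_mem i) (by simp)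

theorem AtMostTwo.comp {d e : Diagram k} (hd : AtMostTwo d Set.univ)
    (he : AtMostTwo e Set.univ) : AtMostTwo (comp d e) Set.univ := by
  have key := mergeFirst_induction d e (P := AtMostTwo) ?_ ?_
  · intro u _ v _ w _ huv huw
    have := key _ (outer_mem u) _ (outer_mem v) _ (outer_mem w) ((mergeFirst_outer d e u v).2 huv)
      ((mergeFirst_outer d e u w).2 huw)
    simpa only [outer_injective.eq_iff] using this
  · rintro _ - _ - _ - (h | h) (h' | h')
    · simpa using hd _ trivial _ trivial _ trivial h h'
    · simpa using he _ trivial _ trivial _ trivial h h'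
  · exact fun R i h => h.merge (upperMid_mem i) (lowerMid_mem i) (by simp)

theorem NoSingleton.comp {d e : Diagram k} (hd : NoSingleton d Set.univ)
    (he : NoSingleton e Set.univ) (hd2 : AtMostTwo d Set.univ) (he2 : AtMostTwo e Set.univ) :
    NoSingleton (comp d e) Set.univ := by
  have key := mergeFirst_induction d e (P := fun R S => AtMostTwo R S ∧ NoSingleton R S) ?_ ?_
  · intro u _
    obtain ⟨z, hz, hne, huz⟩ := key.2 _ (outer_mem u)
    obtain ⟨v, rfl⟩ := exists_outer hz
    exact ⟨v, trivial, fun h => hne (by rw [h]), (mergeFirst_outer d e u v).1 huz⟩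
  · refine ⟨?_, ?_⟩
    · rintro _ - _ - _ - (h | h) (h' | h')
      · simpa using hd2 _ trivial _ trivial _ trivial h h'
      · simpa using he2 _ trivial _ trivial _ trivial h h'
    · rintro (u | u) -
      · obtain ⟨v, -, hne, h⟩ := hd u trivial
        exact ⟨Sum.inl v, trivial, by simpa using hne, Sum.LiftRel.inl h⟩
      · obtain ⟨v, -, hne, h⟩ := he u trivial
        exact ⟨Sum.inr v, trivial, by simpa using hne, Sum.LiftRel.inr h⟩
  · exact fun R i h => ⟨h.1.merge (upperMid_mem i) (lowerMid_mem i) (by simp),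
      h.2.merge h.1 (upperMid_mem i) (lowerMid_mem i) (by simp)⟩

theorem boundaryPos_inl (i : Fin k) : boundaryPos (Sum.inl i) = i := rfl

theorem boundaryPos_inr (i : Fin k) : boundaryPos (Sum.inr i) = 2 * k - 1 - i := rfl

theorem boundaryPos_lt (u : Fin k ⊕ Fin k) : boundaryPos u < 2 * k := by
  rcases u with u | u
  · rw [boundaryPos_inl]
    omega
  · rw [boundaryPos_inr]
    omega

theorem IsPlanar.comp {d e : Diagram k} (hd : IsPlanar d) (he : IsPlanar e) :
    IsPlanar (comp d e) := by
  -- The boundary of `d` is read first and that of `e` after it. The middle rows then appear as `k',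
  -- …, 1', 1, …, k`, so the pairs are identified from the inside out and the next pair is always
  -- adjacent among the remaining vertices. The outer vertices keep their boundary order.
  let pos : (Fin k ⊕ Fin k) ⊕ (Fin k ⊕ Fin k) → ℕ :=
    Sum.elim boundaryPos fun u => 2 * k + boundaryPos u
  have hl : ∀ u, pos (Sum.inl u) = boundaryPos u := fun u => rfl
  have hr : ∀ u, pos (Sum.inr u) = 2 * k + boundaryPos u := fun u => rfl
  have key := mergeFirst_induction d e (P := NonCrossing pos) ?_ ?_
  · have ho : ∀ u v : Fin k ⊕ Fin k, boundaryPos u < boundaryPos v →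
        pos (outer u) < pos (outer v) := by
      rintro (u | u) (v | v) huv <;>
        simp only [outer, Sum.map_inl, Sum.map_inr, hl, hr, boundaryPos_inl, boundaryPos_inr] at huv ⊢ <;>
        omega
    intro a b a' b' h₁ h₂ h₃ ha hb
    exact (mergeFirst_outer d e a b).1 (key _ (outer_mem a) _ (outer_mem b) _ (outer_mem a') _
      (outer_mem b') (ho _ _ h₁) (ho _ _ h₂) (ho _ _ h₃) ((mergeFirst_outer d e _ _).2 ha)
      ((mergeFirst_outer d e _ _).2 hb))
  · rintro _ - _ - _ - _ - h₁ h₂ h₃ (@⟨a, a', ha⟩ | @⟨a, a', ha⟩) (@⟨b, b', hb⟩ | @⟨b, b', hb⟩)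
    · exact Sum.LiftRel.inl (hd _ _ _ _ h₁ h₂ h₃ ha hb)
    · have := boundaryPos_lt a'
      simp only [hl, hr] at h₂
      omega
    · have := boundaryPos_lt b
      simp only [hl, hr] at h₁
      omega
    · simp only [hr, add_lt_add_iff_left] at h₁ h₂ h₃
      exact Sum.LiftRel.inr (he _ _ _ _ h₁ h₂ h₃ ha hb)
  · refine fun R i h => h.merge (upperMid_mem i) (lowerMid_mem i) ?_
    rintro ((z | z) | (z | z)) hz hz₁ hz₂ <;> simp only [hl, hr, boundaryPos_inl, boundaryPos_inr]
    · omega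
    · have h1 : z ≠ i := fun h => hz₁ (by rw [h])
      have h2 : ¬ (z : ℕ) < i := fun h => (hz z h).1 rfl
      have : (z : ℕ) ≠ i := fun h => h1 (Fin.ext h)
      omega
    · have h1 : z ≠ i := fun h => hz₂ (by rw [h])
      have h2 : ¬ (z : ℕ) < i := fun h => (hz z h).2 rfl
      have : (z : ℕ) ≠ i := fun h => h1 (Fin.ext h)
      omega
    · omega

end FourRows

/-! ### The families in terms of relations -/

section Families

variable {k : ℕ}

open Classical in
theorem topCount_add_bottomCount (d : Diagram k) (v : Fin k ⊕ Fin k) :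
    topCount d v + bottomCount d v = (Finset.univ.filter fun z => d v z).card := by
  simp only [topCount, bottomCount, Finset.card_filter, Fintype.sum_sum_type]

theorem topCount_add_bottomCount_pos (d : Diagram k) (v : Fin k ⊕ Fin k) :
    0 < topCount d v + bottomCount d v := by
  classical
  rw [topCount_add_bottomCount]
  exact Finset.card_pos.2 ⟨v, by simp⟩

theorem signSeparated_iff (d : Diagram k) : SignSeparated Sum.isLeft d Set.univ ↔
    ∀ v, topCount d v ≤ 1 ∧ bottomCount d v ≤ 1 := by
  classical
  simp only [topCount, bottomCount, Finset.card_le_one, Finset.mem_filter, Finset.mem_univ, true_and]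
  constructor
  · refine fun h v => ⟨fun a ha b hb => ?_, fun a ha b hb => ?_⟩
    · exact Sum.inl_injective (h _ trivial _ trivial (d.trans' (d.symm' ha) hb) rfl)
    · exact Sum.inr_injective (h _ trivial _ trivial (d.trans' (d.symm' ha) hb) rfl)
  · rintro h (a | a) - (b | b) - hab hs
    · rw [(h (Sum.inl a)).1 a (d.refl' _) b hab]
    · exact absurd hs (by simp)
    · exact absurd hs (by simp)
    · rw [(h (Sum.inr a)).2 a (d.refl' _) b hab]

theorem atMostTwo_iff (d : Diagram k) : AtMostTwo d Set.univ ↔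
    ∀ v, topCount d v + bottomCount d v = 1 ∨ topCount d v + bottomCount d v = 2 := by
  classical
  have h1 : (∀ v, topCount d v + bottomCount d v = 1 ∨ topCount d v + bottomCount d v = 2) ↔
      ∀ v, ¬ 2 < (Finset.univ.filter fun z => d v z).card := by
    refine forall_congr' fun v => ?_
    rw [← topCount_add_bottomCount]
    have := topCount_add_bottomCount_pos d v
    omega
  rw [h1]
  simp only [Finset.two_lt_card, Finset.mem_filter, Finset.mem_univ, true_and]
  constructor
  · rintro h v ⟨a, ha, b, hb, c, hc, hab, hac, hbc⟩
    have := h a trivial b trivial c trivial (d.trans' (d.symm' ha) hb) (d.trans' (d.symm' ha) hc)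
    grind
  · intro h x _ y _ z _ hxy hxz
    by_contra hc
    push Not at hc
    exact h x ⟨x, d.refl' x, y, hxy, z, hxz, hc.1, hc.2.1, hc.2.2⟩

theorem atMostTwo_noSingleton_iff (d : Diagram k) :
    AtMostTwo d Set.univ ∧ NoSingleton d Set.univ ↔ ∀ v, topCount d v + bottomCount d v = 2 := by
  classical
  have h1 : NoSingleton d Set.univ ↔ ∀ v, 1 < topCount d v + bottomCount d v := by
    simp only [topCount_add_bottomCount, Finset.one_lt_card, Finset.mem_filter, Finset.mem_univ,
      true_and]
    constructor
    · intro h v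
      obtain ⟨y, -, hy, hvy⟩ := h v trivial
      exact ⟨v, d.refl' v, y, hvy, hy.symm⟩
    · intro h v _
      obtain ⟨a, ha, b, hb, hab⟩ := h v
      by_cases hav : a = v
      · exact ⟨b, trivial, fun hbv => hab (hav.trans hbv.symm), hb⟩
      · exact ⟨a, trivial, hav, ha⟩
  rw [atMostTwo_iff, h1, ← forall_and]
  refine forall_congr' fun v => ?_
  omega

theorem symmetric_iff (d : Diagram k) : (∀ v, topCount d v = 1 ∧ bottomCount d v = 1) ↔
    SignSeparated Sum.isLeft d Set.univ ∧ AtMostTwo d Set.univ ∧ NoSingleton d Set.univ := by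
  rw [signSeparated_iff, atMostTwo_noSingleton_iff, ← forall_and]
  refine forall_congr' fun v => ?_
  omega

/-- The conditions on the sizes of the blocks of the diagrams in a family. -/
def DiagramFamily.SizeCondition (X : DiagramFamily) (d : Diagram k) : Prop :=
  match X with
  | .partition | .planarPartition => True
  | .symmetric | .identity =>
      SignSeparated Sum.isLeft d Set.univ ∧ AtMostTwo d Set.univ ∧ NoSingleton d Set.univ
  | .rook | .planarRook => SignSeparated Sum.isLeft d Set.univ
  | .brauer | .temperleyLieb => AtMostTwo d Set.univ ∧ NoSingleton d Set.univ
  | .rookBrauer | .motzkin => AtMostTwo d Set.univ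

/-- The planar families. -/
def DiagramFamily.Planar (X : DiagramFamily) : Prop :=
  match X with
  | .partition | .symmetric | .rook | .brauer | .rookBrauer => False
  | .planarPartition | .identity | .temperleyLieb | .planarRook | .motzkin => True

/-- This rewrites the vertex counts as relational conditions, the form in which they survive
merging, and separates them from planarity. -/
theorem DiagramFamily.mem_iff (X : DiagramFamily) (d : Diagram k) :
    X.Mem d ↔ X.SizeCondition d ∧ (X.Planar → IsPlanar d) := by
  cases X <;> simp only [DiagramFamily.Mem, DiagramFamily.SizeCondition, DiagramFamily.Planar,
    symmetric_iff, ← signSeparated_iff, ← atMostTwo_iff, ← atMostTwo_noSingleton_iff, and_true,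
    true_and, forall_const, false_imp_iff]

theorem DiagramFamily.Mem.comp {X : DiagramFamily} {d e : Diagram k} (hd : X.Mem d)
    (he : X.Mem e) : X.Mem (comp d e) := by
  rw [DiagramFamily.mem_iff] at hd he ⊢
  refine ⟨?_, fun h => (hd.2 h).comp (he.2 h)⟩
  have hd := hd.1
  have he := he.1
  cases X <;> simp only [DiagramFamily.SizeCondition] at hd he ⊢
  all_goals first
    | exact ⟨hd.1.comp he.1, hd.2.1.comp he.2.1, hd.2.2.comp he.2.2 hd.2.1 he.2.1⟩
    | exact ⟨hd.1.comp he.1, hd.2.comp he.2 hd.1 he.1⟩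
    | exact SignSeparated.comp hd he
    | exact AtMostTwo.comp hd he

theorem DiagramFamily.Mem.transpose {X : DiagramFamily} {d : Diagram k} (hd : X.Mem d) :
    X.Mem (transpose d) := by
  rw [DiagramFamily.mem_iff] at hd ⊢
  have h1 : SignSeparated Sum.isLeft d Set.univ →
      SignSeparated Sum.isLeft (DiagramAlgebras.transpose d) Set.univ := by
    intro h x _ y _ hxy hs
    refine Sum.swap_leftInverse.injective (h _ trivial _ trivial hxy ?_)
    rw [Sum.isLeft_swap, Sum.isLeft_swap]
    rcases x with x | x <;> rcases y with y | y <;> simp at hs ⊢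
  have h2 : AtMostTwo d Set.univ → AtMostTwo (DiagramAlgebras.transpose d) Set.univ := by
    intro h x _ y _ z _ hxy hxz
    simpa only [Sum.swap_leftInverse.injective.eq_iff] using
      h _ trivial _ trivial _ trivial hxy hxz
  have h3 : NoSingleton d Set.univ → NoSingleton (DiagramAlgebras.transpose d) Set.univ := by
    intro h x _
    obtain ⟨y, -, hne, hxy⟩ := h x.swap trivial
    refine ⟨y.swap, trivial, fun hc => hne (by rw [← hc, Sum.swap_swap]), ?_⟩
    rw [transpose_apply, Sum.swap_swap]
    exact hxy
  refine ⟨?_, fun hX a b a' b' hab hba hab' ha hb => ?_⟩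
  · have hd := hd.1
    cases X <;> simp only [DiagramFamily.SizeCondition] at hd ⊢
    all_goals first
      | exact ⟨h1 hd.1, h2 hd.2.1, h3 hd.2.2⟩
      | exact ⟨h2 hd.1, h3 hd.2⟩
      | exact h1 hd
      | exact h2 hd
  -- Reflection reverses the traversal of the boundary, so the four vertices are read backwards.
  · have hpos : ∀ u v : Fin k ⊕ Fin k, boundaryPos u < boundaryPos v →
        boundaryPos v.swap < boundaryPos u.swap := by
      rintro (u | u) (v | v) huv <;>
        simp only [Sum.swap_inl, Sum.swap_inr, boundaryPos_inl, boundaryPos_inr] at huv ⊢ <;> omega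
    have h := hd.2 hX b'.swap a'.swap b.swap a.swap (hpos _ _ hab') (hpos _ _ hba) (hpos _ _ hab)
      (d.symm' hb) (d.symm' ha)
    exact d.trans' ha (d.trans' (d.symm' h) (d.symm' hb))

theorem DiagramFamily.mem_id (X : DiagramFamily) : X.Mem (idDiagram (Fin k)) := by
  rw [DiagramFamily.mem_iff]
  have hid : ∀ u v, idDiagram (Fin k) u v ↔ Sum.elim id id u = Sum.elim id id v := fun _ _ => Iff.rfl
  have h1 : SignSeparated Sum.isLeft (idDiagram (Fin k)) Set.univ := by
    rintro (x | x) - (y | y) - hxy hs <;> simp [hid] at hxy hs ⊢ <;> exact hxy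
  have h2 : AtMostTwo (idDiagram (Fin k)) Set.univ := by
    rintro (x | x) - (y | y) - (z | z) - hxy hxz <;> simp [hid] at hxy hxz ⊢ <;> grind
  have h3 : NoSingleton (idDiagram (Fin k)) Set.univ := by
    intro x _
    exact ⟨x.swap, trivial, by rcases x with x | x <;> simp, by rcases x with x | x <;> rfl⟩
  refine ⟨?_, fun _ => ?_⟩
  · cases X <;> simp only [DiagramFamily.SizeCondition]
    all_goals first
      | exact ⟨h1, h2, h3⟩
      | exact ⟨h2, h3⟩
      | exact h1
      | exact h2
  · rintro (a | a) (b | b) (a' | a') (b' | b') h₁ h₂ h₃ ha hb <;>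
      simp only [hid, boundaryPos_inl, boundaryPos_inr, Sum.elim_inl, Sum.elim_inr, id] at * <;>
      (have := congrArg Fin.val ha; have := congrArg Fin.val hb; omega)

theorem DiagramFamily.Mem.conj {X : DiagramFamily} {d w : Diagram k} (hd : X.Mem d)
    (hw : X.Mem w) : X.Mem (conj d w) :=
  (hd.comp hw).comp hd.transpose

end Families

/-! ### Diagrams with prescribed upper and lower halves -/

section Join

variable {α β L : Type}

open Classical in
/-- The label of a top vertex of a full diagram. -/
noncomputable def fullLabel (g : BiDiagram α L) (x : α) : L ⊕ Quotient g :=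
  if h : ∃ i, g (Sum.inl x) (Sum.inr i) then Sum.inl h.choose else Sum.inr (Quotient.mk g (Sum.inl x))

theorem IsFull.fullLabel_eq {g : BiDiagram α L} (hg : IsFull g) {x : α} {i : L}
    (h : g (Sum.inl x) (Sum.inr i)) : fullLabel g x = Sum.inl i := by
  have hx : ∃ i, g (Sum.inl x) (Sum.inr i) := ⟨i, h⟩
  rw [fullLabel, dif_pos hx, hg.2 _ _ (g.trans' (g.symm' hx.choose_spec) h)]

theorem IsFull.fullLabel_congr {g : BiDiagram α L} (hg : IsFull g) {x y : α}
    (h : g (Sum.inl x) (Sum.inl y)) : fullLabel g x = fullLabel g y := by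
  by_cases hx : ∃ i, g (Sum.inl x) (Sum.inr i)
  · obtain ⟨i, hi⟩ := hx
    rw [hg.fullLabel_eq hi, hg.fullLabel_eq (g.trans' (g.symm' h) hi)]
  · have hy : ¬ ∃ i, g (Sum.inl y) (Sum.inr i) := fun ⟨i, hi⟩ => hx ⟨i, g.trans' h hi⟩
    rw [fullLabel, fullLabel, dif_neg hx, dif_neg hy]
    exact congrArg Sum.inr (Quotient.sound h)

theorem fullLabel_inl {g : BiDiagram α L} {x : α} {i : L} (h : fullLabel g x = Sum.inl i) :
    g (Sum.inl x) (Sum.inr i) := by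
  rw [fullLabel] at h
  split_ifs at h with hx
  rw [← Sum.inl_injective h]
  exact hx.choose_spec

theorem fullLabel_rel {g : BiDiagram α L} {x y : α} (h : fullLabel g x = fullLabel g y) :
    g (Sum.inl x) (Sum.inl y) := by
  rcases hy : fullLabel g y with i | q
  · rw [hy] at h
    exact g.trans' (fullLabel_inl h) (g.symm' (fullLabel_inl hy))
  · rw [fullLabel, fullLabel] at h
    rw [fullLabel] at hy
    split_ifs at h hy with hx
    exact Quotient.exact (Sum.inr_injective h)

/-- The blocks of the diagram with upper half `g` and lower half `h`. -/
theorem IsFull.comp_transpose_label {g : BiDiagram α L} {h : BiDiagram β L} (hg : IsFull g)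
    (hh : IsFull h) {u v : α ⊕ β} (huv : comp g (transpose h) u v) :
    Sum.elim (fun x => (fullLabel g x).map id Sum.inl) (fun y => (fullLabel h y).map id Sum.inr) u =
      Sum.elim (fun x => (fullLabel g x).map id Sum.inl)
        (fun y => (fullLabel h y).map id (Sum.inr (α := Quotient g))) v := by
  have key := stack_induction (d := g) (e := transpose h) (Sum.elim
    (fun x => (fullLabel g x).map id Sum.inl)
    (Sum.elim Sum.inl (fun y => (fullLabel h y).map id (Sum.inr (α := Quotient g))))) ?_ ?_ huv
  · rcases u with u | u <;> rcases v with v | v <;> exact key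
  · rintro (x | i) (y | j) hxy
    · simp [hg.fullLabel_congr hxy]
    · simp [hg.fullLabel_eq hxy]
    · simp [hg.fullLabel_eq (g.symm' hxy)]
    · simp [hg.2 _ _ hxy]
  · rintro (i | x) (j | y) hxy
    · simp [hh.2 _ _ hxy]
    · simp [hh.fullLabel_eq (h.symm' hxy)]
    · simp [hh.fullLabel_eq hxy]
    · simp [hh.fullLabel_congr hxy]

theorem IsFull.comp_transpose_inl_inl {g : BiDiagram α L} {h : BiDiagram β L} (hg : IsFull g)
    (hh : IsFull h) {x y : α} :
    comp g (transpose h) (Sum.inl x) (Sum.inl y) ↔ g (Sum.inl x) (Sum.inl y) := by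
  refine ⟨fun hxy => fullLabel_rel ?_, fun hxy => stack_upper hxy⟩
  exact Sum.map_injective.2 ⟨Function.injective_id, Sum.inl_injective⟩
    (hg.comp_transpose_label hh hxy)

theorem IsFull.comp_transpose_inr_inr {g : BiDiagram α L} {h : BiDiagram β L} (hg : IsFull g)
    (hh : IsFull h) {x y : β} :
    comp g (transpose h) (Sum.inr x) (Sum.inr y) ↔ h (Sum.inl x) (Sum.inl y) := by
  refine ⟨fun hxy => fullLabel_rel ?_, fun hxy => stack_lower hxy⟩
  exact Sum.map_injective.2 ⟨Function.injective_id, Sum.inr_injective⟩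
    (hg.comp_transpose_label hh hxy)

theorem IsFull.comp_transpose_inl_inr {g : BiDiagram α L} {h : BiDiagram β L} (hg : IsFull g)
    (hh : IsFull h) {x : α} {y : β} : comp g (transpose h) (Sum.inl x) (Sum.inr y) ↔
      ∃ i, g (Sum.inl x) (Sum.inr i) ∧ h (Sum.inl y) (Sum.inr i) := by
  constructor
  · intro hxy
    have key := hg.comp_transpose_label hh hxy
    simp only [Sum.elim_inl, Sum.elim_inr] at key
    rcases hx : fullLabel g x with i | q <;> rcases hy : fullLabel h y with j | q' <;>
      rw [hx, hy] at key <;> simp at key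
    subst key
    exact ⟨i, fullLabel_inl hx, fullLabel_inl hy⟩
  · rintro ⟨i, hx, hy⟩
    have h1 : transpose h (Sum.inl i) (Sum.inr y) := h.symm' hy
    exact (stack g (transpose h)).trans' (stack_upper hx) (stack_lower h1)

end Join

/-! ### Joining the upper half of one symmetric diagram to the lower half of another -/

section JoinMem

variable {k m : ℕ}

/-- The diagram with the upper half of `w₁` and the lower half of `w₀`, in which the propagating
blocks are connected as prescribed by `τ` and `σ`. -/
noncomputable def join (w₁ w₀ : Diagram k) (τ σ : Equiv.Perm (Fin m)) : Diagram k :=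
  comp (half w₁ τ) (transpose (half w₀ σ))

theorem transpose_join (w₁ w₀ : Diagram k) (τ σ : Equiv.Perm (Fin m)) :
    transpose (join w₁ w₀ τ σ) = join w₀ w₁ σ τ := by
  rw [join, transpose_comp, transpose_transpose, join]

variable {w₁ w₀ : Diagram k} {τ σ : Equiv.Perm (Fin m)}

theorem join_inl_inl (h₁ : rank w₁ = m) (h₀ : rank w₀ = m) {x y : Fin k} :
    join w₁ w₀ τ σ (Sum.inl x) (Sum.inl y) ↔ w₁ (Sum.inl x) (Sum.inl y) := by
  rw [join, (isFull_half h₁ τ).comp_transpose_inl_inl (isFull_half h₀ σ), half_inl_inl]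

theorem join_inr_inr (h₁ : rank w₁ = m) (h₀ : rank w₀ = m) {x y : Fin k} :
    join w₁ w₀ τ σ (Sum.inr x) (Sum.inr y) ↔ w₀ (Sum.inl x) (Sum.inl y) := by
  rw [join, (isFull_half h₁ τ).comp_transpose_inr_inr (isFull_half h₀ σ), half_inl_inl]

theorem join_inl_inr (h₁ : rank w₁ = m) (h₀ : rank w₀ = m) {x y : Fin k} :
    join w₁ w₀ τ σ (Sum.inl x) (Sum.inr y) ↔ ∃ i, (Propagates w₁ x ∧ blockIndex w₁ x = τ i) ∧
      Propagates w₀ y ∧ blockIndex w₀ y = σ i := by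
  rw [join, (isFull_half h₁ τ).comp_transpose_inl_inr (isFull_half h₀ σ)]
  simp only [half_inl_inr]

theorem join_self_inl_inr (h₁ : rank w₁ = m) (h₀ : rank w₀ = m) {x y : Fin k} :
    join w₁ w₀ σ σ (Sum.inl x) (Sum.inr y) ↔
      Propagates w₁ x ∧ Propagates w₀ y ∧ blockIndex w₁ x = blockIndex w₀ y := by
  rw [join_inl_inr h₁ h₀]
  constructor
  · rintro ⟨i, ⟨hx, hi⟩, hy, hi'⟩
    exact ⟨hx, hy, hi.trans hi'.symm⟩
  · rintro ⟨hx, hy, h⟩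
    have hlt : blockIndex w₁ x < m := h₁ ▸ blockIndex_lt hx
    exact ⟨σ.symm ⟨_, hlt⟩, ⟨hx, by simp⟩, hy, by simp [h]⟩

/-- A propagating block already contains a vertex and its mirror image, which leaves no room for a
second top vertex. -/
theorem IsSymmetricDiagram.eq_of_propagates {w : Diagram k} (hw : IsSymmetricDiagram m w)
    (h2 : AtMostTwo w Set.univ) {x y : Fin k} (hx : Propagates w x)
    (hxy : w (Sum.inl x) (Sum.inl y)) : x = y := by
  have := h2 _ trivial _ trivial _ trivial (hw.2.2 x hx) hxy
  simpa using this

theorem AtMostTwo.join (h₁ : IsSymmetricDiagram m w₁) (h₀ : IsSymmetricDiagram m w₀)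
    (a₁ : AtMostTwo w₁ Set.univ) (a₀ : AtMostTwo w₀ Set.univ) :
    AtMostTwo (join w₁ w₀ τ σ) Set.univ := by
  have key : ∀ {w₁ w₀ : Diagram k} {τ σ : Equiv.Perm (Fin m)}, IsSymmetricDiagram m w₁ →
      IsSymmetricDiagram m w₀ → AtMostTwo w₁ Set.univ → AtMostTwo w₀ Set.univ → ∀ x y z,
      DiagramAlgebras.join w₁ w₀ τ σ (Sum.inl x) y → DiagramAlgebras.join w₁ w₀ τ σ (Sum.inl x) z →
        Sum.inl x = y ∨ Sum.inl x = z ∨ y = z := by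
    intro w₁ w₀ τ σ h₁ h₀ a₁ a₀ x y z hxy hxz
    rcases y with y | y <;> rcases z with z | z
    · rw [join_inl_inl h₁.2.1 h₀.2.1] at hxy hxz
      exact a₁ _ trivial _ trivial _ trivial hxy hxz
    · rw [join_inl_inl h₁.2.1 h₀.2.1] at hxy
      rw [join_inl_inr h₁.2.1 h₀.2.1] at hxz
      obtain ⟨i, ⟨hx, -⟩, -⟩ := hxz
      exact Or.inl (congrArg Sum.inl (h₁.eq_of_propagates a₁ hx hxy))
    · rw [join_inl_inl h₁.2.1 h₀.2.1] at hxz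
      rw [join_inl_inr h₁.2.1 h₀.2.1] at hxy
      obtain ⟨i, ⟨hx, -⟩, -⟩ := hxy
      exact Or.inr (Or.inl (congrArg Sum.inl (h₁.eq_of_propagates a₁ hx hxz)))
    · have hyz := Setoid.trans' _ (Setoid.symm' _ hxy) hxz
      rw [join_inr_inr h₁.2.1 h₀.2.1] at hyz
      rw [join_inl_inr h₁.2.1 h₀.2.1] at hxy
      obtain ⟨i, -, hy, -⟩ := hxy
      exact Or.inr (Or.inr (congrArg Sum.inr (h₀.eq_of_propagates a₀ hy hyz)))
  rintro (x | x) - y - z - hxy hxz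
  · exact key h₁ h₀ a₁ a₀ x y z hxy hxz
  · have htr : ∀ v, DiagramAlgebras.join w₁ w₀ τ σ (Sum.inr x) v →
        DiagramAlgebras.join w₀ w₁ σ τ (Sum.inl x) v.swap := by
      intro v hv
      rw [← transpose_join, transpose_apply, Sum.swap_swap]
      exact hv
    have := key h₀ h₁ a₀ a₁ x y.swap z.swap (htr _ hxy) (htr _ hxz)
    rw [← Sum.swap_inr] at this
    simpa only [Sum.swap_leftInverse.injective.eq_iff] using this

theorem NoSingleton.join (h₁ : IsSymmetricDiagram m w₁) (h₀ : IsSymmetricDiagram m w₀)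
    (a₁ : NoSingleton w₁ Set.univ) (a₀ : NoSingleton w₀ Set.univ) :
    NoSingleton (join w₁ w₀ τ σ) Set.univ := by
  have key : ∀ {w₁ w₀ : Diagram k} {τ σ : Equiv.Perm (Fin m)}, IsSymmetricDiagram m w₁ →
      IsSymmetricDiagram m w₀ → NoSingleton w₁ Set.univ → ∀ x,
      ∃ y, y ≠ Sum.inl x ∧ DiagramAlgebras.join w₁ w₀ τ σ (Sum.inl x) y := by
    intro w₁ w₀ τ σ h₁ h₀ a₁ x
    by_cases hx : Propagates w₁ x
    · have hlt : blockIndex w₁ x < m := h₁.2.1 ▸ blockIndex_lt hx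
      obtain ⟨y, hy, hyi⟩ := exists_blockIndex (w := w₀) (i := σ (τ.symm ⟨_, hlt⟩))
        (by rw [h₀.2.1]; exact Fin.is_lt _)
      refine ⟨Sum.inr y, by simp, ?_⟩
      rw [join_inl_inr h₁.2.1 h₀.2.1]
      exact ⟨τ.symm ⟨_, hlt⟩, ⟨hx, by simp⟩, hy, hyi⟩
    · obtain ⟨y | y, -, hne, hy⟩ := a₁ (Sum.inl x) trivial
      · exact ⟨Sum.inl y, hne, (join_inl_inl h₁.2.1 h₀.2.1).2 hy⟩
      · exact absurd ⟨y, hy⟩ hx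
  rintro (x | x) -
  · obtain ⟨y, hy⟩ := key (τ := τ) (σ := σ) h₁ h₀ a₁ x
    exact ⟨y, trivial, hy⟩
  · obtain ⟨y, hne, hy⟩ := key (τ := σ) (σ := τ) h₀ h₁ a₀ x
    refine ⟨y.swap, trivial, fun h => hne ?_, ?_⟩
    · rw [← Sum.swap_swap y, h]
      rfl
    · rw [← transpose_join] at hy
      exact hy

theorem SignSeparated.join (h₁ : IsSymmetricDiagram m w₁) (h₀ : IsSymmetricDiagram m w₀)
    (a₁ : SignSeparated Sum.isLeft w₁ Set.univ) (a₀ : SignSeparated Sum.isLeft w₀ Set.univ) :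
    SignSeparated Sum.isLeft (join w₁ w₀ τ σ) Set.univ := by
  rintro (x | x) - (y | y) - hxy hs
  · exact a₁ _ trivial _ trivial ((join_inl_inl h₁.2.1 h₀.2.1).1 hxy) rfl
  · exact absurd hs (by simp)
  · exact absurd hs (by simp)
  · rw [Sum.inl_injective (a₀ _ trivial _ trivial ((join_inr_inr h₁.2.1 h₀.2.1).1 hxy) rfl)]

/-- A propagating block starting under the arc from `a` to `c` would have to cross it. -/
theorem IsPlanar.rel_of_between {w : Diagram k} (hw : IsPlanar w) {a b c : Fin k} (hab : a < b)
    (hbc : b < c) (hac : w (Sum.inl a) (Sum.inl c)) (hb : Propagates w b) :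
    w (Sum.inl a) (Sum.inl b) := by
  obtain ⟨b', hb'⟩ := hb
  refine hw _ _ _ _ ?_ ?_ ?_ hac hb' <;> simp only [boundaryPos_inl, boundaryPos_inr] <;> omega

/-- Propagating blocks of a planar diagram are not nested, so ordering them by maximal entries is
ordering them from left to right. -/
theorem IsPlanar.blockIndex_le {w : Diagram k} (hw : IsPlanar w) {a b : Fin k} (hab : a ≤ b)
    (ha : Propagates w a) (hb : Propagates w b) : blockIndex w a ≤ blockIndex w b := by
  by_contra hc
  push Not at hc
  obtain ⟨a', ha', haa⟩ := exists_propMaxima ha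
  obtain ⟨b', hb', hbb⟩ := exists_propMaxima hb
  rw [blockIndex_lt_blockIndex hb' ha' hbb haa] at hc
  have hle : b ≤ b' := (mem_propMaxima.1 hb').2 _ (w.symm' hbb)
  have hne : a ≠ b := by
    rintro rfl
    rw [propMaxima_eq ha' hb' (w.trans' (w.symm' haa) hbb)] at hc
    exact lt_irrefl _ hc
  have := hw.rel_of_between (lt_of_le_of_ne hab hne) (hle.trans_lt hc) haa hb
  rw [propMaxima_eq ha' hb' (w.trans' (w.symm' haa) (w.trans' this hbb))] at hc
  exact lt_irrefl _ hc

/-- With equal numberings the `i`-th propagating block of `w₁` is joined to the `i`-th one of `w₀`.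
Both orders run from left to right, so no crossing is created. -/
theorem IsPlanar.join (h₁ : IsSymmetricDiagram m w₁) (h₀ : IsSymmetricDiagram m w₀)
    (a₁ : IsPlanar w₁) (a₀ : IsPlanar w₀) : IsPlanar (join w₁ w₀ σ σ) := by
  have hll : ∀ {x y}, DiagramAlgebras.join w₁ w₀ σ σ (Sum.inl x) (Sum.inl y) ↔
      w₁ (Sum.inl x) (Sum.inl y) := join_inl_inl h₁.2.1 h₀.2.1
  have hrr : ∀ {x y}, DiagramAlgebras.join w₁ w₀ σ σ (Sum.inr x) (Sum.inr y) ↔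
      w₀ (Sum.inl x) (Sum.inl y) := join_inr_inr h₁.2.1 h₀.2.1
  have hlr : ∀ {x y}, DiagramAlgebras.join w₁ w₀ σ σ (Sum.inl x) (Sum.inr y) ↔
      Propagates w₁ x ∧ Propagates w₀ y ∧ blockIndex w₁ x = blockIndex w₀ y :=
    join_self_inl_inr h₁.2.1 h₀.2.1
  rintro (a | a) (b | b) (a' | a') (b' | b') hab hba hab' ha hb <;>
    simp only [boundaryPos_inl, boundaryPos_inr] at hab hba hab' <;> try omega
  · rw [hll] at ha hb ⊢
    refine a₁ (Sum.inl a) (Sum.inl b) (Sum.inl a') (Sum.inl b') ?_ ?_ ?_ ha hb <;>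
      rwa [boundaryPos_inl, boundaryPos_inl]
  · rw [hll] at ha ⊢
    exact a₁.rel_of_between hab hba ha (hlr.1 hb).1
  · rw [hlr] at ha hb
    rw [hll]
    have h1 := a₁.blockIndex_le (a := a) (b := b) (le_of_lt hab) ha.1 hb.1
    have h2 := a₀.blockIndex_le (a := b') (b := a') (by rw [Fin.le_def]; omega) hb.2.1 ha.2.1
    exact (blockIndex_inj ha.1 hb.1).1 (by omega)
  · rw [hrr] at hb
    refine Setoid.trans' _ ha (hrr.2 ?_)
    have h1 := a₀.rel_of_between (a := b') (b := a') (c := b) (by rw [Fin.lt_def]; omega)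
      (by rw [Fin.lt_def]; omega) (w₀.symm' hb) (hlr.1 ha).2.1
    exact w₀.symm' (w₀.trans' hb h1)
  · rw [hrr] at ha hb ⊢
    have h1 : w₀ (Sum.inl b') (Sum.inl a') := by
      refine a₀ _ _ _ _ ?_ ?_ ?_ (w₀.symm' hb) (w₀.symm' ha) <;> simp only [boundaryPos_inl] <;> omega
    exact w₀.trans' ha (w₀.trans' (w₀.symm' h1) (w₀.symm' hb))

theorem DiagramFamily.Mem.join {X : DiagramFamily} (h₁ : IsSymmetricDiagram m w₁)
    (h₀ : IsSymmetricDiagram m w₀) (m₁ : X.Mem w₁) (m₀ : X.Mem w₀) (hX : X.Planar → τ = σ) :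
    X.Mem (join w₁ w₀ τ σ) := by
  rw [DiagramFamily.mem_iff] at m₁ m₀ ⊢
  refine ⟨?_, fun h => ?_⟩
  · have m₁ := m₁.1
    have m₀ := m₀.1
    cases X <;> simp only [DiagramFamily.SizeCondition] at m₁ m₀ ⊢
    all_goals first
      | exact ⟨m₁.1.join h₁ h₀ m₀.1, m₁.2.1.join h₁ h₀ m₀.2.1, m₁.2.2.join h₁ h₀ m₀.2.2⟩
      | exact ⟨m₁.1.join h₁ h₀ m₀.1, m₁.2.join h₁ h₀ m₀.2⟩
      | exact SignSeparated.join h₁ h₀ m₁ m₀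
      | exact AtMostTwo.join h₁ h₀ m₁ m₀
  · rw [hX h]
    exact (m₁.2 h).join h₁ h₀ (m₀.2 h)

/-- Multiplication by a joining diagram moves to the upper half. -/
theorem conj_join {w : Diagram k} (h₁ : IsSymmetricDiagram m w₁) (hw : IsSymmetricDiagram m w)
    (h : rank (conj (join w₁ w₀ τ σ) w) = m) : conj (join w₁ w₀ τ σ) w = w₁ := by
  have hfull := (isFull_comp_half hw 1).2 h
  have hassoc : comp (join w₁ w₀ τ σ) (half w (1 : Equiv.Perm (Fin m))) =
      comp (half w₁ τ) (comp (transpose (half w₀ σ)) (half w 1)) :=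
    (comp_assoc_and_removed _ _ _).1
  rw [hassoc] at hfull
  rw [conj_eq hw 1, hassoc, comp_perm_conj hfull, comp_half_transpose h₁]

end JoinMem

/-! ### The index sets are non-empty -/

section Model

variable {k m : ℕ}

/-- The block of a vertex in a model diagram: the first `m` vertices are alone in their row, the
others are paired if `b` holds and are singletons otherwise. -/
def modelMap (m : ℕ) (b : Bool) (x : ℕ) : ℕ :=
  if x < m then x else if b then m + (x - m) / 2 else x

/-- A model half diagram. -/
def modelHalf (k m : ℕ) (b : Bool) : BiDiagram (Fin k) (Fin m) :=
  Setoid.ker (Sum.elim (fun x => modelMap m b x) fun i => (i : ℕ))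

theorem isFull_modelHalf (h : m ≤ k) (b : Bool) : IsFull (modelHalf k m b) := by
  refine ⟨fun i => ⟨⟨i, by omega⟩, ?_⟩, fun i j hij => Fin.ext hij⟩
  change modelMap m b i = i
  simp [modelMap]

theorem modelHalf_apply (b : Bool) (u v : Fin k ⊕ Fin k) :
    comp (modelHalf k m b) (transpose (modelHalf k m b)) u v ↔
      modelMap m b (Sum.elim id id u : Fin k) = modelMap m b (Sum.elim id id v : Fin k) ∧
        (u.isLeft = v.isLeft ∨ ((Sum.elim id id u : Fin k) : ℕ) < m) := by
  rw [comp_transpose_apply]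
  refine and_congr Iff.rfl (or_congr_right ?_)
  change (∃ i : Fin m, modelMap m b (Sum.elim id id u : Fin k) = i) ↔ _
  generalize ((Sum.elim id id u : Fin k) : ℕ) = x
  constructor
  · rintro ⟨i, hi⟩
    by_contra hc
    have := i.2
    rw [modelMap, if_neg hc] at hi
    split_ifs at hi <;> omega
  · intro h
    exact ⟨⟨x, h⟩, by simp [modelMap, h]⟩

theorem modelMap_mono (b : Bool) {x y : ℕ} (h : x ≤ y) : modelMap m b x ≤ modelMap m b y := by
  unfold modelMap
  split_ifs <;> omega

theorem isPlanar_modelHalf (b : Bool) :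
    IsPlanar (comp (modelHalf k m b) (transpose (modelHalf k m b))) := by
  have hm : ∀ x y : Fin k, (x : ℕ) ≤ y → modelMap m b x ≤ modelMap m b y :=
    fun x y h => modelMap_mono b h
  rintro (p | p) (q | q) (r | r) (s | s) h₁ h₂ h₃ ha hb <;>
    rw [modelHalf_apply] at ha hb ⊢ <;>
    simp only [boundaryPos_inl, boundaryPos_inr, Sum.elim_inl, Sum.elim_inr, id, Sum.isLeft_inl,
      Sum.isLeft_inr, true_or, and_true, reduceCtorEq, false_or] at * <;> try omega
  · have := hm p q (by omega)
    have := hm q r (by omega)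
    omega
  · have := hm p q (by omega)
    have := hm q r (by omega)
    omega
  · have := hm p q (by omega)
    have := hm s r (by omega)
    omega
  · have := hm s r (by omega)
    have := hm r q (by omega)
    omega
  · have := hm s r (by omega)
    have := hm r q (by omega)
    have := hm q p (by omega)
    omega

theorem modelMap_eq {b : Bool} {x y z : ℕ} (hxy : modelMap m b x = modelMap m b y)
    (hxz : modelMap m b x = modelMap m b z) :
    (x < m → x = y ∧ x = z) ∧ (x = y ∨ x = z ∨ y = z) := by
  rcases b <;> simp only [modelMap, if_true, Bool.false_eq_true, if_false] at hxy hxz <;>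
    split_ifs at hxy hxz <;> omega

theorem atMostTwo_modelHalf (b : Bool) :
    AtMostTwo (comp (modelHalf k m b) (transpose (modelHalf k m b))) Set.univ := by
  rintro p - q - r - ha hb
  rw [modelHalf_apply] at ha hb
  obtain ⟨h₁, h₂⟩ := modelMap_eq ha.1 hb.1
  rcases p with p | p <;> rcases q with q | q <;> rcases r with r | r <;>
    simp only [Sum.elim_inl, Sum.elim_inr, id, Sum.isLeft_inl, Sum.isLeft_inr, reduceCtorEq,
      Bool.true_eq_false, Bool.false_eq_true,
      false_or, true_or, and_true, Sum.inl.injEq, Sum.inr.injEq, Fin.ext_iff, or_false] at * <;>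
    omega

theorem signSeparated_modelHalf :
    SignSeparated Sum.isLeft (comp (modelHalf k m false) (transpose (modelHalf k m false)))
      Set.univ := by
  rintro (p | p) - (q | q) - ha hs <;>
    rw [modelHalf_apply] at ha <;>
    simp [modelMap, Fin.ext_iff] at * <;> exact ha

theorem noSingleton_modelHalf {b : Bool} (h : m = k ∨ b = true ∧ ∃ l, m + 2 * l = k) :
    NoSingleton (comp (modelHalf k m b) (transpose (modelHalf k m b))) Set.univ := by
  intro u _
  by_cases hu : ((Sum.elim id id u : Fin k) : ℕ) < m
  · refine ⟨u.swap, trivial, by rcases u with u | u <;> simp, ?_⟩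
    rw [modelHalf_apply]
    exact ⟨by rcases u with u | u <;> rfl, Or.inr hu⟩
  · obtain ⟨rfl, l, hl⟩ : b = true ∧ ∃ l, m + 2 * l = k := by
      refine h.resolve_left fun hmk => hu ?_
      rw [hmk]
      exact Fin.is_lt _
    have key : ∀ x : Fin k, ¬ (x : ℕ) < m →
        ∃ y : Fin k, y ≠ x ∧ modelMap m true x = modelMap m true y := by
      intro x hx
      by_cases hpar : (x - m : ℕ) % 2 = 0
      · refine ⟨⟨x + 1, by omega⟩, fun hc => by have := congrArg Fin.val hc; simp at this, ?_⟩
        simp only [modelMap, if_neg hx, if_true]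
        rw [if_neg (by omega)]
        omega
      · refine ⟨⟨x - 1, by omega⟩, fun hc => by have := congrArg Fin.val hc; simp at this; omega, ?_⟩
        simp only [modelMap, if_neg hx, if_true]
        rw [if_neg (by omega)]
        omega
    rcases u with u | u
    · obtain ⟨y, hne, hy⟩ := key u hu
      exact ⟨Sum.inl y, trivial, by simpa using hne, (modelHalf_apply _ _ _).2 ⟨hy, Or.inl rfl⟩⟩
    · obtain ⟨y, hne, hy⟩ := key u hu
      exact ⟨Sum.inr y, trivial, by simpa using hne, (modelHalf_apply _ _ _).2 ⟨hy, Or.inl rfl⟩⟩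

/-- This is needed for the module to be nonzero. In the model the first `m` vertices propagate; the
others are paired with a neighbour for the Brauer and Temperley-Lieb families, where `k - m` is
even, and are singletons otherwise. -/
theorem DiagramFamily.exists_symDiagram {X : DiagramFamily} {lam : YoungDiagram}
    (hX : X.IsIndex k lam) : ∃ w : Diagram k, X.Mem w ∧
      IsSymmetricDiagram (removeFirstRow lam).card w := by
  have key : ∀ b, (removeFirstRow lam).card ≤ k →
      X.SizeCondition (comp (modelHalf k (removeFirstRow lam).card b)
        (transpose (modelHalf k (removeFirstRow lam).card b))) → ∃ w : Diagram k, X.Mem w ∧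
      IsSymmetricDiagram (removeFirstRow lam).card w := by
    intro b hb hs
    refine ⟨_, (X.mem_iff _).2 ⟨hs, fun _ => isPlanar_modelHalf b⟩, ?_⟩
    simpa using (isFull_modelHalf hb b).isSymmetricDiagram
  cases X <;> simp only [DiagramFamily.IsIndex] at hX
  case partition => exact key false hX trivial
  case symmetric => exact key false hX.le ⟨signSeparated_modelHalf, atMostTwo_modelHalf _,
      noSingleton_modelHalf (Or.inl hX)⟩
  case rook => exact key false hX signSeparated_modelHalf
  case brauer =>
    exact key true (by obtain ⟨l, hl⟩ := hX; omega)
      ⟨atMostTwo_modelHalf _, noSingleton_modelHalf (Or.inr ⟨rfl, hX⟩)⟩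
  case rookBrauer => exact key false hX (atMostTwo_modelHalf _)
  case planarPartition => exact key false hX.1 trivial
  case identity => exact key false hX.1.le ⟨signSeparated_modelHalf, atMostTwo_modelHalf _,
      noSingleton_modelHalf (Or.inl hX.1)⟩
  case temperleyLieb =>
    exact key true (by obtain ⟨⟨l, hl⟩, -⟩ := hX; omega)
      ⟨atMostTwo_modelHalf _, noSingleton_modelHalf (Or.inr ⟨rfl, hX.1⟩)⟩
  case planarRook => exact key false hX.1 signSeparated_modelHalf
  case motzkin => exact key false hX.1 (atMostTwo_modelHalf _)

end Model

/-! ### Set-partition tableaux and upper halves of diagrams -/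

section Shape

theorem card_eq_rowLen_add (lam : YoungDiagram) :
    lam.card = lam.rowLen 0 + (removeFirstRow lam).card := by
  classical
  have h : lam.cells = (Finset.range (lam.rowLen 0)).map ⟨fun j => (0, j), fun i j h => by
      simpa using h⟩ ∪ (removeFirstRow lam).cells.map ⟨fun c => (c.1 + 1, c.2), fun c c' h => by
      simpa [Prod.ext_iff] using h⟩ := by
    ext ⟨i, j⟩
    rw [Finset.mem_union, Finset.mem_map, Finset.mem_map]
    constructor
    · intro hc
      rcases i with _ | i
      · exact Or.inl ⟨j, Finset.mem_range.2 (YoungDiagram.mem_iff_lt_rowLen.1 hc), rfl⟩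
      · exact Or.inr ⟨(i, j), mem_removeFirstRow.2 hc, rfl⟩
    · rintro (⟨j', hj, he⟩ | ⟨c, hc, he⟩)
      · rw [← he]
        exact YoungDiagram.mem_iff_lt_rowLen.2 (Finset.mem_range.1 hj)
      · rw [← he]
        exact mem_removeFirstRow.1 hc
  rw [YoungDiagram.card, h, Finset.card_union_of_disjoint, Finset.card_map, Finset.card_map,
    Finset.card_range]
  rw [Finset.disjoint_left]
  intro c hc hc'
  rw [Finset.mem_map] at hc hc'
  obtain ⟨j, -, rfl⟩ := hc
  obtain ⟨c', -, he⟩ := hc'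
  exact absurd (congrArg Prod.fst he) (by simp)

theorem col_lt_card_removeFirstRow {lam : YoungDiagram} {i j : ℕ} (h : (i + 1, j) ∈ lam.cells) :
    j < (removeFirstRow lam).card := by
  have hsub : (Finset.range (j + 1)).map ⟨fun j => (0, j), fun i j h => by simpa using h⟩ ⊆
      (removeFirstRow lam).cells := by
    intro c hc
    obtain ⟨j', hj, rfl⟩ := Finset.mem_map.1 hc
    have hle : ((0 + 1, j') : ℕ × ℕ) ≤ (i + 1, j) :=
      ⟨Nat.succ_le_succ (Nat.zero_le _), Nat.lt_succ_iff.1 (Finset.mem_range.1 hj)⟩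
    exact mem_removeFirstRow.2 (lam.isLowerSet hle h)
  have := Finset.card_le_card hsub
  rwa [Finset.card_map, Finset.card_range] at this

end Shape

/-! ### The labelled upper half of a set-partition tableau -/

namespace SetPartitionTableau

variable {k : ℕ} {lam : YoungDiagram}

theorem card_quotient_le (π : Setoid (Fin k)) : Nat.card (Quotient π) ≤ k := by
  simpa using Nat.card_le_card_of_surjective (Quotient.mk π) Quotient.mk_surjective

theorem card_removeFirstRow_le (T : SetPartitionTableau k lam) :
    (removeFirstRow lam).card ≤ Nat.card (Quotient T.content) := by
  rw [← card_cell, ← Nat.card_eq_fintype_card]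
  exact Nat.card_le_card_of_injective _ T.lowerBlock_injective

theorem isPropagating_iff (T : SetPartitionTableau k lam) (q : Quotient T.content) :
    T.IsPropagating q ↔ ∃ c, T.lowerBlock c = q := by
  constructor
  · intro h
    rcases hc : T.filling.symm q with ⟨⟨i, j⟩, hm, hr⟩
    rw [IsPropagating, hc] at h
    rcases i with _ | i
    · exact absurd rfl h
    · refine ⟨⟨(i, j), mem_removeFirstRow.2 hm⟩, ?_⟩
      rw [← T.filling.apply_symm_apply q, hc]
      rfl
  · rintro ⟨c, rfl⟩
    simp [IsPropagating, lowerBlock]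

/-- The upper half of the symmetric diagram of `T`, in which a propagating block is labelled by
the entry of the Young tableau `t` in the same position. -/
def tableauHalf (T : SetPartitionTableau k lam) (t : YoungTableau (removeFirstRow lam)) :
    BiDiagram (Fin k) (Fin (removeFirstRow lam).card) :=
  Setoid.ker (Sum.elim (Quotient.mk T.content) fun i => T.lowerBlock (t.symm i))

variable (T : SetPartitionTableau k lam) (t : YoungTableau (removeFirstRow lam))

theorem tableauHalf_inl_inl {x y : Fin k} :
    T.tableauHalf t (Sum.inl x) (Sum.inl y) ↔ T.content x y :=
  ⟨fun h => Quotient.exact h, fun h => Quotient.sound h⟩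

theorem tableauHalf_inl_inr {x : Fin k} {i : Fin (removeFirstRow lam).card} :
    T.tableauHalf t (Sum.inl x) (Sum.inr i) ↔ T.lowerBlock (t.symm i) = Quotient.mk _ x :=
  eq_comm

theorem isFull_tableauHalf : IsFull (T.tableauHalf t) := by
  refine ⟨fun i => ?_, fun i j h => t.symm.injective (T.lowerBlock_injective h)⟩
  obtain ⟨x, hx⟩ := Quotient.exists_rep (T.lowerBlock (t.symm i))
  exact ⟨x, hx⟩

theorem symDiagram_eq :
    T.symDiagram = comp (T.tableauHalf t) (transpose (T.tableauHalf t)) := by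
  refine Setoid.ext fun u v => ?_
  rw [comp_transpose_apply, tableauHalf_inl_inl]
  refine and_congr Iff.rfl (or_congr_right ?_)
  rw [isPropagating_iff]
  simp only [tableauHalf_inl_inr]
  exact ⟨fun ⟨c, hc⟩ => ⟨t c, by simpa using hc⟩, fun ⟨i, hi⟩ => ⟨_, hi⟩⟩

theorem isSymmetricDiagram_symDiagram :
    IsSymmetricDiagram (removeFirstRow lam).card T.symDiagram := by
  rw [T.symDiagram_eq T.youngTableau]
  simpa using (T.isFull_tableauHalf T.youngTableau).isSymmetricDiagram

theorem symDiagram_inl_inl {x y : Fin k} :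
    T.symDiagram (Sum.inl x) (Sum.inl y) ↔ T.content x y :=
  ⟨fun h => h.1, fun h => ⟨h, Or.inl rfl⟩⟩

theorem propagates_symDiagram {x : Fin k} :
    Propagates T.symDiagram x ↔ ∃ c, T.lowerBlock c = Quotient.mk _ x := by
  rw [← isPropagating_iff]
  exact ⟨fun ⟨j, hj⟩ => hj.2.resolve_left (by simp),
    fun h => ⟨x, T.content.refl' x, Or.inr h⟩⟩

theorem le_blockMax {π : Setoid (Fin k)} (x : Fin k) : x ≤ blockMax (Quotient.mk π x) :=
  Finset.le_max' _ _ (by simp)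

theorem blockMax_mem_propMaxima (c : Cell (removeFirstRow lam)) :
    blockMax (T.lowerBlock c) ∈ propMaxima T.symDiagram := by
  rw [mem_propMaxima]
  refine ⟨T.propagates_symDiagram.2 ⟨c, (blockMax_mk _).symm⟩, fun z hz => ?_⟩
  have : Quotient.mk T.content z = T.lowerBlock c :=
    (Quotient.sound (T.symDiagram_inl_inl.1 hz)).symm.trans (blockMax_mk _)
  rw [← this]
  exact le_blockMax z

theorem youngTableau_lt {c c' : Cell (removeFirstRow lam)} :
    T.youngTableau c < T.youngTableau c' ↔
      blockMax (T.lowerBlock c) < blockMax (T.lowerBlock c') :=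
  rankEquiv_lt _ _ _ _ _

/-- Both numberings of the propagating blocks increase with the maximal entries. Comparing them
gives a strictly increasing self-map of `Fin m`, which must be the identity. -/
theorem blockIndex_blockMax (c : Cell (removeFirstRow lam)) :
    blockIndex T.symDiagram (blockMax (T.lowerBlock c)) = T.youngTableau c := by
  have hlt : ∀ i, blockIndex T.symDiagram (blockMax (T.lowerBlock (T.youngTableau.symm i))) <
      (removeFirstRow lam).card := fun i => by
    have := blockIndex_lt (mem_propMaxima.1
      (T.blockMax_mem_propMaxima (T.youngTableau.symm i))).1
    rwa [T.isSymmetricDiagram_symDiagram.2.1] at this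
  let f : Fin (removeFirstRow lam).card → Fin (removeFirstRow lam).card := fun i => ⟨_, hlt i⟩
  have hf : StrictMono f := by
    intro i j hij
    rw [Fin.mk_lt_mk, blockIndex_lt_blockIndex (T.blockMax_mem_propMaxima _)
      (T.blockMax_mem_propMaxima _) (Setoid.refl' _ _) (Setoid.refl' _ _), ← youngTableau_lt]
    simpa using hij
  have hid : f = id := (hf.range_inj strictMono_id).1 (by
    rw [(Finite.injective_iff_surjective.1 hf.injective).range_eq, Set.range_id])
  have := congrArg Fin.val (congrFun hid (T.youngTableau c))
  simpa [f] using this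

theorem lowerBlock_eq_iff {c : Cell (removeFirstRow lam)} {x : Fin k} :
    T.lowerBlock c = Quotient.mk _ x ↔
      Propagates T.symDiagram x ∧ blockIndex T.symDiagram x = T.youngTableau c := by
  have hm := mem_propMaxima.1 (T.blockMax_mem_propMaxima c)
  rw [← blockIndex_blockMax]
  constructor
  · intro h
    have hx : T.symDiagram (Sum.inl x) (Sum.inl (blockMax (T.lowerBlock c))) :=
      T.symDiagram_inl_inl.2 (Quotient.exact (by rw [blockMax_mk, h]))
    exact ⟨hm.1.congr (Setoid.symm' _ hx), blockIndex_congr hx⟩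
  · rintro ⟨hp, hi⟩
    rw [blockIndex_inj hp hm.1, symDiagram_inl_inl] at hi
    rw [← blockMax_mk (T.lowerBlock c)]
    exact (Quotient.sound hi).symm

/-- The label `i` sits in the box `t⁻¹ i`, and the index of the block in that box is the entry of
the Young tableau of `T`. This translates tableaux into symmetric diagrams with numbered blocks. -/
theorem tableauHalf_eq : T.tableauHalf t = half T.symDiagram (t.symm.trans T.youngTableau) := by
  refine (T.isFull_tableauHalf t).ext (isFull_half T.isSymmetricDiagram_symDiagram.2.1 _)
    (fun x y => ?_) fun i => ?_
  · rw [tableauHalf_inl_inl, half_inl_inl, symDiagram_inl_inl]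
  · obtain ⟨x, hx⟩ := (T.isFull_tableauHalf t).1 i
    refine ⟨x, hx, ?_⟩
    rw [tableauHalf_inl_inr, lowerBlock_eq_iff] at hx
    rw [half_inl_inr]
    exact hx

/-- Both the one-line diagram of the content and the symmetric diagram arise by stacking something
below the same full half, so both counts equal the one for `d` and that half. -/
theorem removed_oneLine {d : Diagram k} (h : IsFull (comp d (T.tableauHalf t))) :
    removed d (oneLine T.content) = removed d T.symDiagram := by
  have hone : oneLine T.content =
      comp (T.tableauHalf t) (⊥ : BiDiagram (Fin (removeFirstRow lam).card) Empty) := by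
    refine Setoid.ext ?_
    rintro (x | x) (y | y)
    · constructor
      · intro hxy
        exact stack_upper (u := Sum.inl x) (v := Sum.inl y) ((T.tableauHalf_inl_inl t).2 hxy)
      · intro hxy
        have := stack_induction (Sum.elim (Quotient.mk T.content)
          (Sum.elim (fun i => T.lowerBlock (t.symm i)) Empty.elim)) ?_ ?_ hxy
        · exact Quotient.exact (s := T.content) this
        · rintro (u | u) (v | v) huv <;> exact huv
        · rintro u v rfl
          rfl
    all_goals exact Empty.elim (by assumption)
  rw [hone, T.symDiagram_eq t, removed_comp_transpose (T.isFull_tableauHalf t) h,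
    removed_comp_transpose (T.isFull_tableauHalf t) h]

theorem stack_oneLine_iff {d : Diagram k} (u v : Fin k ⊕ Fin k) :
    stack d (oneLine T.content) (Sum.map id Sum.inl u) (Sum.map id Sum.inl v) ↔
      stack d (T.tableauHalf t) (Sum.map id Sum.inl u) (Sum.map id Sum.inl v) :=
  stack_upper_congr (fun _ _ => (T.tableauHalf_inl_inl t).symm) u v

theorem topOfComp_iff {d : Diagram k} {x y : Fin k} : topOfComp d T.content x y ↔
    comp d (T.tableauHalf t) (Sum.inl x) (Sum.inl y) :=
  T.stack_oneLine_iff t (Sum.inl x) (Sum.inl y)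

variable {T}

/-- The upper half of `d(T)` is the concatenation of `d` and the upper half of `T`. -/
theorem IsAction.comp_tableauHalf {d : Diagram k} {T' : SetPartitionTableau k lam}
    (h : IsAction d T T') : comp d (T.tableauHalf t) = T'.tableauHalf t := by
  have htop : ∀ x y, comp d (T.tableauHalf t) (Sum.inl x) (Sum.inl y) ↔
      T'.tableauHalf t (Sum.inl x) (Sum.inl y) := fun x y => by
    rw [tableauHalf_inl_inl, h.1, topOfComp_iff]
  have hlab : ∀ i x, T'.tableauHalf t (Sum.inl x) (Sum.inr i) →
      comp d (T.tableauHalf t) (Sum.inl x) (Sum.inr i) := by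
    intro i x hx
    obtain ⟨y, hy⟩ := (T.isFull_tableauHalf t).1 i
    rw [tableauHalf_inl_inr] at hx
    have h1 := (T.stack_oneLine_iff t (Sum.inl x) (Sum.inr y)).1
      (h.2.1 _ x y hx ((T.tableauHalf_inl_inr t).1 hy))
    exact (stack d (T.tableauHalf t)).trans' h1 (stack_lower hy)
  have hfull : IsFull (comp d (T.tableauHalf t)) := by
    refine ⟨fun i => ?_, fun i j hij => ?_⟩
    · obtain ⟨x, hx⟩ := (T'.isFull_tableauHalf t).1 i
      exact ⟨x, hlab i x hx⟩
    · obtain ⟨x, hx⟩ := (T'.isFull_tableauHalf t).1 i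
      obtain ⟨y, hy⟩ := (T'.isFull_tableauHalf t).1 j
      have hxy := (htop x y).1 (Setoid.trans' _ (hlab i x hx)
        (Setoid.trans' _ hij (Setoid.symm' _ (hlab j y hy))))
      exact (T'.isFull_tableauHalf t).2 i j
        (Setoid.trans' _ (Setoid.symm' _ hx) (Setoid.trans' _ hxy hy))
  refine hfull.ext (T'.isFull_tableauHalf t) htop fun i => ?_
  obtain ⟨x, hx⟩ := (T'.isFull_tableauHalf t).1 i
  exact ⟨x, hlab i x hx, hx⟩

theorem isAction_of_comp_tableauHalf {d : Diagram k} {T' : SetPartitionTableau k lam}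
    (h : comp d (T.tableauHalf t) = T'.tableauHalf t) (hT' : T'.FirstRowIncreasing) :
    IsAction d T T' := by
  refine ⟨Setoid.ext fun x y => ?_, fun c x y hx hy => ?_, hT'⟩
  · rw [T.topOfComp_iff t, h, tableauHalf_inl_inl]
  · have h1 : comp d (T.tableauHalf t) (Sum.inl x) (Sum.inr (t c)) := by
      rw [h, tableauHalf_inl_inr]
      simpa using hx
    have h2 : T.tableauHalf t (Sum.inl y) (Sum.inr (t c)) := by
      rw [tableauHalf_inl_inr]
      simpa using hy
    exact (T.stack_oneLine_iff t (Sum.inl x) (Sum.inr y)).2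
      (Setoid.trans' _ h1 (Setoid.symm' _ (stack_lower h2)))

end SetPartitionTableau

/-! ### Tableaux with increasing first row -/

namespace SetPartitionTableau

variable {k : ℕ} {lam : YoungDiagram}

/-- The boxes of the first row of `λ/[r]`. -/
abbrev FirstRowCell (lam : YoungDiagram) (r : ℕ) : Type := {c : SkewCell lam r // c.1.1 = 0}

noncomputable instance (lam : YoungDiagram) (r : ℕ) : Fintype (FirstRowCell lam r) :=
  Fintype.ofFinite _

theorem card_firstRowCell (lam : YoungDiagram) (r : ℕ) :
    Fintype.card (FirstRowCell lam r) = lam.rowLen 0 - r := by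
  rw [← Nat.card_Ico, ← Fintype.card_coe (Finset.Ico r (lam.rowLen 0))]
  refine Fintype.card_congr
    { toFun := fun c => ⟨c.1.1.2, Finset.mem_Ico.2 ⟨c.1.2.2 c.2, ?_⟩⟩
      invFun := fun j => ⟨⟨(0, j.1), ?_, fun _ => (Finset.mem_Ico.1 j.2).1⟩, rfl⟩
      left_inv := ?_
      right_inv := fun j => rfl }
  · have h := c.1.2.1
    rw [show c.1.1 = (0, c.1.1.2) from Prod.ext c.2 rfl] at h
    exact YoungDiagram.mem_iff_lt_rowLen.1 h
  · exact YoungDiagram.mem_iff_lt_rowLen.2 (Finset.mem_Ico.1 j.2).2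
  · rintro ⟨⟨⟨i, j⟩, h⟩, hi⟩
    obtain rfl : i = 0 := hi
    rfl

theorem col_injective (lam : YoungDiagram) (r : ℕ) :
    Function.Injective fun c : FirstRowCell lam r => c.1.1.2 := fun c c' h =>
  Subtype.ext (Subtype.ext (Prod.ext (c.2.trans c'.2.symm) h))

/-- Every full half diagram is the upper half of a tableau with increasing first row. -/
theorem exists_tableauHalf_eq (hk : 2 * k ≤ lam.card) (t : YoungTableau (removeFirstRow lam))
    {g : BiDiagram (Fin k) (Fin (removeFirstRow lam).card)} (hg : IsFull g) :
    ∃ T : SetPartitionTableau k lam, T.FirstRowIncreasing ∧ T.tableauHalf t = g := by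
  classical
  let π : Setoid (Fin k) := g.comap Sum.inl
  choose lab hlab using hg.1
  let low : Cell (removeFirstRow lam) → Quotient π := fun c => Quotient.mk π (lab (t c))
  have hlow : Function.Injective low := by
    intro c c' h
    have h1 : g (Sum.inl (lab (t c))) (Sum.inl (lab (t c'))) := Quotient.exact (s := π) h
    exact t.injective (hg.2 _ _ (g.trans' (g.symm' (hlab _)) (g.trans' h1 (hlab _))))
  let r := lam.card - Nat.card (Quotient π)
  have hle := card_quotient_le π
  have hcard : Fintype.card {q : Quotient π // q ∉ Set.range low} =
      Nat.card (Quotient π) - (removeFirstRow lam).card := by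
    rw [Fintype.card_subtype_compl, Nat.card_eq_fintype_card, ← card_cell,
      ← Set.card_range_of_injective hlow]
  -- Since the number `t` of blocks is at most `k` and `2k ≤ n`, the subtraction `n - t` does not
  -- truncate. The first row of `λ/[n-t]` has `λ₁ - (n - t) = t - m` boxes, as many as there are
  -- unlabelled blocks.
  have hcard' : Fintype.card (FirstRowCell lam r) =
      Nat.card (Quotient π) - (removeFirstRow lam).card := by
    rw [card_firstRowCell]
    have := card_eq_rowLen_add lam
    omega
  let e₁ := rankEquiv (fun c : FirstRowCell lam r => c.1.1.2) (col_injective lam r) hcard'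
  let e₂ := rankEquiv (fun q : {q : Quotient π // q ∉ Set.range low} => blockMax q.1)
    (blockMax_injective.comp Subtype.val_injective) hcard
  let F : SkewCell lam r → Quotient π := fun c =>
    if h : c.1.1 = 0 then (e₂.symm (e₁ ⟨c, h⟩)).1
    else low ⟨(c.1.1 - 1, c.1.2), mem_removeFirstRow.2 (by
      rw [show (c.1.1 - 1 + 1, c.1.2) = c.1 from Prod.ext (by simp; omega) rfl]
      exact c.2.1)⟩
  have hFlow : ∀ c : Cell (removeFirstRow lam), F ⟨(c.1.1 + 1, c.1.2), mem_removeFirstRow.1 c.2,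
      fun h => absurd h (Nat.succ_ne_zero _)⟩ = low c := fun c => by
    simp only [F]
    rw [dif_neg (Nat.succ_ne_zero _)]
    rfl
  have hF : Function.Bijective F := by
    constructor
    · intro c c' h
      by_cases hc : c.1.1 = 0 <;> by_cases hc' : c'.1.1 = 0 <;>
        simp only [F, hc, hc', dite_true, dite_false] at h
      · simpa using e₁.injective (e₂.symm.injective (Subtype.ext h))
      · exact absurd ⟨_, h.symm⟩ (e₂.symm (e₁ ⟨c, hc⟩)).2
      · exact absurd ⟨_, h⟩ (e₂.symm (e₁ ⟨c', hc'⟩)).2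
      · have := congrArg Subtype.val (hlow h)
        rw [Prod.mk.injEq] at this
        exact Subtype.ext (Prod.ext (by omega) this.2)
    · intro q
      by_cases hq : q ∈ Set.range low
      · obtain ⟨c, rfl⟩ := hq
        exact ⟨_, hFlow c⟩
      · refine ⟨(e₁.symm (e₂ ⟨q, hq⟩)).1, ?_⟩
        simp only [F]
        rw [dif_pos (e₁.symm (e₂ ⟨q, hq⟩)).2]
        simp
  refine ⟨⟨π, Equiv.ofBijective F hF⟩, ?_, ?_⟩
  · intro c c' hc hc' hlt
    change blockMax (F c) < blockMax (F c')
    simp only [F]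
    rw [dif_pos hc, dif_pos hc', ← rankEquiv_lt (fun q : {q : Quotient π // q ∉ Set.range low} =>
      blockMax q.1) (blockMax_injective.comp Subtype.val_injective) hcard]
    change e₂ _ < e₂ _
    rw [Equiv.apply_symm_apply, Equiv.apply_symm_apply]
    exact (rankEquiv_lt _ _ _ _ _).2 hlt
  · refine (isFull_tableauHalf _ t).ext hg (fun x y => tableauHalf_inl_inl _ t) fun i => ?_
    refine ⟨lab i, (tableauHalf_inl_inr _ t).2 ((hFlow _).trans ?_), hlab i⟩
    simp [low]

/-- A tableau with increasing first row is determined by its upper half. -/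
theorem eq_of_tableauHalf_eq {T T' : SetPartitionTableau k lam}
    {t : YoungTableau (removeFirstRow lam)} (hT : T.FirstRowIncreasing)
    (hT' : T'.FirstRowIncreasing) (h : T.tableauHalf t = T'.tableauHalf t) : T = T' := by
  have hcont : T.content = T'.content := Setoid.ext fun x y => by
    rw [← T.tableauHalf_inl_inl t, h, T'.tableauHalf_inl_inl]
  have hlow : ∀ c x, T.lowerBlock c = Quotient.mk _ x ↔ T'.lowerBlock c = Quotient.mk _ x := by
    intro c x
    rw [← t.symm_apply_apply c, ← T.tableauHalf_inl_inr t, h, T'.tableauHalf_inl_inr]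
  obtain ⟨π, f⟩ := T
  obtain ⟨π', f'⟩ := T'
  obtain rfl : π = π' := hcont
  congr 1
  have hlow' : ∀ c : SkewCell lam (lam.card - Nat.card (Quotient π)), c.1.1 ≠ 0 → f c = f' c := by
    rintro ⟨⟨i, j⟩, hm, hr⟩ hi
    rcases i with _ | i
    · exact absurd rfl hi
    · obtain ⟨x, hx⟩ := Quotient.exists_rep (f ⟨(i + 1, j), hm, hr⟩)
      rw [← hx]
      exact ((hlow ⟨(i, j), mem_removeFirstRow.2 hm⟩ x).1 hx.symm).symm
  let a := rankEquiv (fun c : FirstRowCell lam (lam.card - Nat.card (Quotient π)) => c.1.1.2)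
    (col_injective lam _) rfl
  have hmono : ∀ {f : SkewCell lam (lam.card - Nat.card (Quotient π)) ≃ Quotient π},
      FirstRowIncreasing ⟨π, f⟩ → StrictMono fun i => blockMax (f (a.symm i).1) := by
    intro f hf i j hij
    refine hf _ _ (a.symm i).2 (a.symm j).2 ((rankEquiv_lt (fun c : FirstRowCell lam
      (lam.card - Nat.card (Quotient π)) => c.1.1.2) (col_injective lam _) rfl _ _).1 ?_)
    change a (a.symm i) < a (a.symm j)
    rwa [Equiv.apply_symm_apply, Equiv.apply_symm_apply]
  have hrange : ∀ {f f' : SkewCell lam (lam.card - Nat.card (Quotient π)) ≃ Quotient π},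
      (∀ c, c.1.1 ≠ 0 → f c = f' c) → Set.range (fun i => blockMax (f (a.symm i).1)) ⊆
        Set.range fun i => blockMax (f' (a.symm i).1) := by
    rintro f f' hff _ ⟨i, rfl⟩
    have h0 : (f'.symm (f (a.symm i).1)).1.1 = 0 := by
      by_contra hne
      have h1 := hff _ hne
      rw [Equiv.apply_symm_apply] at h1
      rw [f.injective h1] at hne
      exact hne (a.symm i).2
    exact ⟨a ⟨_, h0⟩, by simp⟩
  -- The two first rows contain the same blocks, namely those not below, and both list them by
  -- increasing maximal entries.
  have key := ((hmono hT).range_inj (hmono hT')).1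
    (subset_antisymm (hrange hlow') (hrange fun c hc => (hlow' c hc).symm))
  ext c
  by_cases hc : c.1.1 = 0
  · refine blockMax_injective ?_
    simpa using congrFun key (a ⟨c, hc⟩)
  · exact hlow' c hc

/-- The boxes of the first row start in column `n - t ≥ k ≥ t ≥ m`, to the right of every box below.
Hence no column condition relates the first row to the rest. -/
theorem isStandard_iff (hk : 2 * k ≤ lam.card) (T : SetPartitionTableau k lam) :
    T.IsStandard ↔ T.FirstRowIncreasing ∧ YoungTableau.IsStandard T.youngTableau := by
  constructor
  · refine fun h => ⟨fun c c' hc hc' hlt => h c c' (Or.inl ⟨hc.trans hc'.symm, hlt⟩),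
      fun c c' hcc => T.youngTableau_lt.2 (h _ _ ?_)⟩
    exact hcc.imp (fun h => ⟨congrArg (· + 1) h.1, h.2⟩) fun h => ⟨h.1, Nat.succ_lt_succ h.2⟩
  · rintro ⟨h₁, h₂⟩ ⟨⟨i, j⟩, hm, hr⟩ ⟨⟨i', j'⟩, hm', hr'⟩ hcc
    rcases i with _ | i <;> rcases i' with _ | i'
    · rcases hcc with hcc | hcc
      · exact h₁ _ _ rfl rfl hcc.2
      · exact absurd hcc.2 (lt_irrefl _)
    · rcases hcc with hcc | hcc
      · exact absurd hcc.1 (by simp)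
      · obtain rfl : j = j' := hcc.1
        have := col_lt_card_removeFirstRow hm'
        have := T.card_removeFirstRow_le
        have := card_quotient_le T.content
        have := hr rfl
        simp only at this
        omega
    · rcases hcc with hcc | hcc
      · exact absurd hcc.1 (by simp)
      · exact absurd hcc.2 (by simp)
    · refine T.youngTableau_lt.1 (h₂ ⟨(i, j), mem_removeFirstRow.2 hm⟩
        ⟨(i', j'), mem_removeFirstRow.2 hm'⟩ ?_)
      exact hcc.imp (fun h => ⟨Nat.succ_injective h.1, h.2⟩)
        fun h => ⟨h.1, Nat.lt_of_succ_lt_succ h.2⟩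

theorem eq_of_symDiagram_eq {T T' : SetPartitionTableau k lam} (hT : T.FirstRowIncreasing)
    (hT' : T'.FirstRowIncreasing) (hw : T.symDiagram = T'.symDiagram)
    (ht : T.youngTableau = T'.youngTableau) : T = T' :=
  eq_of_tableauHalf_eq (t := T.youngTableau) hT hT' (by rw [tableauHalf_eq, tableauHalf_eq, hw, ht])

/-- Tableaux with increasing first row correspond to pairs of a symmetric diagram and a Young
tableau. -/
theorem exists_symDiagram_youngTableau (hk : 2 * k ≤ lam.card) {w : Diagram k}
    (hw : IsSymmetricDiagram (removeFirstRow lam).card w)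
    (t : YoungTableau (removeFirstRow lam)) : ∃ T : SetPartitionTableau k lam,
      T.FirstRowIncreasing ∧ T.symDiagram = w ∧ T.youngTableau = t := by
  obtain ⟨T, hT, h⟩ := exists_tableauHalf_eq hk t (isFull_half hw.2.1 1)
  have hwT : T.symDiagram = w := by
    rw [T.symDiagram_eq t, h, comp_half_transpose hw]
  refine ⟨T, hT, hwT, ?_⟩
  rw [tableauHalf_eq, hwT] at h
  have := half_injective hw.2.1 h
  ext c
  simpa using congrArg Fin.val (Equiv.congr_fun this (t c))

variable {d : Diagram k} {T : SetPartitionTableau k lam}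

/-- Both sides say that `d` concatenated with the upper half of `T` is full: every full half is the
upper half of a tableau, and fullness is maximal rank of the conjugate. -/
theorem exists_isAction_iff (hk : 2 * k ≤ lam.card) : (∃ T', IsAction d T T') ↔
    rank (conj d T.symDiagram) = (removeFirstRow lam).card := by
  rw [← isFull_comp_half T.isSymmetricDiagram_symDiagram
    (T.youngTableau.symm.trans T.youngTableau), ← tableauHalf_eq]
  constructor
  · rintro ⟨T', hT'⟩
    rw [hT'.comp_tableauHalf]
    exact T'.isFull_tableauHalf _
  · intro h
    obtain ⟨T', hT', he⟩ := exists_tableauHalf_eq hk T.youngTableau h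
    exact ⟨T', isAction_of_comp_tableauHalf _ he.symm hT'⟩

end SetPartitionTableau

/-! ### The action on tableaux in terms of twists, straightening and block sizes -/

namespace SetPartitionTableau

variable {k : ℕ} {lam : YoungDiagram}

theorem IsAction.symDiagram_eq {d : Diagram k} {T T' : SetPartitionTableau k lam}
    (h : IsAction d T T') : T'.symDiagram = conj d T.symDiagram := by
  rw [conj_eq T.isSymmetricDiagram_symDiagram (T.youngTableau.symm.trans T.youngTableau),
    ← tableauHalf_eq, h.comp_tableauHalf, ← T'.symDiagram_eq]

/-- Concatenation with `d` renumbers the propagating blocks by the twist, so the Young tableau of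
`d(T)` is the one of `T` with the twist applied to its entries. -/
theorem IsAction.ofPerm_mul_naturalVector {d : Diagram k} {T T' : SetPartitionTableau k lam}
    (h : IsAction d T T') {σ : Equiv.Perm (Fin (removeFirstRow lam).card)}
    (hσ : ∀ τ, comp d (half T.symDiagram τ) = half (conj d T.symDiagram) (σ * τ)) :
    ofPerm σ * naturalVector T.youngTableau = naturalVector T'.youngTableau := by
  have h1 := h.comp_tableauHalf T.youngTableau
  rw [tableauHalf_eq, tableauHalf_eq, hσ, ← h.symDiagram_eq] at h1
  have h2 := half_injective T'.isSymmetricDiagram_symDiagram.2.1 h1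
  have h3 : σ * tableauPerm T.youngTableau = tableauPerm T'.youngTableau := by
    ext x
    have := congrArg Fin.val (Equiv.congr_fun h2 (tableauPerm T.youngTableau x))
    simpa [tableauPerm] using this
  rw [naturalVector, ← mul_assoc, ofPerm_mul, h3, naturalVector]

theorem IsAction.removed_eq {d : Diagram k} {T T' : SetPartitionTableau k lam}
    (h : IsAction d T T') : removed d (oneLine T.content) = removed d T.symDiagram := by
  refine T.removed_oneLine T.youngTableau ?_
  rw [h.comp_tableauHalf]
  exact T'.isFull_tableauHalf _

theorem exists_standard (hk : 2 * k ≤ lam.card) {w : Diagram k}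
    (hw : IsSymmetricDiagram (removeFirstRow lam).card w)
    (s : StandardYoungTableau (removeFirstRow lam)) : ∃ T : StandardSPT k lam,
      T.1.symDiagram = w ∧ T.1.youngTableau = s.1 := by
  obtain ⟨T, hT, hw, hs⟩ := exists_symDiagram_youngTableau hk hw s.1
  exact ⟨⟨T, (isStandard_iff hk T).2 ⟨hT, hs ▸ s.2⟩⟩, hw, hs⟩

theorem standard_ext (hk : 2 * k ≤ lam.card) {T T' : StandardSPT k lam}
    (hw : T.1.symDiagram = T'.1.symDiagram) (ht : T.1.youngTableau = T'.1.youngTableau) :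
    T = T' :=
  Subtype.ext (eq_of_symDiagram_eq ((isStandard_iff hk _).1 T.2).1
    ((isStandard_iff hk _).1 T'.2).1 hw ht)

/-- For each standard `s` exactly one standard set-partition tableau has the symmetric diagram of
`T` and Young tableau `s`. The sum over tableaux in `straightenedVector` thus collapses to a sum
over `s`. -/
theorem linearCombination_straightenedVector (hk : 2 * k ≤ lam.card) {M : Type} [AddCommGroup M]
    [Module ℂ M] (T : SetPartitionTableau k lam)
    (F : Diagram k → YoungTableau (removeFirstRow lam) → M) :
    Finsupp.linearCombination ℂ (fun S : StandardSPT k lam =>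
        F S.1.symDiagram S.1.youngTableau) (straightenedVector T) =
      ∑ s : StandardYoungTableau (removeFirstRow lam),
        (straightening T.youngTableau s : ℂ) • F T.symDiagram s.1 := by
  classical
  have := Fintype.ofFinite (StandardSPT k lam)
  rw [Finsupp.linearCombination_apply, Finsupp.sum_fintype _ _ (by simp)]
  have h1 : ∀ S : StandardSPT k lam, straightenedVector T S • F S.1.symDiagram S.1.youngTableau =
      ∑ s : StandardYoungTableau (removeFirstRow lam),
        if S.1.symDiagram = T.symDiagram ∧ S.1.youngTableau = s.1 then
          (straightening T.youngTableau s : ℂ) • F T.symDiagram s.1 else 0 := by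
    intro S
    simp only [straightenedVector, Finsupp.equivFunOnFinite_symm_apply_apply]
    split_ifs with hS
    · rw [Finset.sum_smul]
      refine Finset.sum_congr rfl fun s _ => ?_
      by_cases hs : S.1.youngTableau = s.1
      · simp [hS, hs]
      · simp [hs]
    · simp [hS]
  rw [Finset.sum_congr rfl fun S _ => h1 S, Finset.sum_comm]
  refine Finset.sum_congr rfl fun s _ => ?_
  obtain ⟨S, hS, hs⟩ := exists_standard hk T.isSymmetricDiagram_symDiagram s
  rw [Finset.sum_eq_single S, if_pos ⟨hS, hs⟩]
  · intro S' _ hne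
    exact if_neg fun h => hne (standard_ext hk (h.1.trans hS.symm) (h.2.trans hs.symm))
  · simp

/-! ### Block sizes -/

theorem blockSize_pos {π : Setoid (Fin k)} (q : Quotient π) : 0 < blockSize q :=
  have : Nonempty {x : Fin k // Quotient.mk π x = q} := ⟨⟨_, blockMax_mk q⟩⟩
  Nat.card_pos

theorem card_content (T : SetPartitionTableau k lam) (x : Fin k) (p : Fin k → Prop)
    [DecidablePred p] (hp : ∀ y, p y ↔ T.content x y) :
    (Finset.univ.filter p).card = blockSize (Quotient.mk T.content x) := by
  classical
  rw [blockSize, Nat.card_eq_fintype_card, Fintype.card_subtype]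
  congr 1
  ext y
  simp only [Finset.mem_filter, Finset.mem_univ, true_and, hp]
  exact ⟨fun h => (Quotient.sound h).symm, fun h => (Quotient.exact h.symm)⟩

/-- A propagating block of size `s` becomes one block with `s` vertices in each row, while a
non-propagating block becomes two blocks, one in each row. -/
theorem forall_count_iff (T : SetPartitionTableau k lam) (P : ℕ → ℕ → Prop) :
    (∀ v, P (topCount T.symDiagram v) (bottomCount T.symDiagram v)) ↔
      ∀ q, (T.IsPropagating q → P (blockSize q) (blockSize q)) ∧
        (¬ T.IsPropagating q → P (blockSize q) 0 ∧ P 0 (blockSize q)) := by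
  classical
  have h1 : ∀ x, topCount T.symDiagram (Sum.inl x) = blockSize (Quotient.mk T.content x) :=
    fun x => T.card_content x _ fun y => ⟨fun h => h.1, fun h => ⟨h, Or.inl rfl⟩⟩
  have h2 : ∀ x, bottomCount T.symDiagram (Sum.inr x) = blockSize (Quotient.mk T.content x) :=
    fun x => T.card_content x _ fun y => ⟨fun h => h.1, fun h => ⟨h, Or.inl rfl⟩⟩
  have h3 : ∀ x, T.IsPropagating (Quotient.mk T.content x) →
      bottomCount T.symDiagram (Sum.inl x) = blockSize (Quotient.mk T.content x) :=
    fun x hx => T.card_content x _ fun y => ⟨fun h => h.1, fun h => ⟨h, Or.inr hx⟩⟩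
  have h4 : ∀ x, T.IsPropagating (Quotient.mk T.content x) →
      topCount T.symDiagram (Sum.inr x) = blockSize (Quotient.mk T.content x) :=
    fun x hx => T.card_content x _ fun y => ⟨fun h => h.1, fun h => ⟨h, Or.inr hx⟩⟩
  have h5 : ∀ x, ¬ T.IsPropagating (Quotient.mk T.content x) →
      bottomCount T.symDiagram (Sum.inl x) = 0 := fun x hx =>
    Finset.card_eq_zero.2 (Finset.filter_eq_empty_iff.2 fun y _ h =>
      hx (h.2.resolve_left (by simp)))
  have h6 : ∀ x, ¬ T.IsPropagating (Quotient.mk T.content x) →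
      topCount T.symDiagram (Sum.inr x) = 0 := fun x hx =>
    Finset.card_eq_zero.2 (Finset.filter_eq_empty_iff.2 fun y _ h =>
      hx (h.2.resolve_left (by simp)))
  constructor
  · intro h q
    obtain ⟨x, rfl⟩ := Quotient.exists_rep q
    have hl := h (Sum.inl x)
    have hr := h (Sum.inr x)
    rw [h1] at hl
    rw [h2] at hr
    refine ⟨fun hx => ?_, fun hx => ?_⟩
    · rwa [h3 x hx] at hl
    · rw [h5 x hx] at hl
      rw [h6 x hx] at hr
      exact ⟨hl, hr⟩
  · rintro h (x | x)
    · rw [h1]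
      by_cases hx : T.IsPropagating (Quotient.mk T.content x)
      · rw [h3 x hx]
        exact (h _).1 hx
      · rw [h5 x hx]
        exact ((h _).2 hx).1
    · rw [h2]
      by_cases hx : T.IsPropagating (Quotient.mk T.content x)
      · rw [h4 x hx]
        exact (h _).1 hx
      · rw [h6 x hx]
        exact ((h _).2 hx).2

theorem forall_count_iff_hasBlockSizes (T : SetPartitionTableau k lam) {P : ℕ → ℕ → Prop}
    {p : ℕ → Prop} (h₁ : ∀ s, 0 < s → (P s s ↔ s = 1))
    (h₂ : ∀ s, 0 < s → (P s 0 ∧ P 0 s ↔ p s)) :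
    (∀ v, P (topCount T.symDiagram v) (bottomCount T.symDiagram v)) ↔ HasBlockSizes T p := by
  rw [forall_count_iff]
  exact forall_congr' fun q => and_congr (imp_congr_right fun _ => h₁ _ (blockSize_pos q))
    (imp_congr_right fun _ => h₂ _ (blockSize_pos q))

theorem mem_restrictedSSPT_iff (X : DiagramFamily) (T : StandardSPT k lam) :
    T ∈ restrictedSSPT X k lam ↔ X.HasShape T.1 := by
  have h1 : T ∈ restrictedSSPT X k lam ↔ X.Mem T.1.symDiagram :=
    and_iff_left T.1.isSymmetricDiagram_symDiagram
  have hs : (∀ v, topCount T.1.symDiagram v = 1 ∧ bottomCount T.1.symDiagram v = 1) ↔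
      HasBlockSizes T.1 fun _ => False :=
    T.1.forall_count_iff_hasBlockSizes (P := fun a b => a = 1 ∧ b = 1)
      (fun s hs => by omega) fun s hs => by simp
  have hr : (∀ v, topCount T.1.symDiagram v ≤ 1 ∧ bottomCount T.1.symDiagram v ≤ 1) ↔
      HasBlockSizes T.1 fun s => s = 1 :=
    T.1.forall_count_iff_hasBlockSizes (P := fun a b => a ≤ 1 ∧ b ≤ 1)
      (fun s hs => by omega) fun s hs => by omega
  have hb : (∀ v, topCount T.1.symDiagram v + bottomCount T.1.symDiagram v = 2) ↔
      HasBlockSizes T.1 fun s => s = 2 :=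
    T.1.forall_count_iff_hasBlockSizes (P := fun a b => a + b = 2)
      (fun s hs => by omega) fun s hs => by omega
  have hrb : (∀ v, topCount T.1.symDiagram v + bottomCount T.1.symDiagram v = 1 ∨
      topCount T.1.symDiagram v + bottomCount T.1.symDiagram v = 2) ↔
      HasBlockSizes T.1 fun s => s = 1 ∨ s = 2 :=
    T.1.forall_count_iff_hasBlockSizes (P := fun a b => a + b = 1 ∨ a + b = 2)
      (fun s hs => by omega) fun s hs => by omega
  rw [h1]
  cases X
  case partition => exact Iff.rfl
  case symmetric => exact hs
  case rook => exact hr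
  case brauer => exact hb
  case rookBrauer => exact hrb
  case planarPartition => exact Iff.rfl
  case identity => exact and_congr hs Iff.rfl
  case temperleyLieb => exact and_congr hb Iff.rfl
  case planarRook => exact and_congr hr Iff.rfl
  case motzkin => exact and_congr hrb Iff.rfl

end SetPartitionTableau

/-! ### Embedding both modules into tensor space -/

section Transport

/-- A representation restricts along an injective linear map with stable range. -/
theorem exists_restrict {A V M : Type} [Ring A] [Algebra ℂ A] [AddCommGroup V] [Module ℂ V]
    [AddCommGroup M] [Module ℂ M] (R : A →ₐ[ℂ] Module.End ℂ V) {Ψ : M →ₗ[ℂ] V}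
    (hΨ : Function.Injective Ψ) (h : ∀ a x, R a (Ψ x) ∈ LinearMap.range Ψ) :
    ∃ τ : A →ₐ[ℂ] Module.End ℂ M, ∀ a x, Ψ (τ a x) = R a (Ψ x) := by
  choose f hf using h
  refine ⟨AlgHom.ofLinearMap
    { toFun := fun a =>
        { toFun := f a
          map_add' := fun x y => hΨ (by simp only [map_add, hf])
          map_smul' := fun r x => hΨ (by simp only [map_smul, hf, RingHom.id_apply]) }
      map_add' := fun a b => LinearMap.ext fun x => hΨ (by
        simp only [LinearMap.coe_mk, AddHom.coe_mk, LinearMap.add_apply, map_add, hf])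
      map_smul' := fun r a => LinearMap.ext fun x => hΨ (by
        simp only [LinearMap.coe_mk, AddHom.coe_mk, LinearMap.smul_apply, map_smul, hf,
          RingHom.id_apply]) } ?_ ?_, hf⟩
  · exact LinearMap.ext fun x => hΨ (by simp [hf])
  · exact fun a b => LinearMap.ext fun x => hΨ (by simp [hf])

end Transport

/-- The parameter can vanish only for `k = 0`, and then there is no middle vertex to delete. -/
theorem natCast_pow_removed_ne_zero {k n : ℕ} (hn : 2 * k ≤ n) {α β : Type}
    (d : BiDiagram α (Fin k)) (e : BiDiagram (Fin k) β) : (n : ℂ) ^ removed d e ≠ 0 := by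
  rcases Nat.eq_zero_or_pos n with rfl | h
  · obtain rfl : k = 0 := by omega
    rw [removed_eq_zero e fun b => b.elim0, pow_zero]
    exact one_ne_zero
  · exact pow_ne_zero _ (Nat.cast_ne_zero.2 h.ne')

section Embedding

variable {X : DiagramFamily} {k : ℕ} {lam : YoungDiagram}

instance {m : ℕ} : Finite (X.SymDiagram k m) := Subtype.finite

noncomputable instance {m : ℕ} : DecidableEq (X.SymDiagram k m) := Classical.decEq _

theorem DiagramFamily.IsIndex.card_le (hX : X.IsIndex k lam) : (removeFirstRow lam).card ≤ k := by
  cases X <;> simp only [DiagramFamily.IsIndex] at hX <;> omega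

theorem DiagramFamily.IsIndex.oneRow (hX : X.IsIndex k lam) (h : X.Planar) :
    OneRow (removeFirstRow lam) := by
  cases X
  case planarPartition | planarRook | motzkin | identity | temperleyLieb => exact hX.2
  all_goals exact h.elim

/-- The map `v ↦ symVec n w v` on the Specht module. -/
noncomputable def spechtVec (n : ℕ) (lam : YoungDiagram) (w : Diagram k) :
    spechtModule (removeFirstRow lam) →ₗ[ℂ] ((Fin k → Fin n) → ℂ) :=
  symVec n w ∘ₗ (spechtModule (removeFirstRow lam)).subtype.restrictScalars ℂ

theorem spechtVec_apply {n : ℕ} (w : Diagram k) (v : spechtModule (removeFirstRow lam)) :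
    spechtVec n lam w v = symVec n w v.1 := rfl

/-- The embedding of `A_k^λ` into tensor space. -/
noncomputable def symEmbedding (X : DiagramFamily) (k n : ℕ) (lam : YoungDiagram) :
    SymModule X k lam →ₗ[ℂ] ((Fin k → Fin n) → ℂ) :=
  (Finsupp.lsum ℂ fun w : X.SymDiagram k (removeFirstRow lam).card => spechtVec n lam w.1) ∘ₗ
    (TensorProduct.finsuppScalarLeft ℂ (spechtModule (removeFirstRow lam))
      (X.SymDiagram k (removeFirstRow lam).card)).toLinearMap

variable {n : ℕ}

theorem symEmbedding_tmul (w : X.SymDiagram k (removeFirstRow lam).card)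
    (v : spechtModule (removeFirstRow lam)) :
    symEmbedding X k n lam (TensorProduct.tmul ℂ (Finsupp.single w (1 : ℂ)) v) =
      symVec n w.1 v.1 := by
  simp [symEmbedding, TensorProduct.finsuppScalarLeft_apply_tmul, spechtVec_apply]

theorem symEmbedding_eq_sum [Fintype (X.SymDiagram k (removeFirstRow lam).card)]
    (x : SymModule X k lam) : ∃ f : X.SymDiagram k (removeFirstRow lam).card →
      spechtModule (removeFirstRow lam), symEmbedding X k n lam x =
        ∑ w, symVec n w.1 (f w).1 ∧ (f = 0 → x = 0) := by
  refine ⟨TensorProduct.finsuppScalarLeft ℂ (spechtModule (removeFirstRow lam))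
      (X.SymDiagram k (removeFirstRow lam).card) x, ?_, fun h => ?_⟩
  · rw [symEmbedding, LinearMap.comp_apply, Finsupp.lsum_apply, Finsupp.sum_fintype _ _ (by simp)]
    rfl
  · rwa [← Finsupp.coe_zero, DFunLike.coe_fn_eq, LinearEquiv.map_eq_zero_iff] at h

theorem symEmbedding_injective (hn : 2 * k ≤ n) :
    Function.Injective (symEmbedding X k n lam) := by
  have := Fintype.ofFinite (X.SymDiagram k (removeFirstRow lam).card)
  refine (injective_iff_map_eq_zero _).2 fun x hx => ?_
  obtain ⟨f, hf, h0⟩ := symEmbedding_eq_sum (n := n) x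
  refine h0 (funext fun w => Subtype.ext ?_)
  exact symVec_eq_zero hn (w := fun w : X.SymDiagram k (removeFirstRow lam).card => w.1)
    Subtype.val_injective (fun w => w.2.2) (v := fun w => (f w).1) (hf ▸ hx) w

/-- The vectors in tensor space of the symmetric diagrams in `𝒜_k` and the standard tableaux. -/
def standardVectors (X : DiagramFamily) (k n : ℕ) (lam : YoungDiagram) :
    Set ((Fin k → Fin n) → ℂ) :=
  Set.range fun p : X.SymDiagram k (removeFirstRow lam).card ×
    StandardYoungTableau (removeFirstRow lam) => symVec n p.1.1 (naturalVector p.2.1)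

theorem range_symEmbedding : LinearMap.range (symEmbedding X k n lam) =
    Submodule.span ℂ (standardVectors X k n lam) := by
  have := Fintype.ofFinite (X.SymDiagram k (removeFirstRow lam).card)
  apply le_antisymm
  · rintro _ ⟨x, rfl⟩
    obtain ⟨f, hf, -⟩ := symEmbedding_eq_sum (n := n) x
    rw [hf]
    refine Submodule.sum_mem _ fun w _ => ?_
    have h1 := Submodule.mem_map_of_mem (f := symVec n w.1) (spechtModule_mem_span (f w).2)
    rw [Submodule.map_span] at h1
    refine Submodule.span_mono ?_ h1
    rintro _ ⟨_, ⟨s, rfl⟩, rfl⟩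
    exact ⟨(w, s), rfl⟩
  · rw [Submodule.span_le]
    rintro _ ⟨⟨w, s⟩, rfl⟩
    exact ⟨_, symEmbedding_tmul w ⟨_, naturalVector_mem_spechtModule s.1⟩⟩

theorem symVec_mem {w : Diagram k} (hX : X.Mem w)
    (hw : IsSymmetricDiagram (removeFirstRow lam).card w)
    {v : SymGroupAlgebra (removeFirstRow lam).card} (hv : v ∈ spechtModule (removeFirstRow lam)) :
    symVec n w v ∈ Submodule.span ℂ (standardVectors X k n lam) := by
  rw [← range_symEmbedding]
  exact ⟨_, symEmbedding_tmul ⟨w, hX, hw⟩ ⟨v, hv⟩⟩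

theorem ofPerm_mul_mem {μ : YoungDiagram} (σ : Equiv.Perm (Fin μ.card)) {v : SymGroupAlgebra μ.card}
    (hv : v ∈ spechtModule μ) : ofPerm σ * v ∈ spechtModule μ :=
  Submodule.smul_mem _ (ofPerm σ) hv

theorem colourRep_mem (hn : 2 * k ≤ n) (hm : (removeFirstRow lam).card ≤ k)
    {a : PartitionAlgebra k (n : ℂ)} (ha : a ∈ X.span k (n : ℂ)) {y : (Fin k → Fin n) → ℂ}
    (hy : y ∈ Submodule.span ℂ (standardVectors X k n lam)) :
    colourRep k n a y ∈ Submodule.span ℂ (standardVectors X k n lam) := by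
  induction ha using Submodule.span_induction with
  | mem a ha =>
    obtain ⟨d, hd, rfl⟩ := ha
    induction hy using Submodule.span_induction with
    | mem y hy =>
      obtain ⟨⟨w, s⟩, rfl⟩ := hy
      simp only [colourRep_ofDiagram]
      by_cases hr : rank (conj d w.1) = (removeFirstRow lam).card
      · obtain ⟨σ, -, hσ⟩ := exists_twist w.2.2 hr
        rw [diagramMatrix_mulVec_symVec w.2.2 hr hσ]
        exact Submodule.smul_mem _ _ (symVec_mem (hd.conj w.2.1) (isSymmetricDiagram_conj w.2.2 hr)
          (ofPerm_mul_mem σ (naturalVector_mem_spechtModule s.1)))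
      · rw [diagramMatrix_mulVec_symVec_eq_zero (by omega) w.2.2 hr]
        exact Submodule.zero_mem _
    | zero => rw [map_zero]; exact Submodule.zero_mem _
    | add x y _ _ hx hy => rw [map_add]; exact Submodule.add_mem _ hx hy
    | smul r x _ hx => rw [map_smul]; exact Submodule.smul_mem _ _ hx
  | zero => rw [map_zero]; exact Submodule.zero_mem _
  | add a b _ _ ha hb => rw [map_add]; exact Submodule.add_mem _ ha hb
  | smul r a _ ha => rw [map_smul]; exact Submodule.smul_mem _ _ ha

/-- The embedding of `P_k^λ` into tensor space. -/
noncomputable def naturalEmbedding (k n : ℕ) (lam : YoungDiagram) :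
    NaturalModule k lam →ₗ[ℂ] ((Fin k → Fin n) → ℂ) :=
  Finsupp.linearCombination ℂ fun T : StandardSPT k lam =>
    symVec n T.1.symDiagram (naturalVector T.1.youngTableau)

theorem naturalEmbedding_single (T : StandardSPT k lam) :
    naturalEmbedding k n lam (Finsupp.single T (1 : ℂ)) =
      symVec n T.1.symDiagram (naturalVector T.1.youngTableau) := by
  rw [naturalEmbedding, Finsupp.linearCombination_single, one_smul]

/-- Grouping the tableaux by symmetric diagram, independence of the half-diagram vectors separates
the groups. Within a group the Young tableaux are distinct standard ones, and their natural vectors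
are independent. -/
theorem naturalEmbedding_injective (hn : 2 * k ≤ n) (hlam : lam.card = n) :
    Function.Injective (naturalEmbedding k n lam) := by
  classical
  subst hlam
  have := Fintype.ofFinite (StandardSPT k lam)
  have := Fintype.ofFinite (Diagram k)
  refine (injective_iff_map_eq_zero _).2 fun x hx => ?_
  rw [naturalEmbedding, Finsupp.linearCombination_apply, Finsupp.sum_fintype _ _ (by simp)] at hx
  let ι := {w : Diagram k // IsSymmetricDiagram (removeFirstRow lam).card w}
  let v : ι → SymGroupAlgebra (removeFirstRow lam).card := fun w =>
    ∑ T : StandardSPT k lam, if T.1.symDiagram = w.1 then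
      x T • naturalVector T.1.youngTableau else 0
  have := Fintype.ofFinite ι
  have hsum : ∑ w : ι, symVec lam.card w.1 (v w) = 0 := by
    rw [← hx]
    simp only [v, map_sum]
    rw [Finset.sum_comm]
    refine Finset.sum_congr rfl fun T _ => ?_
    rw [Finset.sum_eq_single ⟨T.1.symDiagram, T.1.isSymmetricDiagram_symDiagram⟩]
    · rw [if_pos rfl, map_smul]
    · intro w _ hw
      rw [if_neg fun h => hw (Subtype.ext h.symm), map_zero]
    · simp
  have hv := symVec_eq_zero hn (w := fun w : ι => w.1) Subtype.val_injective (fun w => w.2) hsum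
  have hlin : ∀ w : ι, ∑ s : StandardYoungTableau (removeFirstRow lam),
      (∑ T : StandardSPT k lam, if T.1.symDiagram = w.1 ∧ T.1.youngTableau = s.1 then x T else 0) •
        naturalVector s.1 = 0 := by
    intro w
    rw [← hv w]
    simp only [Finset.sum_smul, v]
    rw [Finset.sum_comm]
    refine Finset.sum_congr rfl fun T _ => ?_
    rw [Finset.sum_eq_single ⟨T.1.youngTableau, ((SetPartitionTableau.isStandard_iff hn T.1).1 T.2).2⟩]
    · by_cases h : T.1.symDiagram = w.1 <;> simp [h]
    · intro s _ hs
      rw [if_neg fun h => hs (Subtype.ext h.2.symm), zero_smul]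
    · simp
  ext T
  have h1 := Fintype.linearIndependent_iff.1 linearIndependent_naturalVector _
    (hlin ⟨_, T.1.isSymmetricDiagram_symDiagram⟩)
    ⟨T.1.youngTableau, ((SetPartitionTableau.isStandard_iff hn T.1).1 T.2).2⟩
  rw [Finset.sum_eq_single T, if_pos ⟨rfl, rfl⟩] at h1
  · exact h1
  · intro T' _ hT'
    exact if_neg fun h => hT' (SetPartitionTableau.standard_ext hn h.1 h.2)
  · simp

theorem map_restrictedModule (hn : 2 * k ≤ n) (hlam : lam.card = n) :
    (restrictedModule X k lam).map (naturalEmbedding k n lam) =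
      Submodule.span ℂ (standardVectors X k n lam) := by
  subst hlam
  rw [restrictedModule, Submodule.map_span, ← Set.image_comp]
  congr 1
  ext y
  constructor
  · rintro ⟨T, hT, rfl⟩
    exact ⟨(⟨_, hT⟩, ⟨_, ((SetPartitionTableau.isStandard_iff hn T.1).1 T.2).2⟩),
      (naturalEmbedding_single T).symm⟩
  · rintro ⟨⟨w, s⟩, rfl⟩
    obtain ⟨T, hw, hs⟩ := SetPartitionTableau.exists_standard hn w.2.2 s
    refine ⟨T, ?_, ?_⟩
    · change _ ∧ _
      rw [hw]
      exact w.2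
    · rw [Function.comp_apply, naturalEmbedding_single, hw, hs]

/-- The straightening in the definition of `N_{d(T)}` is exactly the expansion of the natural vector
of its Young tableau, so it becomes invisible in tensor space. -/
theorem naturalEmbedding_naturalActionVector (hn : 2 * k ≤ n) (hlam : lam.card = n)
    (hm : (removeFirstRow lam).card ≤ k) (d : Diagram k) (T : StandardSPT k lam) :
    naturalEmbedding k n lam (naturalActionVector (n : ℂ) d T) =
      (diagramMatrix (Fin n) d).mulVec
        (symVec n T.1.symDiagram (naturalVector T.1.youngTableau)) := by
  subst hlam
  have hw := T.1.isSymmetricDiagram_symDiagram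
  rw [naturalActionVector]
  split_ifs with h
  · have hT' := h.choose_spec
    have hr := (SetPartitionTableau.exists_isAction_iff hn).1 h
    obtain ⟨σ, -, hσ⟩ := exists_twist hw hr
    rw [diagramMatrix_mulVec_symVec hw hr hσ, hT'.ofPerm_mul_naturalVector hσ, map_smul,
      hT'.removed_eq, naturalEmbedding, SetPartitionTableau.linearCombination_straightenedVector hn
        h.choose fun w t => symVec lam.card w (naturalVector t), hT'.symDiagram_eq]
    rw [isStraightening_straightening h.choose.youngTableau, map_sum]
    simp only [map_smul]
  · rw [map_zero, diagramMatrix_mulVec_symVec_eq_zero (by omega) hw fun hr =>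
      h ((SetPartitionTableau.exists_isAction_iff hn).2 hr)]

theorem naturalEmbedding_naturalAction (hn : 2 * k ≤ n) (hlam : lam.card = n)
    (hm : (removeFirstRow lam).card ≤ k) (a : PartitionAlgebra k (n : ℂ))
    (x : NaturalModule k lam) :
    naturalEmbedding k n lam (naturalAction k lam (n : ℂ) a x) =
      colourRep k n a (naturalEmbedding k n lam x) := by
  have h : (LinearMap.llcomp ℂ _ _ _ (naturalEmbedding k n lam)) ∘ₗ
        naturalAction k lam (n : ℂ) =
      (LinearMap.lcomp ℂ _ (naturalEmbedding k n lam)) ∘ₗ (colourRep k n).toLinearMap := by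
    refine PartitionAlgebra.lin_ext fun d => Finsupp.lhom_ext' fun T => LinearMap.ext_ring ?_
    change naturalEmbedding k n lam (naturalAction k lam (n : ℂ) (.ofDiagram _ d)
      (Finsupp.single T 1)) = colourRep k n (.ofDiagram _ d)
        (naturalEmbedding k n lam (Finsupp.single T 1))
    rw [naturalAction, PartitionAlgebra.lift_ofDiagram, Finsupp.linearCombination_single, one_smul,
      naturalEmbedding_naturalActionVector hn hlam hm, colourRep_ofDiagram,
      naturalEmbedding_single]
  exact congrArg (fun F => F a x) h

end Embedding

/-! ### The actions of the diagram algebras -/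

/-- The diagram algebra `A_k` as a subalgebra of the partition algebra. -/
noncomputable def DiagramFamily.algebra (X : DiagramFamily) (k : ℕ) (n : ℂ) :
    Subalgebra ℂ (PartitionAlgebra k n) :=
  (X.span k n).toSubalgebra (Submodule.subset_span ⟨_, X.mem_id, rfl⟩) (by
    intro a b ha hb
    induction ha using Submodule.span_induction with
    | mem a ha =>
      obtain ⟨d, hd, rfl⟩ := ha
      induction hb using Submodule.span_induction with
      | mem b hb =>
        obtain ⟨e, he, rfl⟩ := hb
        rw [PartitionAlgebra.ofDiagram_mul]
        exact Submodule.smul_mem _ _ (Submodule.subset_span ⟨_, hd.comp he, rfl⟩)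
      | zero => rw [mul_zero]; exact Submodule.zero_mem _
      | add x y _ _ hx hy => rw [mul_add]; exact Submodule.add_mem _ hx hy
      | smul r x _ hx => rw [mul_smul_comm]; exact Submodule.smul_mem _ _ hx
    | zero => rw [zero_mul]; exact Submodule.zero_mem _
    | add x y _ _ hx hy => rw [add_mul]; exact Submodule.add_mem _ hx hy
    | smul r x _ hx => rw [smul_mul_assoc]; exact Submodule.smul_mem _ _ hx)

/-! ### Irreducibility and the isomorphism -/

section Irreducible

variable {X : DiagramFamily} {k n : ℕ} {lam : YoungDiagram}

theorem symVec_ne_zero (hn : 2 * k ≤ n) {m : ℕ} {w : Diagram k} (hw : IsSymmetricDiagram m w)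
    {v : SymGroupAlgebra m} (hv : v ≠ 0) : symVec n w v ≠ 0 := fun h =>
  hv (symVec_eq_zero hn (ι := Unit) (w := fun _ => w) (Function.injective_of_subsingleton _)
    (fun _ => hw) (v := fun _ => v) (by simpa using h) ())

/-- Joining `w` to itself with the blocks permuted realises the permutation `π` on the summand of
`w`, up to a power of `n`. -/
theorem join_mulVec_symVec {m : ℕ} {w : Diagram k} (hw : IsSymmetricDiagram m w)
    (π : Equiv.Perm (Fin m)) (v : SymGroupAlgebra m) :
    (diagramMatrix (Fin n) (join w w π 1)).mulVec (symVec n w v) =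
      (n : ℂ) ^ removed (join w w π 1) w • symVec n w (ofPerm π * v) := by
  have hfull := isFull_half hw.2.1 π
  have h1 : comp (join w w π 1) (half w 1) = half w π := by
    have h2 : comp (join w w π 1) (half w (1 : Equiv.Perm (Fin m))) =
        comp (half w π) (comp (transpose (half w 1)) (half w 1)) := (comp_assoc_and_removed _ _ _).1
    rw [h2, (isFull_half hw.2.1 1).transpose_comp_self, (comp_id_and_removed _).1]
  have hr : rank (conj (join w w π 1) w) = m := by
    rw [← isFull_comp_half hw 1, h1]
    exact hfull
  have hc := conj_join (w₀ := w) hw hw hr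
  obtain ⟨σ, -, hσ⟩ := exists_twist hw hr
  have h2 := hσ 1
  rw [h1, hc, mul_one] at h2
  rw [diagramMatrix_mulVec_symVec hw hr hσ, hc, half_injective hw.2.1 h2]

theorem diagramMatrix_join_mulVec {m : ℕ} {w₁ w₀ : Diagram k} (h₁ : IsSymmetricDiagram m w₁)
    (τ σ : Equiv.Perm (Fin m)) (y : (Fin k → Fin n) → ℂ) :
    (diagramMatrix (Fin n) (join w₁ w₀ τ σ)).mulVec y =
      (diagramMatrix (Fin n) (half w₁ τ)).mulVec
        ((diagramMatrix (Fin n) (transpose (half w₀ σ))).mulVec y) := by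
  rw [Matrix.mulVec_mulVec, diagramMatrix_mul, removed_eq_zero _ (isFull_half h₁.2.1 τ).1, pow_zero,
    one_smul, join]

/-- The mirror image of a half diagram is a left inverse of it, up to a nonzero power of `n`. -/
theorem diagramMatrix_half_mulVec_ne_zero (hn : 2 * k ≤ n) {m : ℕ} {w : Diagram k}
    (hw : IsSymmetricDiagram m w) (τ : Equiv.Perm (Fin m)) {z : (Fin m → Fin n) → ℂ} (hz : z ≠ 0) :
    (diagramMatrix (Fin n) (half w τ)).mulVec z ≠ 0 := by
  intro h
  have h1 := congrArg (diagramMatrix (Fin n) (transpose (half w τ))).mulVec h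
  rw [Matrix.mulVec_mulVec, diagramMatrix_mul, (isFull_half hw.2.1 τ).transpose_comp_self,
    diagramMatrix_id, Matrix.mulVec_zero, Matrix.smul_mulVec, Matrix.one_mulVec] at h1
  refine (smul_ne_zero ?_ hz) h1
  rw [Fintype.card_fin]
  exact natCast_pow_removed_ne_zero hn _ _

/-- A joining diagram maps tensor space into the summand of its upper half. -/
theorem exists_join_mulVec (hn : 2 * k ≤ n) (hm : (removeFirstRow lam).card ≤ k)
    {w₁ w₀ : Diagram k} (h₁ : IsSymmetricDiagram (removeFirstRow lam).card w₁)
    (τ σ : Equiv.Perm (Fin (removeFirstRow lam).card)) (x : SymModule X k lam) :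
    ∃ v ∈ spechtModule (removeFirstRow lam),
      (diagramMatrix (Fin n) (join w₁ w₀ τ σ)).mulVec (symEmbedding X k n lam x) =
        symVec n w₁ v := by
  have := Fintype.ofFinite (X.SymDiagram k (removeFirstRow lam).card)
  obtain ⟨f, hf, -⟩ := symEmbedding_eq_sum (n := n) x
  have key : ∀ w : X.SymDiagram k (removeFirstRow lam).card,
      ∃ v ∈ spechtModule (removeFirstRow lam),
        (diagramMatrix (Fin n) (join w₁ w₀ τ σ)).mulVec (symVec n w.1 (f w).1) =
          symVec n w₁ v := by
    intro w
    by_cases hr : rank (conj (join w₁ w₀ τ σ) w.1) = (removeFirstRow lam).card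
    · obtain ⟨π, -, hπ⟩ := exists_twist w.2.2 hr
      refine ⟨(n : ℂ) ^ removed (join w₁ w₀ τ σ) w.1 • (ofPerm π • f w :
        spechtModule (removeFirstRow lam)).1, ?_, ?_⟩
      · exact Submodule.smul_of_tower_mem _ _ (Subtype.property _)
      · rw [diagramMatrix_mulVec_symVec w.2.2 hr hπ, conj_join h₁ w.2.2 hr, map_smul]
        rfl
    · exact ⟨0, Submodule.zero_mem _, by
        rw [diagramMatrix_mulVec_symVec_eq_zero (by omega) w.2.2 hr, map_zero]⟩
  choose v hv hv' using key
  refine ⟨∑ w, v w, Submodule.sum_mem _ fun w _ => hv w, ?_⟩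
  rw [hf, Matrix.mulVec_sum, map_sum]
  exact Finset.sum_congr rfl fun w _ => hv' w

theorem eq_top_of_tmul_mem {U : Submodule ℂ (SymModule X k lam)}
    (h : ∀ w v, TensorProduct.tmul ℂ (Finsupp.single w (1 : ℂ)) v ∈ U) : U = ⊤ := by
  refine eq_top_iff.2 fun x _ => ?_
  induction x using TensorProduct.induction_on with
  | zero => exact U.zero_mem
  | tmul f v =>
    induction f using Finsupp.induction_linear with
    | zero => rw [TensorProduct.zero_tmul]; exact U.zero_mem
    | add f g hf hg => rw [TensorProduct.add_tmul]; exact U.add_mem (hf trivial) (hg trivial)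
    | single w a =>
      rw [← mul_one a, ← smul_eq_mul, ← Finsupp.smul_single, ← TensorProduct.smul_tmul']
      exact U.smul_mem _ (h w v)
  | add x y hx hy => exact U.add_mem (hx trivial) (hy trivial)

variable {τ : X.algebra k (n : ℂ) →ₐ[ℂ] Module.End ℂ (SymModule X k lam)}

/-- The element of the diagram algebra given by a diagram. -/
noncomputable def DiagramFamily.algebraOf {d : Diagram k} (hd : X.Mem d) (n : ℂ) :
    X.algebra k n := ⟨.ofDiagram n d, Submodule.subset_span ⟨d, hd, rfl⟩⟩

/-- A nonzero invariant subspace meets every summand `w₁ ⊗ S_m` nontrivially, by positivity and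
joining diagrams. It then contains each summand, by irreducibility of the Specht module. -/
theorem isIrreducibleAction (hn : 2 * k ≤ n) (hX : X.IsIndex k lam)
    (hτ : ∀ a x, symEmbedding X k n lam (τ a x) =
      colourRep k n a (symEmbedding X k n lam x)) : IsIrreducibleAction τ := by
  have hinj := symEmbedding_injective (X := X) (lam := lam) hn
  have hd : ∀ {d : Diagram k} (hd : X.Mem d) (x : SymModule X k lam),
      symEmbedding X k n lam (τ (X.algebraOf hd n) x) =
        (diagramMatrix (Fin n) d).mulVec (symEmbedding X k n lam x) := fun hd x => by
    rw [hτ, ← colourRep_ofDiagram]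
    rfl
  have hp := Submodule.mem_span_singleton_self (R := SymGroupAlgebra (removeFirstRow lam).card)
    (youngSymmetrizer (removeFirstRow lam))
  refine ⟨?_, fun U hU => ?_⟩
  · obtain ⟨w, hw, hs⟩ := DiagramFamily.exists_symDiagram hX
    refine ⟨TensorProduct.tmul ℂ (Finsupp.single ⟨w, hw, hs⟩ (1 : ℂ)) ⟨_, hp⟩, 0, fun h => ?_⟩
    have h1 := symEmbedding_tmul (n := n) (⟨w, hw, hs⟩ : X.SymDiagram k _) ⟨_, hp⟩
    rw [h, map_zero] at h1
    exact symVec_ne_zero hn hs (youngSymmetrizer_ne_zero _) h1.symm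
  by_cases hbot : U = ⊥
  · exact Or.inl hbot
  right
  have := Fintype.ofFinite (X.SymDiagram k (removeFirstRow lam).card)
  obtain ⟨x, hxU, hx⟩ := (Submodule.ne_bot_iff U).1 hbot
  obtain ⟨f, hf, -⟩ := symEmbedding_eq_sum (n := n) x
  -- If all the transposed halves killed the image of `x`, it would be orthogonal to itself.
  obtain ⟨w₀, σ, hz⟩ : ∃ (w₀ : X.SymDiagram k (removeFirstRow lam).card)
      (σ : Equiv.Perm (Fin (removeFirstRow lam).card)),
      (diagramMatrix (Fin n) (transpose (half w₀.1 σ))).mulVec (symEmbedding X k n lam x) ≠ 0 := by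
    by_contra! hc
    exact hx (hinj ((eq_zero_of_transpose_mulVec hf hc).trans (map_zero _).symm))
  -- The same numbering `σ` is used on both halves, so that the joined diagram belongs to the planar
  -- families too. It factors through the lower half, which keeps the image of `x` nonzero, and the
  -- upper half, which is injective.
  have hmem : ∀ w₁ : X.SymDiagram k (removeFirstRow lam).card,
      ∃ v : spechtModule (removeFirstRow lam), v ≠ 0 ∧
        TensorProduct.tmul ℂ (Finsupp.single w₁ (1 : ℂ)) v ∈ U := by
    intro w₁
    obtain ⟨v, hv, he⟩ := exists_join_mulVec hn hX.card_le (w₀ := w₀.1) w₁.2.2 σ σ x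
    have hne := diagramMatrix_half_mulVec_ne_zero hn w₁.2.2 σ hz
    rw [← diagramMatrix_join_mulVec w₁.2.2, he] at hne
    refine ⟨⟨v, hv⟩, fun h => hne ?_, ?_⟩
    · rw [show v = 0 from congrArg Subtype.val h, map_zero]
    · convert hU (X.algebraOf (w₁.2.1.join w₁.2.2 w₀.2.2 w₀.2.1 fun _ => rfl) n) x hxU using 1
      exact hinj (by rw [symEmbedding_tmul, hd, he])
  refine eq_top_of_tmul_mem fun w₁ v' => ?_
  obtain ⟨v, hv, hvU⟩ := hmem w₁
  let N : Submodule ℂ (spechtModule (removeFirstRow lam)) :=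
    U.comap (TensorProduct.mk ℂ _ _ (Finsupp.single w₁ (1 : ℂ)))
  have hvN : v ∈ N := hvU
  change v' ∈ N
  -- Planar families contain no nontrivial permutations of the propagating blocks, but there `λ*`
  -- has one row and the Specht module is one-dimensional.
  by_cases hpl : X.Planar
  · obtain ⟨r, hr⟩ := spechtModule_oneRow (hX.oneRow hpl) v.2
    obtain ⟨r', hr'⟩ := spechtModule_oneRow (hX.oneRow hpl) v'.2
    have hr0 : r ≠ 0 := by
      rintro rfl
      exact hv (Subtype.ext (by rw [hr, zero_smul]; rfl))
    have : v' = (r' * r⁻¹) • v := Subtype.ext (by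
      change v'.1 = (r' * r⁻¹) • v.1
      rw [hr, hr', smul_smul, mul_assoc, inv_mul_cancel₀ hr0, mul_one])
    rw [this]
    exact N.smul_mem _ hvN
  · have hperm : ∀ (π : Equiv.Perm (Fin (removeFirstRow lam).card)) (u), u ∈ N →
        ofPerm π • u ∈ N := by
      intro π u hu
      have h1 := hU (X.algebraOf (w₁.2.1.join w₁.2.2 w₁.2.2 w₁.2.1
        (τ := π) (σ := 1) fun h => absurd h hpl) n) _ hu
      have h2 : (n : ℂ) ^ removed (join w₁.1 w₁.1 π 1) w₁.1 • (ofPerm π • u) ∈ N := by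
        change TensorProduct.tmul ℂ _ _ ∈ U
        convert h1 using 1
        refine hinj ?_
        rw [hd, TensorProduct.mk_apply, symEmbedding_tmul, symEmbedding_tmul,
          join_mulVec_symVec w₁.2.2, ← map_smul]
        rfl
      exact (N.smul_mem_iff (natCast_pow_removed_ne_zero hn _ _)).1 h2
    -- A subspace stable under all permutations is a submodule over the group algebra, which makes
    -- irreducibility of the Specht module applicable.
    let N' : Submodule (SymGroupAlgebra (removeFirstRow lam).card)
        (SymGroupAlgebra (removeFirstRow lam).card) :=
      Submodule.map (spechtModule (removeFirstRow lam)).subtype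
        { N with
          smul_mem' := fun y u hu => by
            have hu : u ∈ N := hu
            change y • u ∈ N
            rw [eq_sum_ofPerm y, Finset.sum_smul]
            refine N.sum_mem fun π _ => ?_
            rw [smul_assoc]
            exact N.smul_mem _ (hperm π u hu) }
    have hN' : ∀ u : spechtModule (removeFirstRow lam), u.1 ∈ N' ↔ u ∈ N := fun u =>
      ⟨fun ⟨u', hu', h⟩ => (Subtype.ext h : u' = u) ▸ hu', fun h => ⟨u, h, rfl⟩⟩
    rcases spechtModule_irreducible (U := N') (Submodule.map_subtype_le _ _) with h | h
    · have h1 := (hN' v).2 hvN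
      rw [h, Submodule.mem_bot] at h1
      exact absurd (Subtype.ext h1) hv
    · rw [← hN', h]
      exact v'.2

theorem isTwistedAction (hn : 2 * k ≤ n) (hm : (removeFirstRow lam).card ≤ k)
    (hτ : ∀ a x, symEmbedding X k n lam (τ a x) =
      colourRep k n a (symEmbedding X k n lam x)) : IsTwistedAction X lam τ := by
  have hinj := symEmbedding_injective (X := X) (lam := lam) hn
  intro a d hd had w v
  have ha : symEmbedding X k n lam (τ a (TensorProduct.tmul ℂ (Finsupp.single w (1 : ℂ)) v)) =
      (diagramMatrix (Fin n) d).mulVec (symVec n w.1 v.1) := by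
    rw [hτ, had, colourRep_ofDiagram, symEmbedding_tmul]
  refine ⟨fun hr => ?_, fun hr => hinj ?_⟩
  · obtain ⟨σ, hσ, hσ'⟩ := exists_twist w.2.2 hr
    refine ⟨⟨conj d w.1, hd.conj w.2.1, isSymmetricDiagram_conj w.2.2 hr⟩, σ, rfl, hσ, hinj ?_⟩
    rw [ha, diagramMatrix_mulVec_symVec w.2.2 hr hσ', map_smul]
    exact congrArg _ (symEmbedding_tmul (X := X)
      ⟨conj d w.1, hd.conj w.2.1, isSymmetricDiagram_conj w.2.2 hr⟩ (ofPerm σ • v)).symm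
  · rw [ha, diagramMatrix_mulVec_symVec_eq_zero (by omega) w.2.2 hr.ne, map_zero]

/-- The two modules are isomorphic, since they have the same image in tensor space. -/
theorem exists_actions (hn : 2 * k ≤ n) (hlam : lam.card = n) (hX : X.IsIndex k lam) :
    ∃ ρ : X.algebra k (n : ℂ) →ₐ[ℂ] Module.End ℂ (restrictedModule X k lam),
      (∀ (a : X.algebra k (n : ℂ)) (x : restrictedModule X k lam),
        (ρ a x : NaturalModule k lam) = naturalAction k lam (n : ℂ) a x) ∧
      ∃ τ : X.algebra k (n : ℂ) →ₐ[ℂ] Module.End ℂ (SymModule X k lam),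
        IsTwistedAction X lam τ ∧ IsIrreducibleAction τ ∧
        ∃ φ : restrictedModule X k lam ≃ₗ[ℂ] SymModule X k lam,
          ∀ (a : X.algebra k (n : ℂ)) (x : restrictedModule X k lam), φ (ρ a x) = τ a (φ x) := by
  let Φ : restrictedModule X k lam →ₗ[ℂ] ((Fin k → Fin n) → ℂ) :=
    naturalEmbedding k n lam ∘ₗ (restrictedModule X k lam).subtype
  let R : X.algebra k (n : ℂ) →ₐ[ℂ] Module.End ℂ ((Fin k → Fin n) → ℂ) :=
    (colourRep k n).comp (X.algebra k (n : ℂ)).val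
  have hΦ : Function.Injective Φ :=
    (naturalEmbedding_injective hn hlam).comp Subtype.val_injective
  have hΨ := symEmbedding_injective (X := X) (lam := lam) hn
  have hrange : LinearMap.range Φ = Submodule.span ℂ (standardVectors X k n lam) := by
    rw [LinearMap.range_comp, Submodule.range_subtype, map_restrictedModule hn hlam]
  obtain ⟨ρ, hρ⟩ := exists_restrict (M := restrictedModule X k lam) R (Ψ := Φ) hΦ fun a x => by
    rw [hrange]
    exact colourRep_mem hn hX.card_le a.2 (hrange ▸ LinearMap.mem_range_self Φ x)
  obtain ⟨τ, hτ⟩ := exists_restrict (M := SymModule X k lam) R (Ψ := symEmbedding X k n lam) hΨ fun a x => by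
    rw [range_symEmbedding]
    exact colourRep_mem hn hX.card_le a.2 (range_symEmbedding ▸ LinearMap.mem_range_self _ x)
  refine ⟨ρ, fun a x => naturalEmbedding_injective hn hlam ?_, τ,
    isTwistedAction hn hX.card_le hτ, isIrreducibleAction hn hX hτ, ?_⟩
  · rw [naturalEmbedding_naturalAction hn hlam hX.card_le]
    exact hρ a x
  · let φ := ((LinearEquiv.ofInjective Φ hΦ).trans (LinearEquiv.ofEq _ _
      (hrange.trans range_symEmbedding.symm))).trans (LinearEquiv.ofInjective _ hΨ).symm
    have hφ : ∀ x, symEmbedding X k n lam (φ x) = Φ x := fun x => by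
      have := (LinearEquiv.ofInjective _ hΨ).apply_symm_apply (LinearEquiv.ofEq _ _
        (hrange.trans range_symEmbedding.symm) (LinearEquiv.ofInjective Φ hΦ x))
      exact congrArg Subtype.val this
    exact ⟨φ, fun a x => hΨ (by rw [hφ, hρ, hτ, hφ])⟩

end Irreducible

end DiagramAlgebras

theorem mainTheorem11 (X : DiagramFamily) (k n : ℕ) (hn : 2 * k ≤ n) (lam : YoungDiagram)
    (hlam : lam.card = n) (hX : X.IsIndex k lam) :
    (∀ t : YoungTableau (removeFirstRow lam), ∃! c : StandardYoungTableau (removeFirstRow lam) → ℤ,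
      IsStraightening t c) ∧
    (∀ T : StandardSPT k lam, T ∈ restrictedSSPT X k lam ↔ X.HasShape T.1) ∧
    ∃ A : Subalgebra ℂ (PartitionAlgebra k (n : ℂ)),
      Subalgebra.toSubmodule A = X.span k (n : ℂ) ∧
      ∃ ρ : A →ₐ[ℂ] Module.End ℂ (restrictedModule X k lam),
        (∀ (a : A) (x : restrictedModule X k lam),
          (ρ a x : NaturalModule k lam) = naturalAction k lam (n : ℂ) a x) ∧
        ∃ τ : A →ₐ[ℂ] Module.End ℂ (SymModule X k lam),
          IsTwistedAction X lam τ ∧ IsIrreducibleAction τ ∧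
          ∃ φ : restrictedModule X k lam ≃ₗ[ℂ] SymModule X k lam,
            ∀ (a : A) (x : restrictedModule X k lam), φ (ρ a x) = τ a (φ x) := by
  exact ⟨existsUnique_isStraightening, SetPartitionTableau.mem_restrictedSSPT_iff X,
    X.algebra k (n : ℂ), Submodule.toSubalgebra_toSubmodule _ _ _, exists_actions hn hlam hX⟩
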